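/- **Setting.** Let $0<\delta<n$, $\varepsilon>0$, $1<r<\infty$ and $1<p<n/\delta$. Let $K(x,y)$ be a complex-valued function, locally integrable on $\{(x,y)\in\mathbb R^n\times\mathbb R^n: x\ne y\}$, such that for some constant $C$ $$|K(x,y)|\le C|x-y|^{-n+\delta}\quad (x\neq y),$$ $$|K(y,x)-K(z,x)|+|K(x,y)-K(x,z)|\le C|y-z|^{\varepsilon}|x-z|^{-n-\varepsilon+\delta}\quad\text{if } x\ne z,\ 2|y-z|\le|x-z|,$$ and let $T_\delta g(x)=\int_{\mathbb R^n}K(x,y)g(y)\,dy$ for bounded compactly supported $g$. Let $m_1,\dots,m_l$ be positive integers, $m=m_1+\dots+m_l$, and let $A_1,\dots,A_l$ be locally integrable functions on $\mathbb R^n$ having locally integrable weak derivatives $D^\alpha A_j$ for all $|\alpha|\le m_j$. Put $$R_{m_j+1}(A_j;x,y)=A_j(x)-\sum_{|\alpha|\le m_j}\frac1{\alpha!}D^\alpha A_j(y)(x-y)^\alpha,\qquad T_\delta^A g(x)=\int_{\mathbb R^n}\frac{\prod_{j=1}^lR_{m_j+1}(A_j;x,y)}{|x-y|^m}K(x,y)g(y)\,dy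 .$$ For a sequence $f=(f_i)_{i\ge1}$ of measurable functions put $|f|_r=(\sum_i|f_i|^r)^{1/r}$, $|T_\delta(f)|_r=(\sum_i|T_\delta f_i|^r)^{1/r}$ and $|T_\delta^A(f)|_r=(\sum_i|T_\delta^Af_i|^r)^{1/r}$. We say that $|T_\delta^A(f)|_r$ is *well defined* if for almost every $x$ all the integrals defining $T^A_\delta f_i(x)$ converge absolutely and $|T_\delta^A(f)(x)|_r<\infty$. Let $Q(x,d)$ be the cube with sides parallel to the axes, center $x$ and side length $d$, and $f_Q=|Q|^{-1}\int_Qf$. For locally integrable $f$ let $$\|f\|_{\mathrm{BMO}}=\sup_Q\frac1{|Q|}\int_Q|f-f_Q|,\qquad \|f\|_{\mathrm{CMO}}=\sup_{d>1}\frac1{|Q(0,d)|}\int_{Q(0,d)}|f-f_{Q(0,d)}|,$$ let $\mathrm{BMO}(\mathbb R^n)$ and $\mathrm{CMO}(\mathbb R^n)$ be the spaces of locally integrable functions for which these are finite, and let $$\|f\|_{B_p^\delta}=\sup_{\rho>1}\rho^{-n(1/p-\delta/n)}\|f\chi_{Q(0,\rho)}\|_{L^p}.$$ **Theorem 1.**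 Assume that $D^\alpha A_j\in\mathrm{BMO}(\mathbb R^n)$ for all $|\alpha|=m_j$, $j=1,\dots,l$, and that $|T_\delta|_r$ is bounded from $L^s$ to $L^t$ for all $s,t$ with $1<s<n/\delta$ and $1/t=1/s-\delta/n$, that is, for each such $s,t$ there is a constant $C$ with $\||T_\delta(f)|_r\|_{L^t}\le C\||f|_r\|_{L^s}$ for all sequences $f$ of bounded compactly supported measurable functions. Then: (a) $|T_\delta^A|_r$ maps $L^{n/\delta}(\mathbb R^n)$ continuously into $\mathrm{BMO}(\mathbb R^n)$: there is a constant $C$, independent of $f$, such that for every $f$ with $|f|_r\in L^{n/\delta}$ for which $|T_\delta^A(f)|_r$ is well defined, $|T_\delta^A(f)|_r\in\mathrm{BMO}(\mathbb R^n)$ and $\||T_\delta^A(f)|_r\|_{\mathrm{BMO}}\le C\||f|_r\|_{L^{n/\delta}}$. Moreover $|T_\delta^A(f)|_r$ is well defined whenever $|f|_r\in L^{n/\delta}$ has compact support. (b) $|T_\delta^A|_r$ maps $B_p^\delta(\mathbb R^n)$ continuously into $\mathrm{CMO}(\mathbb R^n)$: there is a constant $C$, independent of $f$, such that for every $f$ with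 $\||f|_r\|_{B_p^\delta}<\infty$ for which $|T_\delta^A(f)|_r$ is well defined, $|T_\delta^A(f)|_r\in\mathrm{CMO}(\mathbb R^n)$ and $\||T_\delta^A(f)|_r\|_{\mathrm{CMO}}\le C\||f|_r\|_{B_p^\delta}$. Moreover $|T_\delta^A(f)|_r$ is well defined whenever $\||f|_r\|_{B_p^\delta}<\infty$ and $|f|_r$ has compact support. -/

import Mathlib

open MeasureTheory
open scoped ENNReal NNReal

namespace FractionalMultilinear

noncomputable section

/-- Euclidean space `ℝⁿ`. -/
abbrev Rn (n : ℕ) : Type := EuclideanSpace ℝ (Fin n)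

/-- The (closed) cube `Q(x, d)` with sides parallel to the axes, center `x` and side length `d`. -/
def cube {n : ℕ} (x : Rn n) (d : ℝ) : Set (Rn n) :=
  {y | ∀ i, |y i - x i| ≤ d / 2}

section MeanOscillation

variable {n : ℕ} {F : Type*} [NormedAddCommGroup F] [NormedSpace ℝ F]

/-- The mean oscillation `|Q|⁻¹ ∫_Q |f(y) - f_Q| dy`, where `f_Q = |Q|⁻¹ ∫_Q f`. -/
def meanOsc (f : Rn n → F) (Q : Set (Rn n)) : ℝ≥0∞ :=
  (volume Q)⁻¹ * ∫⁻ y in Q, ‖f y - ⨍ z in Q, f z‖ₑ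

/-- The BMO seminorm: the supremum of the mean oscillations over all cubes. -/
def bmoNorm (f : Rn n → F) : ℝ≥0∞ :=
  ⨆ (x : Rn n) (d : ℝ) (_ : 0 < d), meanOsc f (cube x d)

/-- Membership in `BMO(ℝⁿ)`. -/
def MemBMO (f : Rn n → F) : Prop :=
  LocallyIntegrable f ∧ bmoNorm f < ∞

/-- The central BMO seminorm: the supremum of the mean oscillations over the cubes `Q(0, d)`
with `d > 1`. -/
def cmoNorm (f : Rn n → F) : ℝ≥0∞ :=
  ⨆ (d : ℝ) (_ : 1 < d), meanOsc f (cube 0 d)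

/-- Membership in `CMO(ℝⁿ)`. -/
def MemCMO (f : Rn n → F) : Prop :=
  LocallyIntegrable f ∧ cmoNorm f < ∞

end MeanOscillation

/-- The norm `sup_{ρ > 1} ρ ^ (-n (1/p - δ/n)) ‖u χ_{Q(0, ρ)}‖_{L^p}` of the space `B_p^δ(ℝⁿ)`,
for a function `u` with values in `[0, ∞]`. -/
def herzNorm {n : ℕ} (δ p : ℝ) (u : Rn n → ℝ≥0∞) : ℝ≥0∞ :=
  ⨆ (ρ : ℝ) (_ : 1 < ρ),
    ENNReal.ofReal (ρ ^ (-(n : ℝ) * (1 / p - δ / n))) *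
      eLpNorm u (ENNReal.ofReal p) (volume.restrict (cube 0 ρ))

/-- The pointwise `ℓ^r` norm `|f(x)|_r = (∑ᵢ |fᵢ(x)|^r)^{1/r}`, with values in `[0, ∞]`. -/
def vnorm {n : ℕ} (r : ℝ) (f : ℕ → Rn n → ℂ) (x : Rn n) : ℝ≥0∞ :=
  (∑' i, ‖f i x‖ₑ ^ r) ^ (1 / r)

section WeakDerivatives

variable {n : ℕ}

/-- The length `|α|` of a multi-index. -/
def mlen (α : Fin n → ℕ) : ℕ := ∑ i, α i

/-- The factorial `α!` of a multi-index. -/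
def mfact (α : Fin n → ℕ) : ℕ := ∏ i, (α i).factorial

/-- The monomial `x^α`. -/
def mpow (x : Rn n) (α : Fin n → ℕ) : ℝ := ∏ i, x i ^ α i

/-- The classical partial derivative in the `i`-th coordinate direction. -/
def partialDeriv (i : Fin n) (φ : Rn n → ℝ) : Rn n → ℝ :=
  fun x => fderiv ℝ φ x (EuclideanSpace.single i 1)

/-- The classical derivative `D^α φ` of a smooth function. -/
def classicalDeriv (α : Fin n → ℕ) (φ : Rn n → ℝ) : Rn n → ℝ :=
  (List.finRange n).foldr (fun i ψ => (partialDeriv i)^[α i] ψ) φ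

/-- `g` is the weak derivative `D^α u`; both functions are locally integrable. -/
def HasWeakDeriv (α : Fin n → ℕ) (u g : Rn n → ℂ) : Prop :=
  LocallyIntegrable u ∧ LocallyIntegrable g ∧
    ∀ φ : Rn n → ℝ, ContDiff ℝ (⊤ : ℕ∞) φ → HasCompactSupport φ →
      ∫ x, (classicalDeriv α φ x) • u x = (-1 : ℂ) ^ mlen α * ∫ x, φ x • g x

open Classical in
/-- The weak derivative `D^α u`, which is unique up to a null set (zero if there is none). -/
def weakDeriv (α : Fin n → ℕ) (u : Rn n → ℂ) : Rn n → ℂ :=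
  if h : ∃ g, HasWeakDeriv α u g then h.choose else 0

/-- The Taylor remainder
`R_{m+1}(A; x, y) = A(x) - ∑_{|α| ≤ m} (1/α!) D^α A(y) (x - y)^α`. -/
def taylorRemainder (m : ℕ) (A : Rn n → ℂ) (x y : Rn n) : ℂ :=
  A x - ∑ k ∈ Finset.range (m + 1), ∑ α ∈ Finset.piAntidiag Finset.univ k,
    (1 / (mfact α : ℂ)) * weakDeriv α A y * (mpow (x - y) α : ℂ)

end WeakDerivatives

section Operators

variable {n : ℕ}

/-- The kernels of fractional type: locally integrable off the diagonal, with the size condition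
of order `-n + δ` and the regularity condition of exponent `ε` in both variables. -/
structure IsFractionalKernel (δ ε : ℝ) (K : Rn n → Rn n → ℂ) : Prop where
  locallyIntegrableOn :
    LocallyIntegrableOn (fun z : Rn n × Rn n => K z.1 z.2) {z | z.1 ≠ z.2} volume
  size : ∃ C : ℝ, ∀ x y, x ≠ y → ‖K x y‖ ≤ C * ‖x - y‖ ^ (-(n : ℝ) + δ)
  regularity : ∃ C : ℝ, ∀ x y z, x ≠ z → 2 * ‖y - z‖ ≤ ‖x - z‖ →
    ‖K y x - K z x‖ + ‖K x y - K x z‖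
      ≤ C * ‖y - z‖ ^ ε * ‖x - z‖ ^ (-(n : ℝ) - ε + δ)

/-- The integral operator `g ↦ ∫ K(x, y) g(y) dy`. -/
def kernelOp (K : Rn n → Rn n → ℂ) (g : Rn n → ℂ) (x : Rn n) : ℂ :=
  ∫ y, K x y * g y

/-- The kernel `∏ⱼ R_{mⱼ+1}(Aⱼ; x, y) |x - y|^{-m} K(x, y)`, where `m = m₁ + ⋯ + m_l`. -/
def multiKernel {l : ℕ} (m : Fin l → ℕ) (A : Fin l → Rn n → ℂ) (K : Rn n → Rn n → ℂ)
    (x y : Rn n) : ℂ :=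
  (∏ j, taylorRemainder (m j) (A j) x y) / ((‖x - y‖ ^ (∑ j, m j) : ℝ) : ℂ) * K x y

/-- `|T(f)(x)|_r` for the integral operator `T` with kernel `K`. -/
def vectorOp (r : ℝ) (K : Rn n → Rn n → ℂ) (f : ℕ → Rn n → ℂ) : Rn n → ℝ≥0∞ :=
  vnorm r (fun i => kernelOp K (f i))

/-- `|T|_r` maps `L^s` continuously into `L^t`, the inequality being required only for sequences of
bounded functions with compact support, on which `T` is given by its kernel. -/
def BoundedLsLt (r s t : ℝ) (K : Rn n → Rn n → ℂ) : Prop :=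
  ∃ C : ℝ≥0, ∀ f : ℕ → Rn n → ℂ,
    (∀ i, AEStronglyMeasurable (f i) volume) →
    (∀ i, ∃ B : ℝ, ∀ x, ‖f i x‖ ≤ B) →
    (∀ i, HasCompactSupport (f i)) →
    eLpNorm (vectorOp r K f) (ENNReal.ofReal t) volume
      ≤ C * eLpNorm (vnorm r f) (ENNReal.ofReal s) volume

/-- `|T(f)|_r` is well defined: at almost every `x` the integrals defining `T(fᵢ)(x)` converge
absolutely, and `|T(f)(x)|_r` is finite. -/
def WellDefined (r : ℝ) (K : Rn n → Rn n → ℂ) (f : ℕ → Rn n → ℂ) : Prop :=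
  ∀ᵐ x, (∀ i, Integrable (fun y => K x y * f i y)) ∧ vectorOp r K f x < ∞

end Operators

end

end FractionalMultilinear

/-! Fix a ball B(c,ρ) and let W(y) be 1 plus the sum of the deviations |D^α A_j(y) - λ_α|, |α| =
m_j, where λ_α is the mean of D^α A_j over a cube around the ball. Everything rests on two pointwise
estimates for the kernel k of T_δ^A, valid for small η > 0 and almost all points x, x₀ in B(c,ρ)
(`exists_multiKernel_bound`): for y in B(c,8ρ), |k(x,y)| is at most a constant times W(y)^l ρ^{lη}
|x-y|^{δ-n-lη}; for y outside, |k(x,y) - k(x₀,y)| is at most a constant times W(y)^l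
(|y-c|/ρ)^{(l+1)η-min(1,ε)} |y-c|^{δ-n}.

By the John–Nirenberg inequality the averages of W^q over B(c,R), R ≥ ρ, grow no faster than
(R/ρ)^η, for every finite q and every η > 0. Hence W costs an arbitrarily small power, which the
integrability of |x-y|^{δ-n-lη} near the diagonal and the decay min(1,ε) far away absorb. The near
part is integrated over x first (Fubini); the far part is summed over dyadic scales as a geometric
series (`exists_oscillation_bound`). The only input on f is ‖ |f|_r ‖_{L^s(B(c,R))} ≤ N R^{n/s-δ}
for R ≥ ρ. This covers L^{n/δ} on all balls (s = n/δ, power zero) and B_p^δ on central balls (s =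
p), so (a) and (b) are two instances of one estimate, `exists_meanOsc_vectorOp_le`. Minkowski's
inequality replaces the sequence f by the scalar |f|_r.

For the pointwise bounds on R_{m+1}(A;x,y), the top coefficients D^α A(y) are replaced by λ_α. The
modified remainder is C¹ in x after mollification, and its x-derivatives are modified remainders of
order m-1; at order one the gradient is D_i A - λ_i. Morrey's inequality handles that case, the mean
value inequality the induction. The replaced coefficients contribute W(y)|x-y|^m. -/

namespace FractionalMultilinear

open Metric Filter Set
open scoped Topology

noncomputable section

/-! ### Volumes of Euclidean balls and comparison of approximating constants. -/

section Balls

variable {n : ℕ}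

theorem volume_closedBall (x : Rn n) {r : ℝ} (hr : 0 ≤ r) :
    volume (closedBall x r) = ENNReal.ofReal (r ^ n) * volume (ball (0 : Rn n) 1) := by
  simpa using Measure.addHaar_closedBall (volume : Measure (Rn n)) x hr

theorem volume_closedBall_mul (x y : Rn n) {a r : ℝ} (ha : 0 ≤ a) (hr : 0 ≤ r) :
    volume (closedBall x (a * r)) = ENNReal.ofReal (a ^ n) * volume (closedBall y r) := by
  rw [volume_closedBall x (mul_nonneg ha hr), volume_closedBall y hr, mul_pow,
    ENNReal.ofReal_mul (by positivity), mul_assoc]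

theorem volume_closedBall_ne_top (x : Rn n) (r : ℝ) : volume (closedBall x r) ≠ ∞ :=
  measure_closedBall_lt_top.ne

theorem volume_closedBall_ne_zero (x : Rn n) {r : ℝ} (hr : 0 < r) :
    volume (closedBall x r) ≠ 0 := (measure_closedBall_pos _ _ hr).ne'

/-- The constants `a` and `b` approximating `u` on two nested sets of comparable measure are
close to each other. -/
theorem enorm_sub_le_of_lintegral_le {F : Type*} [NormedAddCommGroup F] {u : Rn n → F} {a b : F}
    {s t : Set (Rn n)} (hst : s ⊆ t) (hs0 : volume s ≠ 0) (hs : volume s ≠ ∞) {α β θ : ℝ≥0∞}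
    (hθ : volume t ≤ θ * volume s)
    (hu : AEStronglyMeasurable u volume)
    (ha : ∫⁻ y in s, ‖u y - a‖ₑ ≤ α * volume s) (hb : ∫⁻ y in t, ‖u y - b‖ₑ ≤ β * volume t) :
    ‖a - b‖ₑ ≤ α + θ * β := by
  have h1 : ‖a - b‖ₑ * volume s ≤ (α + θ * β) * volume s := by
    calc ‖a - b‖ₑ * volume s = ∫⁻ y in s, ‖a - b‖ₑ := by simp
      _ ≤ ∫⁻ y in s, (‖u y - a‖ₑ + ‖u y - b‖ₑ) := by
          refine lintegral_mono fun y => ?_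
          have : a - b = -(u y - a) + (u y - b) := by abel
          calc ‖a - b‖ₑ = ‖-(u y - a) + (u y - b)‖ₑ := by rw [← this]
            _ ≤ ‖-(u y - a)‖ₑ + ‖u y - b‖ₑ := enorm_add_le _ _
            _ = _ := by rw [enorm_neg]
      _ = (∫⁻ y in s, ‖u y - a‖ₑ) + ∫⁻ y in s, ‖u y - b‖ₑ :=
          lintegral_add_left' ((hu.sub aestronglyMeasurable_const).enorm.mono_measure
            Measure.restrict_le_self) _
      _ ≤ α * volume s + β * (θ * volume s) := by
          refine add_le_add ha ?_
          exact (lintegral_mono_set hst).trans (hb.trans (by gcongr))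
      _ = _ := by ring
  rwa [ENNReal.mul_le_mul_iff_left hs0 hs] at h1

end Balls

/-! ### Calderón–Zygmund stopping argument with balls. -/

section JohnNirenberg

variable {n : ℕ}

/-- Stopping-time covering: on a ball where the mean oscillation of `u` about `c` is at most `N`,
the set where `|u - c| > L N` is covered by dilated disjoint balls of small total volume, on which
`u` still oscillates about constants near `c`. -/
theorem exists_stopping_cover {N L : ℝ} (hN : 0 < N) (hL : 1 < L) {u : Rn n → ℝ}
    (hu : LocallyIntegrable u)
    (hosc : ∀ (x : Rn n) (r : ℝ), 0 < r → ∃ c : ℝ,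
      ∫⁻ y in closedBall x r, ‖u y - c‖ₑ ≤ ENNReal.ofReal N * volume (closedBall x r))
    (x : Rn n) {r : ℝ} (hr : 0 < r) (c : ℝ)
    (hc : ∫⁻ y in closedBall x r, ‖u y - c‖ₑ ≤ ENNReal.ofReal N * volume (closedBall x r)) :
    ∃ (I : Set (Rn n)) (z : Rn n → Rn n) (ρ : Rn n → ℝ), I.Countable ∧ (∀ i ∈ I, 0 < ρ i) ∧
      (∀ᵐ y, y ∈ closedBall x r → ‖u y - c‖ₑ ≤ ENNReal.ofReal (L * N) ∨
        y ∈ ⋃ i ∈ I, closedBall (z i) (5 * ρ i)) ∧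
      ENNReal.ofReal L * ∑' i : I, volume (closedBall (z i) (ρ i)) ≤ volume (closedBall x r) ∧
      ∀ i ∈ I, ∃ c' : ℝ, ∫⁻ y in closedBall (z i) (5 * ρ i), ‖u y - c'‖ₑ
          ≤ ENNReal.ofReal N * volume (closedBall (z i) (5 * ρ i)) ∧
        ‖c' - c‖ₑ ≤ ENNReal.ofReal (L * N) + ENNReal.ofReal ((5 / 2) ^ n) * ENNReal.ofReal N := by
  have hLN : N < L * N := by nlinarith
  have hmeas : AEStronglyMeasurable u volume := hu.aestronglyMeasurable
  -- The balls B(w y k, δ k) shrink from B(x,r) at k = 0 to the point y. Each contains y and lies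
  -- inside B(x,r), which fails for balls centred at y when y is near the boundary. Lebesgue
  -- differentiation allows such off-centre balls.
  set w : Rn n → ℕ → Rn n := fun y k => y + (1 / 2 : ℝ) ^ k • (x - y) with hw
  set δ : ℕ → ℝ := fun k => (1 / 2 : ℝ) ^ k * r with hδ
  have hδpos : ∀ k, 0 < δ k := fun k => by positivity
  set G : Rn n → Prop := fun y => ∃ k, ENNReal.ofReal (L * N) * volume (closedBall (w y k) (δ k))
    < ∫⁻ z in closedBall (w y k) (δ k), ‖u z - c‖ₑ with hG
  classical
  set K : Rn n → ℕ := fun y => if h : G y then Nat.find h else 0 with hK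
  have hf : LocallyIntegrable (fun y => ‖u y - c‖) volume :=
    fun y => ((hu.sub (locallyIntegrable_const c)) y).norm
  have hae := IsUnifLocDoublingMeasure.ae_tendsto_average (volume : Measure (Rn n)) hf 1
  have hmem : ∀ y ∈ closedBall x r, ∀ k, y ∈ closedBall (w y k) (δ k) := by
    intro y hy k
    rw [mem_closedBall, dist_eq_norm, hw]
    simp only [sub_add_cancel_left, norm_neg, norm_smul, norm_pow, hδ]
    rw [mem_closedBall, dist_comm, dist_eq_norm] at hy
    norm_num
    gcongr
  have hδlim : Tendsto δ atTop (𝓝[>] 0) := by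
    refine tendsto_nhdsWithin_iff.2 ⟨?_, Eventually.of_forall hδpos⟩
    have := (tendsto_pow_atTop_nhds_zero_of_lt_one (r := (1 / 2 : ℝ)) (by norm_num)
      (by norm_num)).mul_const r
    simpa [hδ] using this
  have hgood : ∀ᵐ y, y ∈ closedBall x r → ‖u y - c‖ₑ ≤ ENNReal.ofReal (L * N) ∨ G y := by
    filter_upwards [hae] with y hy hyB
    by_contra! hcon
    obtain ⟨h1, h2⟩ := hcon
    have h1' : L * N < ‖u y - c‖ := by
      rw [← ofReal_norm] at h1
      exact (ENNReal.ofReal_lt_ofReal_iff_of_nonneg (by positivity)).1 h1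
    have ht := hy (w y) δ hδlim (Eventually.of_forall fun k => by
      simpa only [one_mul] using hmem y hyB k)
    obtain ⟨k, hk⟩ := (ht.eventually (lt_mem_nhds h1')).exists
    apply h2
    refine ⟨k, ?_⟩
    have hint : IntegrableOn (fun y => u y - c) (closedBall (w y k) (δ k)) :=
      ((hu.sub (locallyIntegrable_const c)).integrableOn_isCompact (isCompact_closedBall _ _))
    have hV : 0 < volume.real (closedBall (w y k) (δ k)) :=
      ENNReal.toReal_pos (volume_closedBall_ne_zero _ (hδpos k)) (volume_closedBall_ne_top _ _)
    rw [setAverage_eq, smul_eq_mul, ← div_eq_inv_mul, lt_div_iff₀ hV] at hk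
    rw [← ofReal_integral_norm_eq_lintegral_enorm hint]
    rw [← ENNReal.ofReal_toReal (volume_closedBall_ne_top (w y k) (δ k)),
      ← ENNReal.ofReal_mul (by positivity)]
    exact (ENNReal.ofReal_lt_ofReal_iff_of_nonneg (by positivity)).2 hk
  have hw0 : ∀ y, w y 0 = x := fun y => by simp [hw]
  have hsub1 : ∀ y ∈ closedBall x r, ∀ k, closedBall (w y k) (δ k) ⊆ closedBall x r := by
    intro y hy k
    apply closedBall_subset_closedBall'
    have : w y k - x = (1 - (1 / 2 : ℝ) ^ k) • (y - x) := by
      simp only [hw]; module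
    rw [dist_eq_norm, this, norm_smul]
    have h01 : (1 / 2 : ℝ) ^ k ≤ 1 := pow_le_one₀ (by norm_num) (by norm_num)
    rw [Real.norm_of_nonneg (by linarith)]
    rw [mem_closedBall, dist_eq_norm] at hy
    have := mul_le_mul_of_nonneg_left hy (sub_nonneg.2 h01)
    simp only [hδ]; linarith
  -- The centres are at most δ (k+1) apart and δ k = 2 δ (k+1), so dilation by 3 would do; 5 is the
  -- Vitali factor. Thus the last ball before stopping lies in the dilate of the stopping ball.
  have hsub2 : ∀ y ∈ closedBall x r, ∀ k,
      closedBall (w y k) (δ k) ⊆ closedBall (w y (k + 1)) (5 * δ (k + 1)) := by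
    intro y hy k
    apply closedBall_subset_closedBall'
    have : w y k - w y (k + 1) = (1 / 2 : ℝ) ^ (k + 1) • (x - y) := by
      simp only [hw, pow_succ]; module
    rw [dist_eq_norm, this, norm_smul, Real.norm_of_nonneg (by positivity)]
    rw [mem_closedBall, dist_comm, dist_eq_norm] at hy
    have := mul_le_mul_of_nonneg_left hy (show (0 : ℝ) ≤ (1 / 2) ^ (k + 1) by positivity)
    simp only [hδ]
    rw [pow_succ] at *
    nlinarith [show (0 : ℝ) < (1 / 2) ^ k * r by positivity]
  have hKspec : ∀ y, G y → ENNReal.ofReal (L * N) * volume (closedBall (w y (K y)) (δ (K y)))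
      < ∫⁻ z in closedBall (w y (K y)) (δ (K y)), ‖u z - c‖ₑ := by
    intro y hy
    simp only [hK, hy, dif_pos]
    exact Nat.find_spec hy
  have hKpos : ∀ y, G y → ∃ k, K y = k + 1 ∧
      ∫⁻ z in closedBall (w y k) (δ k), ‖u z - c‖ₑ ≤
        ENNReal.ofReal (L * N) * volume (closedBall (w y k) (δ k)) := by
    intro y hy
    rcases hk : K y with _ | k
    -- The stopping index is not 0: over B(x,r) itself the average is at most N < L N.
    · exfalso
      have h1 := hKspec y hy
      rw [hk, hw0] at h1
      simp only [hδ, pow_zero, one_mul] at h1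
      refine absurd (h1.trans_le hc) (not_lt.2 ?_)
      gcongr
    · refine ⟨k, rfl, ?_⟩
      have : k < Nat.find hy := by
        have : K y = Nat.find hy := by simp only [hK, hy, dif_pos]
        omega
      exact not_lt.1 (Nat.find_min hy this)
  obtain ⟨I, hIG, hdisj, hcov⟩ := Vitali.exists_disjoint_subfamily_covering_enlargement_closedBall
    {y | y ∈ closedBall x r ∧ G y} (fun y => w y (K y)) (fun y => δ (K y)) r
    (fun y _ => by
      simp only [hδ]
      exact mul_le_of_le_one_left hr.le (pow_le_one₀ (by norm_num) (by norm_num))) 5 (by norm_num)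
  have hIc : I.Countable := by
    refine hdisj.countable_of_nonempty_interior fun i _ => ?_
    exact (nonempty_ball.2 (hδpos _)).mono ball_subset_interior_closedBall
  refine ⟨I, fun y => w y (K y), fun y => δ (K y), hIc, fun i _ => hδpos _, ?_, ?_, ?_⟩
  · filter_upwards [hgood] with y hy hyB
    rcases hy hyB with h | h
    · exact Or.inl h
    · right
      obtain ⟨b, hb, hbs⟩ := hcov y ⟨hyB, h⟩
      exact mem_biUnion hb (hbs (hmem y hyB _))
  -- The selected balls are disjoint inside B(x,r) and on each the average of |u - c| exceeds L N,
  -- while the integral over B(x,r) is at most N times its volume.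
  · have h1 : ENNReal.ofReal N * (ENNReal.ofReal L *
        ∑' i : I, volume (closedBall (w i (K i)) (δ (K i))))
        ≤ ENNReal.ofReal N * volume (closedBall x r) := by
      calc _ = ∑' i : I, ENNReal.ofReal (L * N) * volume (closedBall (w i (K i)) (δ (K i))) := by
            rw [ENNReal.tsum_mul_left, ENNReal.ofReal_mul (by positivity)]; ring
        _ ≤ ∑' i : I, ∫⁻ z in closedBall (w i (K i)) (δ (K i)), ‖u z - c‖ₑ :=
            ENNReal.tsum_le_tsum fun i => (hKspec i (hIG i.2).2).le
        _ = ∫⁻ z in ⋃ i ∈ I, closedBall (w i (K i)) (δ (K i)), ‖u z - c‖ₑ :=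
            (lintegral_biUnion hIc (fun _ _ => measurableSet_closedBall) hdisj _).symm
        _ ≤ ∫⁻ z in closedBall x r, ‖u z - c‖ₑ :=
            lintegral_mono_set (iUnion₂_subset fun i hi => hsub1 i (hIG hi).1 _)
        _ ≤ _ := hc
    rwa [ENNReal.mul_le_mul_iff_right (by simpa using hN) ENNReal.ofReal_ne_top] at h1
  · intro i hi
    obtain ⟨k, hk, hkle⟩ := hKpos i (hIG hi).2
    obtain ⟨c', hc'⟩ := hosc (w i (K i)) (5 * δ (K i)) (by have := hδpos (K i); positivity)
    refine ⟨c', hc', ?_⟩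
    rw [← enorm_neg, neg_sub]
    simp only [hk] at hc' ⊢
    -- The constants c and c' are compared on the ball just before stopping, where minimality of the
    -- index keeps the average of |u - c| below L N. The dilated stopping ball has 5/2 times its
    -- radius.
    refine enorm_sub_le_of_lintegral_le (hsub2 i (hIG hi).1 k)
      (volume_closedBall_ne_zero _ (hδpos k)) (volume_closedBall_ne_top _ _) ?_ hmeas hkle hc'
    have : 5 * δ (k + 1) = 5 / 2 * δ k := by simp only [hδ, pow_succ]; ring
    rw [this, volume_closedBall_mul _ (w i k) (by norm_num) (hδpos k).le]

end JohnNirenberg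

/-! ### John–Nirenberg in `L^q` and slow growth of the approximating constants. -/

section JohnNirenberg

variable {n : ℕ}

/-- The John–Nirenberg inequality in `L^q`, for bounded real functions, with a constant independent
of the bound. -/
theorem exists_lintegral_rpow_le_of_bounded {N : ℝ} (hN : 0 < N) {q : ℝ} (hq : 1 ≤ q) :
    ∃ C : ℝ≥0, ∀ u : Rn n → ℝ, LocallyIntegrable u → ∀ M : ℝ, (∀ x, ‖u x‖ ≤ M) →
      (∀ (x : Rn n) (r : ℝ), 0 < r → ∃ c : ℝ,
        ∫⁻ y in closedBall x r, ‖u y - c‖ₑ ≤ ENNReal.ofReal N * volume (closedBall x r)) →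
      ∀ (x : Rn n) (r : ℝ) (c : ℝ), 0 < r →
        ∫⁻ y in closedBall x r, ‖u y - c‖ₑ ≤ ENNReal.ofReal N * volume (closedBall x r) →
        ∫⁻ y in closedBall x r, ‖u y - c‖ₑ ^ q ≤ C * volume (closedBall x r) := by
  have hq0 : 0 < q := by linarith
  -- The factor 2^(q-1) comes from convexity of the power q, 5^n from the dilation of the covering
  -- balls. Stopping at height L = 2κ makes the bad set contribute with factor 1/2.
  set κ : ℝ := (2 : ℝ) ^ (q - 1) * 5 ^ n with hκ
  have hκ1 : 1 ≤ κ := one_le_mul_of_one_le_of_one_le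
    (Real.one_le_rpow (by norm_num) (by linarith)) (one_le_pow₀ (by norm_num))
  have hL : 1 < 2 * κ := by linarith
  set Λ : ℝ≥0∞ := ENNReal.ofReal (2 * κ * N) with hΛ
  set D : ℝ≥0∞ := Λ + ENNReal.ofReal ((5 / 2) ^ n) * ENNReal.ofReal N with hD
  have hΛt : Λ ^ q ≠ ∞ := ENNReal.rpow_ne_top_of_nonneg hq0.le ENNReal.ofReal_ne_top
  have hDt : D ^ q ≠ ∞ := ENNReal.rpow_ne_top_of_nonneg hq0.le
    (ENNReal.add_ne_top.2 ⟨ENNReal.ofReal_ne_top,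
      ENNReal.mul_ne_top ENNReal.ofReal_ne_top ENNReal.ofReal_ne_top⟩)
  have hCt : 2 * Λ ^ q + D ^ q ≠ ∞ :=
    ENNReal.add_ne_top.2 ⟨ENNReal.mul_ne_top ENNReal.ofNat_ne_top hΛt, hDt⟩
  refine ⟨(2 * Λ ^ q + D ^ q).toNNReal, fun u hu M hM hosc x r c hr hc => ?_⟩
  rw [ENNReal.coe_toNNReal hCt]
  have hmeas : AEStronglyMeasurable u volume := hu.aestronglyMeasurable
  -- The supremum φ runs over all balls together with all admissible constants, because the stopping
  -- balls bring constants of their own.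
  set T : Set (Rn n × ℝ × ℝ) := {t | 0 < t.2.1 ∧ ∫⁻ y in closedBall t.1 t.2.1, ‖u y - t.2.2‖ₑ ≤
    ENNReal.ofReal N * volume (closedBall t.1 t.2.1)} with hT
  set g : Rn n × ℝ × ℝ → ℝ≥0∞ := fun t => (volume (closedBall t.1 t.2.1))⁻¹ *
    ∫⁻ y in closedBall t.1 t.2.1, ‖u y - t.2.2‖ₑ ^ q with hg
  set φ : ℝ≥0∞ := ⨆ t ∈ T, g t with hφ
  have hle : ∀ t ∈ T, ∫⁻ y in closedBall t.1 t.2.1, ‖u y - t.2.2‖ₑ ^ q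
      ≤ φ * volume (closedBall t.1 t.2.1) := by
    intro t ht
    have h1 : g t ≤ φ := le_biSup g ht
    simp only [hg] at h1
    rw [← ENNReal.div_eq_inv_mul, ENNReal.div_le_iff (volume_closedBall_ne_zero _ ht.1)
      (volume_closedBall_ne_top _ _)] at h1
    exact h1
  -- Boundedness of u enters here alone: φ must be finite to be absorbed below, but the size of this
  -- first bound is irrelevant.
  have hφt : φ ≠ ∞ := by
    refine ne_top_of_le_ne_top (b := (ENNReal.ofReal M + (ENNReal.ofReal M +
      1 * ENNReal.ofReal N)) ^ q) ?_ (iSup₂_le fun t ht => ?_)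
    · finiteness
    · have hV0 := volume_closedBall_ne_zero t.1 ht.1
      have hVt := volume_closedBall_ne_top t.1 t.2.1
      have hu' : ∀ y, ‖u y‖ₑ ≤ ENNReal.ofReal M := fun y => by
        rw [← ofReal_norm]; exact ENNReal.ofReal_le_ofReal (hM y)
      have h1 := enorm_sub_le_of_lintegral_le (a := 0) (α := ENNReal.ofReal M) (θ := 1)
        (Subset.refl _) hV0 hVt (by simp) hmeas (by
          simp only [sub_zero]
          calc _ ≤ ∫⁻ y in closedBall t.1 t.2.1, ENNReal.ofReal M := lintegral_mono fun y => hu' y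
            _ = _ := by simp) ht.2
      rw [zero_sub, enorm_neg] at h1
      simp only [hg]
      rw [← ENNReal.div_eq_inv_mul, ENNReal.div_le_iff hV0 hVt]
      calc _ ≤ ∫⁻ y in closedBall t.1 t.2.1, (ENNReal.ofReal M + (ENNReal.ofReal M +
              1 * ENNReal.ofReal N)) ^ q := by
            refine lintegral_mono fun y => ?_
            dsimp only
            gcongr
            exact (enorm_sub_le).trans (add_le_add (hu' y) h1)
        _ = _ := by simp
  have hstep : ∀ t ∈ T, g t ≤ Λ ^ q + (1 / 2) * (φ + D ^ q) := by
    rintro ⟨x, r, c⟩ ⟨hr, hc⟩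
    dsimp only at hr hc
    obtain ⟨I, z, ρ, hIc, hρ, hae, hsum, hI⟩ := exists_stopping_cover hN hL hu hosc x hr c hc
    have : Countable I := hIc.to_subtype
    simp only [hg]
    rw [← ENNReal.div_eq_inv_mul, ENNReal.div_le_iff (volume_closedBall_ne_zero _ hr)
      (volume_closedBall_ne_top _ _)]
    set U := ⋃ i ∈ I, closedBall (z i) (5 * ρ i) with hU
    have hUm : MeasurableSet U := MeasurableSet.biUnion hIc fun _ _ => measurableSet_closedBall
    have h1 : ∀ i : I, ∫⁻ y in closedBall (z i) (5 * ρ i), ‖u y - c‖ₑ ^ q ≤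
        ENNReal.ofReal κ * (φ + D ^ q) * volume (closedBall (z i) (ρ i)) := by
      intro i
      obtain ⟨c', hc', hcc'⟩ := hI i i.2
      have h5 : 0 < 5 * ρ i := by have := hρ i i.2; positivity
      calc ∫⁻ y in closedBall (z i) (5 * ρ i), ‖u y - c‖ₑ ^ q
          ≤ ∫⁻ y in closedBall (z i) (5 * ρ i), 2 ^ (q - 1) * (‖u y - c'‖ₑ ^ q + D ^ q) := by
            refine lintegral_mono fun y => ?_
            refine le_trans ?_ ((ENNReal.rpow_add_le_mul_rpow_add_rpow _ _ hq))
            gcongr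
            calc ‖u y - c‖ₑ = ‖(u y - c') + (c' - c)‖ₑ := by congr 1; ring
              _ ≤ _ := (enorm_add_le _ _).trans (by gcongr)
        _ = 2 ^ (q - 1) * ((∫⁻ y in closedBall (z i) (5 * ρ i), ‖u y - c'‖ₑ ^ q) +
              D ^ q * volume (closedBall (z i) (5 * ρ i))) := by
            rw [lintegral_const_mul' _ _ (by finiteness), lintegral_add_right _ measurable_const]
            simp
        _ ≤ 2 ^ (q - 1) * (φ * volume (closedBall (z i) (5 * ρ i)) +
              D ^ q * volume (closedBall (z i) (5 * ρ i))) := by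
            gcongr
            exact hle ⟨z i, 5 * ρ i, c'⟩ ⟨h5, hc'⟩
        _ = _ := by
            rw [volume_closedBall_mul _ (z i) (by norm_num) (hρ i i.2).le, hκ,
              ENNReal.ofReal_mul (by positivity), ← ENNReal.ofReal_rpow_of_pos (by norm_num)]
            simp only [ENNReal.ofReal_ofNat]
            ring
    calc ∫⁻ y in closedBall x r, ‖u y - c‖ₑ ^ q
        ≤ ∫⁻ y in closedBall x r, (Λ ^ q + U.indicator (fun y => ‖u y - c‖ₑ ^ q) y) := by
          refine lintegral_mono_ae ?_
          refine (ae_restrict_iff' measurableSet_closedBall).2 ?_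
          filter_upwards [hae] with y hy hyB
          rcases hy hyB with h | h
          · exact le_add_right (by gcongr)
          · rw [indicator_of_mem h]; exact le_add_self
      _ = Λ ^ q * volume (closedBall x r) +
            ∫⁻ y in closedBall x r, U.indicator (fun y => ‖u y - c‖ₑ ^ q) y := by
          rw [lintegral_add_left measurable_const]; simp
      _ ≤ Λ ^ q * volume (closedBall x r) + ∫⁻ y in U, ‖u y - c‖ₑ ^ q := by
          refine add_le_add le_rfl ?_
          rw [lintegral_indicator hUm]
          exact lintegral_mono' (Measure.restrict_mono_measure Measure.restrict_le_self _) le_rfl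
      _ ≤ Λ ^ q * volume (closedBall x r) + ∑' i : I,
            ENNReal.ofReal κ * (φ + D ^ q) * volume (closedBall (z i) (ρ i)) := by
          gcongr
          rw [hU, biUnion_eq_iUnion]
          exact (lintegral_iUnion_le _ _).trans (ENNReal.tsum_le_tsum h1)
      _ = Λ ^ q * volume (closedBall x r) + (1 / 2) * (φ + D ^ q) * (ENNReal.ofReal (2 * κ) *
            ∑' i : I, volume (closedBall (z i) (ρ i))) := by
          rw [ENNReal.tsum_mul_left, ENNReal.ofReal_mul (p := 2) (by norm_num), ENNReal.ofReal_ofNat]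
          congr 1
          calc _ = (2⁻¹ * 2) * (ENNReal.ofReal κ * (φ + D ^ q) *
                ∑' i : I, volume (closedBall (z i) (ρ i))) := by
                rw [ENNReal.inv_mul_cancel (by norm_num) (by norm_num), one_mul]
            _ = _ := by rw [one_div]; ring
      _ ≤ Λ ^ q * volume (closedBall x r) + (1 / 2) * (φ + D ^ q) * volume (closedBall x r) := by
          gcongr
      _ = _ := by ring
  -- Self-improvement: φ/2 moves to the left side, leaving a bound independent of M.
  have hφle : φ ≤ Λ ^ q + (1 / 2) * (φ + D ^ q) := iSup₂_le hstep
  have hfin : φ ≤ 2 * Λ ^ q + D ^ q := by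
    lift φ to ℝ≥0 using hφt with φ'
    lift Λ ^ q to ℝ≥0 using hΛt with a
    lift D ^ q to ℝ≥0 using hDt with d
    have : (1 / 2 : ℝ≥0∞) = ((1 / 2 : ℝ≥0) : ℝ≥0∞) := by simp
    rw [this] at hφle
    norm_cast at hφle ⊢
    have h2 : (φ' : ℝ) ≤ a + 1 / 2 * (φ' + d) := by exact_mod_cast hφle
    have : (φ' : ℝ) ≤ 2 * a + d := by linarith
    exact_mod_cast this
  exact (hle ⟨x, r, c⟩ ⟨hr, hc⟩).trans (by gcongr)

variable {F : Type*} [NormedAddCommGroup F]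

/-- The John–Nirenberg inequality in `L^q`. -/
theorem exists_lintegral_rpow_le {N : ℝ} (hN : 0 < N) {q : ℝ} (hq : 1 ≤ q) :
    ∃ C : ℝ≥0, ∀ (b : Rn n → F) (a : Rn n → ℝ → F), LocallyIntegrable b →
      (∀ (x : Rn n) (r : ℝ), 0 < r → ∫⁻ y in closedBall x r, ‖b y - a x r‖ₑ ≤
        ENNReal.ofReal N * volume (closedBall x r)) →
      ∀ (x : Rn n) (r : ℝ), 0 < r →
        ∫⁻ y in closedBall x r, ‖b y - a x r‖ₑ ^ q ≤ C * volume (closedBall x r) := by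
  obtain ⟨C, hC⟩ := exists_lintegral_rpow_le_of_bounded (n := n) hN hq
  refine ⟨C, fun b a hb ha x r hr => ?_⟩
  have hq0 : 0 < q := by linarith
  -- The map t ↦ min(|t - a x r|, k) is 1-Lipschitz, so the truncations oscillate no more than b,
  -- with the images of the a x' r' as constants; the constant of the ball at hand becomes 0.
  -- Monotone convergence removes k.
  set v : ℕ → Rn n → ℝ := fun k y => min ‖b y - a x r‖ k with hv
  have hbm : AEStronglyMeasurable (fun y => ‖b y - a x r‖) volume :=
    (hb.aestronglyMeasurable.sub aestronglyMeasurable_const).norm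
  have hvm : ∀ k, AEStronglyMeasurable (v k) volume := fun k =>
    (hbm.aemeasurable.min aemeasurable_const).aestronglyMeasurable
  have hvb : ∀ k y, ‖v k y‖ ≤ k := fun k y => by
    rw [Real.norm_of_nonneg (le_min (norm_nonneg _) (Nat.cast_nonneg _))]
    exact min_le_right _ _
  have hvi : ∀ k, LocallyIntegrable (v k) := fun k => by
    refine (locallyIntegrable_const (k : ℝ)).mono (hvm k) (Eventually.of_forall fun y => ?_)
    simpa using hvb k y
  have hk : ∀ k, ∫⁻ y in closedBall x r, ‖v k y‖ₑ ^ q ≤ C * volume (closedBall x r) := by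
    intro k
    have := hC (v k) (hvi k) k (hvb k) (fun x' r' hr' => ⟨min ‖a x' r' - a x r‖ k, ?_⟩) x r 0 hr ?_
    · simpa using this
    · refine le_trans (lintegral_mono fun y => ?_) (ha x' r' hr')
      rw [enorm_le_iff_norm_le, Real.norm_eq_abs]
      refine (abs_min_sub_min_le_max _ _ _ _).trans ?_
      rw [sub_self, abs_zero, max_eq_left (abs_nonneg _)]
      refine (abs_norm_sub_norm_le _ _).trans (le_of_eq ?_)
      congr 1; abel
    · refine le_trans (lintegral_mono fun y => ?_) (ha x r hr)
      rw [enorm_le_iff_norm_le, sub_zero,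
        Real.norm_of_nonneg (le_min (norm_nonneg _) (Nat.cast_nonneg _))]
      exact min_le_left _ _
  have hlim : Tendsto (fun k => ∫⁻ y in closedBall x r, ‖v k y‖ₑ ^ q) atTop
      (𝓝 (∫⁻ y in closedBall x r, ‖b y - a x r‖ₑ ^ q)) := by
    refine lintegral_tendsto_of_tendsto_of_monotone
      (fun k => ((hvm k).enorm.pow_const q).mono_measure Measure.restrict_le_self)
      (Eventually.of_forall fun y => ?_) (Eventually.of_forall fun y => ?_)
    · intro i j hij
      dsimp only
      gcongr
      rw [enorm_le_iff_norm_le, Real.norm_of_nonneg (le_min (norm_nonneg _) (Nat.cast_nonneg _)),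
        Real.norm_of_nonneg (le_min (norm_nonneg _) (Nat.cast_nonneg _))]
      exact min_le_min le_rfl (by exact_mod_cast hij)
    · refine tendsto_const_nhds.congr' ?_
      obtain ⟨k, hk⟩ := exists_nat_ge ‖b y - a x r‖
      filter_upwards [eventually_ge_atTop k] with j hj
      have : v j y = ‖b y - a x r‖ := min_eq_left (hk.trans (by exact_mod_cast hj))
      rw [this, enorm_norm]
  exact le_of_tendsto' hlim hk

/-- The approximating constants on concentric balls grow slowly. -/
theorem exists_enorm_sub_le_rpow {N : ℝ} (hN : 0 < N) {η : ℝ} (hη : 0 < η) :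
    ∃ C : ℝ, 0 ≤ C ∧ ∀ (b : Rn n → F) (a : Rn n → ℝ → F), LocallyIntegrable b →
      (∀ (x : Rn n) (r : ℝ), 0 < r → ∫⁻ y in closedBall x r, ‖b y - a x r‖ₑ ≤
        ENNReal.ofReal N * volume (closedBall x r)) →
      ∀ (x : Rn n) (ρ R : ℝ), 0 < ρ → ρ ≤ R → ‖a x ρ - a x R‖ ≤ C * (R / ρ) ^ η := by
  set D : ℝ := N + 2 ^ n * N with hD
  have hD0 : 0 < D := by positivity
  have hl2 : 0 < Real.log 2 := Real.log_pos (by norm_num)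
  -- Each doubling of the radius moves the constant by at most D. There are at most log(R/ρ)/log 2 ≤
  -- (R/ρ)^η/(η log 2) doublings and one incomplete step.
  refine ⟨(1 / (η * Real.log 2) + 1) * D, by positivity, fun b a hb ha x ρ R hρ hR => ?_⟩
  have hone : ∀ s t : ℝ, 0 < s → s ≤ t → t ≤ 2 * s → ‖a x s - a x t‖ ≤ D := by
    intro s t hs hst hts
    have h := enorm_sub_le_of_lintegral_le (θ := ENNReal.ofReal (2 ^ n))
      (closedBall_subset_closedBall hst)
      (volume_closedBall_ne_zero x hs) (volume_closedBall_ne_top x s) (by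
        rw [← volume_closedBall_mul x x (by norm_num) hs.le]
        exact measure_mono (closedBall_subset_closedBall hts)) hb.aestronglyMeasurable (ha x s hs)
      (ha x t (hs.trans_le hst))
    rw [← ENNReal.ofReal_mul (by positivity), ← ENNReal.ofReal_add (by positivity) (by positivity),
      ← ofReal_norm] at h
    exact (ENNReal.ofReal_le_ofReal_iff hD0.le).1 h
  have hchain : ∀ k : ℕ, ‖a x ρ - a x (2 ^ k * ρ)‖ ≤ k * D := by
    intro k
    induction k with
    | zero => simp
    | succ k ih =>
      have h1 := hone (2 ^ k * ρ) (2 ^ (k + 1) * ρ) (by positivity)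
        (by rw [pow_succ]; nlinarith [show (0 : ℝ) < 2 ^ k * ρ by positivity])
        (by rw [pow_succ]; linarith)
      have h2 := norm_sub_le_norm_sub_add_norm_sub (a x ρ) (a x (2 ^ k * ρ)) (a x (2 ^ (k + 1) * ρ))
      push_cast
      linarith
  obtain ⟨k, hk1, hk2⟩ := exists_nat_pow_near (x := R / ρ) (y := 2)
    ((one_le_div hρ).2 hR) (by norm_num)
  rw [le_div_iff₀ hρ] at hk1
  rw [div_lt_iff₀ hρ] at hk2
  have h1 := hone (2 ^ k * ρ) R (by positivity) hk1 (by rw [pow_succ] at hk2; linarith)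
  have h2 := norm_sub_le_norm_sub_add_norm_sub (a x ρ) (a x (2 ^ k * ρ)) (a x R)
  have h3 : (k : ℝ) * Real.log 2 ≤ (R / ρ) ^ η / η := by
    rw [← Real.log_pow]
    refine (Real.log_le_rpow_div (by positivity) hη).trans ?_
    gcongr
    rwa [le_div_iff₀ hρ]
  have h4 : 1 ≤ (R / ρ) ^ η := Real.one_le_rpow ((one_le_div hρ).2 hR) hη.le
  have h5 : (k : ℝ) ≤ 1 / (η * Real.log 2) * (R / ρ) ^ η := by
    rw [← le_div_iff₀ hl2] at h3
    refine h3.trans (le_of_eq ?_)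
    field_simp
  have h6 := hchain k
  calc ‖a x ρ - a x R‖ ≤ (k + 1) * D := by linarith
    _ ≤ (1 / (η * Real.log 2) * (R / ρ) ^ η + (R / ρ) ^ η) * D := by gcongr
    _ = _ := by ring

/-- Growth of the `L^q` oscillation about the constant of a smaller concentric ball. -/
theorem exists_lintegral_rpow_le_growth {N : ℝ} (hN : 0 < N) {q : ℝ} (hq : 1 ≤ q) {η : ℝ}
    (hη : 0 < η) :
    ∃ C : ℝ, 0 ≤ C ∧ ∀ (b : Rn n → F) (a : Rn n → ℝ → F), LocallyIntegrable b →
      (∀ (x : Rn n) (r : ℝ), 0 < r → ∫⁻ y in closedBall x r, ‖b y - a x r‖ₑ ≤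
        ENNReal.ofReal N * volume (closedBall x r)) →
      ∀ (x : Rn n) (ρ R : ℝ), 0 < ρ → ρ ≤ R →
        ∫⁻ y in closedBall x R, ‖b y - a x ρ‖ₑ ^ q ≤
          ENNReal.ofReal (C * (R / ρ) ^ η) * volume (closedBall x R) := by
  have hq0 : 0 < q := by linarith
  obtain ⟨C, hC⟩ := exists_lintegral_rpow_le (n := n) (F := F) hN hq
  -- Growth exponent η/q, since the difference of constants is raised to the power q.
  obtain ⟨C', hC'0, hC'⟩ := exists_enorm_sub_le_rpow (n := n) (F := F) hN (div_pos hη hq0)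
  refine ⟨2 ^ (q - 1) * (C + C' ^ q), by positivity, fun b a hb ha x ρ R hρ hR => ?_⟩
  have hd := hC' b a hb ha x ρ R hρ hR
  have hR0 : 0 < R := hρ.trans_le hR
  have h4 : 1 ≤ (R / ρ) ^ η := Real.one_le_rpow ((one_le_div hρ).2 hR) hη.le
  calc ∫⁻ y in closedBall x R, ‖b y - a x ρ‖ₑ ^ q
      ≤ ∫⁻ y in closedBall x R, 2 ^ (q - 1) *
          (‖b y - a x R‖ₑ ^ q + ENNReal.ofReal (C' ^ q * (R / ρ) ^ η)) := by
        refine lintegral_mono fun y => ?_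
        have h1 : ‖b y - a x ρ‖ₑ ≤ ‖b y - a x R‖ₑ + ENNReal.ofReal (C' * (R / ρ) ^ (η / q)) := by
          calc ‖b y - a x ρ‖ₑ = ‖(b y - a x R) + -(a x ρ - a x R)‖ₑ := by congr 1; abel
            _ ≤ ‖b y - a x R‖ₑ + ‖-(a x ρ - a x R)‖ₑ := enorm_add_le _ _
            _ ≤ _ := by
              rw [enorm_neg]
              gcongr
              rw [← ofReal_norm]
              exact ENNReal.ofReal_le_ofReal hd
        have h2 : ENNReal.ofReal (C' ^ q * (R / ρ) ^ η)
            = ENNReal.ofReal (C' * (R / ρ) ^ (η / q)) ^ q := by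
          rw [ENNReal.ofReal_rpow_of_nonneg (by positivity) hq0.le,
            Real.mul_rpow hC'0 (by positivity), ← Real.rpow_mul (by positivity),
            div_mul_cancel₀ _ hq0.ne']
        rw [h2]
        exact (ENNReal.rpow_le_rpow h1 hq0.le).trans
          (ENNReal.rpow_add_le_mul_rpow_add_rpow _ _ hq)
    _ = 2 ^ (q - 1) * ((∫⁻ y in closedBall x R, ‖b y - a x R‖ₑ ^ q) +
          ENNReal.ofReal (C' ^ q * (R / ρ) ^ η) * volume (closedBall x R)) := by
        rw [lintegral_const_mul' _ _ (by finiteness), lintegral_add_right _ measurable_const]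
        simp
    _ ≤ 2 ^ (q - 1) * (ENNReal.ofReal (C * (R / ρ) ^ η) * volume (closedBall x R) +
          ENNReal.ofReal (C' ^ q * (R / ρ) ^ η) * volume (closedBall x R)) := by
        gcongr
        refine (hC b a hb ha x R hR0).trans ?_
        gcongr
        rw [← ENNReal.ofReal_coe_nnreal]
        exact ENNReal.ofReal_le_ofReal (le_mul_of_one_le_right C.2 h4)
    _ = _ := by
        rw [← add_mul, ← ENNReal.ofReal_add (by positivity) (by positivity), ← mul_assoc]
        congr 1
        rw [← ENNReal.ofReal_ofNat, ENNReal.ofReal_rpow_of_pos (by norm_num),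
          ← ENNReal.ofReal_mul (by positivity)]
        congr 1
        ring

end JohnNirenberg

/-! ### Morrey's inequality: Hölder continuity from growth of the gradient's integral. -/

section Morrey

variable {n : ℕ}

theorem lintegral_closedBall_comp_affine {h : Rn n → ℝ≥0∞} (hh : Measurable h) (x : Rn n)
    {s t : ℝ} (ht : 0 < t) :
    ∫⁻ w in closedBall 0 s, h (x + t • w) =
      ENNReal.ofReal ((t ^ n)⁻¹) * ∫⁻ y in closedBall x (t * s), h y := by
  set F : Rn n → ℝ≥0∞ := (closedBall x (t * s)).indicator h with hF
  have hFm : Measurable F := hh.indicator measurableSet_closedBall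
  have h1 : ∀ w, F (x + t • w) = (closedBall (0 : Rn n) s).indicator (fun w => h (x + t • w)) w := by
    intro w
    have : x + t • w ∈ closedBall x (t * s) ↔ w ∈ closedBall (0 : Rn n) s := by
      rw [mem_closedBall, mem_closedBall, dist_eq_norm, dist_eq_norm, add_sub_cancel_left, sub_zero,
        norm_smul, Real.norm_of_nonneg ht.le, mul_le_mul_iff_right₀ ht]
    by_cases hw : w ∈ closedBall (0 : Rn n) s
    · rw [indicator_of_mem hw, hF, indicator_of_mem (this.2 hw)]
    · rw [indicator_of_notMem hw, hF, indicator_of_notMem (fun hc => hw (this.1 hc))]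
  rw [← lintegral_indicator measurableSet_closedBall, ← lintegral_indicator measurableSet_closedBall,
    ← hF]
  calc _ = ∫⁻ w, F (x + t • w) := by simp_rw [h1]
    _ = ∫⁻ v, F (x + v) ∂(Measure.map (t • ·) volume) := by
        rw [lintegral_map (by fun_prop) (by fun_prop)]
    _ = ENNReal.ofReal ((t ^ n)⁻¹) * ∫⁻ v, F (x + v) := by
        rw [Measure.map_addHaar_smul _ ht.ne', lintegral_smul_measure, smul_eq_mul,
          finrank_euclideanSpace, Fintype.card_fin, abs_of_pos (by positivity)]
    _ = _ := by rw [lintegral_add_left_eq_self]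

variable {F : Type*} [NormedAddCommGroup F] [NormedSpace ℝ F] [CompleteSpace F]

theorem enorm_sub_le_lintegral_fderiv {g : Rn n → F} (hg : ContDiff ℝ 1 g) (x w : Rn n) :
    ‖g (x + w) - g x‖ₑ ≤ ∫⁻ t in Ioc (0 : ℝ) 1, ‖fderiv ℝ g (x + t • w)‖ₑ * ‖w‖ₑ := by
  have hc : Continuous (fderiv ℝ g) := hg.continuous_fderiv one_ne_zero
  have hd : ∀ t : ℝ, HasDerivAt (fun t : ℝ => g (x + t • w)) (fderiv ℝ g (x + t • w) w) t := by
    intro t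
    have h1 : HasDerivAt (fun t : ℝ => x + t • w) w t := by
      simpa using ((hasDerivAt_id t).smul_const w).const_add x
    exact ((hg.differentiable one_ne_zero _).hasFDerivAt).comp_hasDerivAt t h1
  have hint : IntervalIntegrable (fun t : ℝ => fderiv ℝ g (x + t • w) w) volume 0 1 := by
    apply Continuous.intervalIntegrable
    exact (hc.comp (by fun_prop)).clm_apply continuous_const
  have h := intervalIntegral.integral_eq_sub_of_hasDerivAt (fun t _ => hd t) hint
  simp only [one_smul, zero_smul, add_zero] at h
  rw [← h, intervalIntegral.integral_of_le zero_le_one]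
  refine (enorm_integral_le_lintegral_enorm _).trans (lintegral_mono fun t => ?_)
  exact ContinuousLinearMap.le_opENorm _ _

/-- Integrate the gradient along segments from x and exchange integrals. The dilation by t turns the
ball of radius s into that of radius ts, and the growth condition leaves t^(-η), integrable on (0,1]
because η < 1. -/
theorem lintegral_closedBall_enorm_sub_le {g : Rn n → F} (hg : ContDiff ℝ 1 g) {κ η : ℝ}
    (hκ : 0 ≤ κ) (hη : η < 1) (x : Rn n) {s : ℝ} (hs : 0 < s)
    (h : ∀ t, 0 < t → t ≤ s →
      ∫⁻ y in closedBall x t, ‖fderiv ℝ g y‖ₑ ≤ ENNReal.ofReal (κ * t ^ ((n : ℝ) - η))) :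
    ∫⁻ y in closedBall x s, ‖g y - g x‖ₑ ≤
      ENNReal.ofReal (κ / (1 - η) * s ^ ((n : ℝ) + 1 - η)) := by
  have hc : Continuous (fderiv ℝ g) := hg.continuous_fderiv one_ne_zero
  have h0 := lintegral_closedBall_comp_affine (n := n) (h := fun y => ‖g y - g x‖ₑ)
    (hg.continuous.sub continuous_const).enorm.measurable x (s := s) one_pos
  simp only [one_smul, one_pow, inv_one, ENNReal.ofReal_one, one_mul] at h0
  rw [← h0]
  calc ∫⁻ w in closedBall 0 s, ‖g (x + w) - g x‖ₑ
      ≤ ∫⁻ w in closedBall 0 s, ∫⁻ t in Ioc (0 : ℝ) 1, ‖fderiv ℝ g (x + t • w)‖ₑ * ‖w‖ₑ :=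
        lintegral_mono fun w => enorm_sub_le_lintegral_fderiv hg x w
    _ = ∫⁻ t in Ioc (0 : ℝ) 1, ∫⁻ w in closedBall 0 s, ‖fderiv ℝ g (x + t • w)‖ₑ * ‖w‖ₑ := by
        have hm : Measurable fun p : Rn n × ℝ => ‖fderiv ℝ g (x + p.2 • p.1)‖ₑ * ‖p.1‖ₑ :=
          Measurable.mul (hc.comp (by fun_prop :
            Continuous fun p : Rn n × ℝ => x + p.2 • p.1)).enorm.measurable measurable_fst.enorm
        exact lintegral_lintegral_swap hm.aemeasurable
    _ ≤ ∫⁻ t in Ioc (0 : ℝ) 1, ENNReal.ofReal (κ * s ^ ((n : ℝ) + 1 - η) * t ^ (-η)) := by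
        refine setLIntegral_mono (by fun_prop) fun t ht => ?_
        calc ∫⁻ w in closedBall 0 s, ‖fderiv ℝ g (x + t • w)‖ₑ * ‖w‖ₑ
            ≤ ∫⁻ w in closedBall 0 s, ‖fderiv ℝ g (x + t • w)‖ₑ * ENNReal.ofReal s := by
              refine setLIntegral_mono (by fun_prop) fun w hw => ?_
              gcongr
              rw [← ofReal_norm]
              exact ENNReal.ofReal_le_ofReal (by simpa using hw)
          _ = ENNReal.ofReal ((t ^ n)⁻¹) * (∫⁻ y in closedBall x (t * s), ‖fderiv ℝ g y‖ₑ) *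
                ENNReal.ofReal s := by
              rw [lintegral_mul_const' _ _ ENNReal.ofReal_ne_top,
                lintegral_closedBall_comp_affine (h := fun y => ‖fderiv ℝ g y‖ₑ) (by fun_prop) x
                  ht.1]
          _ ≤ ENNReal.ofReal ((t ^ n)⁻¹) * ENNReal.ofReal (κ * (t * s) ^ ((n : ℝ) - η)) *
                ENNReal.ofReal s := by
              gcongr
              exact h _ (mul_pos ht.1 hs) (mul_le_of_le_one_left hs.le ht.2)
          _ = _ := by
              have ht0 := ht.1
              rw [← ENNReal.ofReal_mul (by positivity), ← ENNReal.ofReal_mul (by positivity)]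
              congr 1
              rw [Real.mul_rpow ht0.le hs.le, show (n : ℝ) + 1 - η = (n - η) + 1 by ring,
                Real.rpow_add_one hs.ne', Real.rpow_sub ht0, Real.rpow_natCast, Real.rpow_neg ht0.le]
              field_simp
    _ = _ := by
        have hI : IntervalIntegrable (fun t : ℝ => κ * s ^ ((n : ℝ) + 1 - η) * t ^ (-η))
            volume 0 1 :=
          (intervalIntegral.intervalIntegrable_rpow' (by linarith)).const_mul _
        rw [← ofReal_integral_eq_lintegral_ofReal
          ((intervalIntegrable_iff_integrableOn_Ioc_of_le zero_le_one).1 hI)]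
        · rw [← intervalIntegral.integral_of_le zero_le_one, intervalIntegral.integral_const_mul,
            integral_rpow (Or.inl (by linarith))]
          congr 1
          rw [Real.one_rpow, Real.zero_rpow (by linarith), show -η + 1 = 1 - η by ring]
          ring
        · refine (ae_restrict_iff' measurableSet_Ioc).2 (Eventually.of_forall fun t ht => ?_)
          have := ht.1
          positivity

/-- Morrey's inequality. -/
theorem exists_morrey (n : ℕ) {η : ℝ} (hη : η < 1) :
    ∃ C : ℝ, 0 ≤ C ∧ ∀ (g : Rn n → F) (κ R : ℝ) (c : Rn n), ContDiff ℝ 1 g → 0 ≤ κ →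
      (∀ x ∈ closedBall c R, ∀ t, 0 < t → t ≤ 2 * R →
        ∫⁻ y in closedBall x t, ‖fderiv ℝ g y‖ₑ ≤ ENNReal.ofReal (κ * t ^ ((n : ℝ) - η))) →
      ∀ x ∈ closedBall c R, ∀ y ∈ closedBall c R, ‖g x - g y‖ ≤ C * κ * ‖x - y‖ ^ (1 - η) := by
  have hη' : 0 < 1 - η := by linarith
  set v : ℝ := volume.real (ball (0 : Rn n) 1) with hv
  have hv0 : 0 < v := ENNReal.toReal_pos (measure_ball_pos _ _ one_pos).ne' measure_ball_lt_top.ne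
  refine ⟨2 ^ n * 2 / ((1 - η) * v), by positivity, fun g κ R c hg hκ h x hx y hy => ?_⟩
  rcases eq_or_ne x y with rfl | hxy
  · simp only [sub_self, norm_zero]; positivity
  set s := ‖x - y‖ with hs
  have hs0 : 0 < s := norm_pos_iff.2 (sub_ne_zero.2 hxy)
  have hsR : s ≤ 2 * R := by
    rw [mem_closedBall, dist_eq_norm] at hx hy
    have : x - y = (x - c) - (y - c) := by abel
    rw [hs, this]
    exact (norm_sub_le _ _).trans (by linarith)
  have hgc := hg.continuous
  -- The ball of radius s/2 about the midpoint lies in both B(x,s) and B(y,s), so g(x) and g(y) can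
  -- be compared there through the values of g.
  set z : Rn n := (1 / 2 : ℝ) • (x + y) with hz
  have hzx : closedBall z (1 / 2 * s) ⊆ closedBall x s := by
    apply closedBall_subset_closedBall'
    rw [dist_eq_norm, show z - x = -((1 / 2 : ℝ) • (x - y)) by simp only [hz]; module, norm_neg,
      norm_smul, ← hs]
    norm_num; linarith
  have hzy : closedBall z (1 / 2 * s) ⊆ closedBall y s := by
    apply closedBall_subset_closedBall'
    rw [dist_eq_norm, show z - y = (1 / 2 : ℝ) • (x - y) by simp only [hz]; module,
      norm_smul, ← hs]
    norm_num; linarith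
  have hb : ∀ x ∈ closedBall c R, ∫⁻ w in closedBall x s, ‖g w - g x‖ₑ ≤
      ENNReal.ofReal (κ / (1 - η) * s ^ ((n : ℝ) + 1 - η)) := fun x hx =>
    lintegral_closedBall_enorm_sub_le hg hκ hη x hs0 fun t ht hts => h x hx t ht (hts.trans hsR)
  have key : ‖g x - g y‖ₑ * volume (closedBall z (1 / 2 * s)) ≤
      ENNReal.ofReal (2 * (κ / (1 - η) * s ^ ((n : ℝ) + 1 - η))) := by
    calc _ = ∫⁻ w in closedBall z (1 / 2 * s), ‖g x - g y‖ₑ := by simp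
      _ ≤ ∫⁻ w in closedBall z (1 / 2 * s), (‖g w - g x‖ₑ + ‖g w - g y‖ₑ) := by
          refine lintegral_mono fun w => ?_
          have : g x - g y = -(g w - g x) + (g w - g y) := by abel
          calc ‖g x - g y‖ₑ = ‖-(g w - g x) + (g w - g y)‖ₑ := by rw [← this]
            _ ≤ _ := (enorm_add_le _ _).trans (by rw [enorm_neg])
      _ = (∫⁻ w in closedBall z (1 / 2 * s), ‖g w - g x‖ₑ) +
            ∫⁻ w in closedBall z (1 / 2 * s), ‖g w - g y‖ₑ :=
          lintegral_add_left (hgc.sub continuous_const).enorm.measurable _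
      _ ≤ _ := by
          rw [two_mul, ENNReal.ofReal_add (by positivity) (by positivity)]
          exact add_le_add ((lintegral_mono_set hzx).trans (hb x hx))
            ((lintegral_mono_set hzy).trans (hb y hy))
  rw [volume_closedBall z (by positivity), ← ENNReal.ofReal_toReal
    (measure_ball_lt_top (x := (0 : Rn n)) (r := 1)).ne, ← ofReal_norm,
    ← ENNReal.ofReal_mul (by positivity), ← ENNReal.ofReal_mul (by positivity),
    ENNReal.ofReal_le_ofReal_iff (by positivity)] at key
  change _ * (_ * v) ≤ _ at key
  rw [show (n : ℝ) + 1 - η = n + (1 - η) by ring, Real.rpow_add hs0, Real.rpow_natCast] at key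
  rw [← mul_le_mul_iff_left₀ (show 0 < (1 / 2 * s) ^ n * v by positivity)]
  refine key.trans (le_of_eq ?_)
  rw [mul_pow, one_div, inv_pow]
  field_simp

end Morrey

/-! ### Algebra of Taylor polynomials and bounds for smooth remainders. -/

section Taylor

variable {n : ℕ}

theorem mlen_add_single (α : Fin n → ℕ) (i : Fin n) : mlen (α + Pi.single i 1) = mlen α + 1 := by
  simp [mlen, Finset.sum_add_distrib, Finset.sum_pi_single']

theorem mlen_zero : mlen (0 : Fin n → ℕ) = 0 := by simp [mlen]

theorem mem_piAntidiag_univ {k : ℕ} {α : Fin n → ℕ} :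
    α ∈ Finset.piAntidiag Finset.univ k ↔ mlen α = k := by
  simp [Finset.mem_piAntidiag, mlen]

theorem mfact_add_single (α : Fin n → ℕ) (i : Fin n) :
    mfact (α + Pi.single i 1) = (α i + 1) * mfact α := by
  rw [mfact, mfact, ← Finset.mul_prod_erase _ _ (Finset.mem_univ i),
    ← Finset.mul_prod_erase Finset.univ (fun j => (α j).factorial) (Finset.mem_univ i), ← mul_assoc]
  congr 1
  · simp [Nat.factorial_succ]
  · refine Finset.prod_congr rfl fun j hj => ?_
    simp [Pi.single_eq_of_ne (Finset.ne_of_mem_erase hj)]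

theorem single_one_le {α : Fin n → ℕ} {i : Fin n} (hi : α i ≠ 0) : Pi.single i 1 ≤ α := by
  intro j
  rcases eq_or_ne j i with rfl | hj
  · rw [Pi.single_eq_same]; exact Nat.one_le_iff_ne_zero.2 hi
  · rw [Pi.single_eq_of_ne hj]; exact Nat.zero_le _

/-- If α i = 0 the truncated subtraction leaves α unchanged, but then the factor α i vanishes. -/
theorem hasFDerivAt_mpow (α : Fin n → ℕ) (v : Rn n) :
    ∃ L : Rn n →L[ℝ] ℝ, HasFDerivAt (fun v : Rn n => mpow v α) L v ∧
      ∀ i, L (EuclideanSpace.single i 1) = α i * mpow v (α - Pi.single i 1) := by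
  have h := HasFDerivAt.finsetProd (u := Finset.univ) (g := fun i (v : Rn n) => v i ^ α i) (x := v)
    (fun i _ => ((EuclideanSpace.proj i : Rn n →L[ℝ] ℝ).hasFDerivAt
      (x := v)).pow (α i))
  refine ⟨_, h, fun i => ?_⟩
  rw [_root_.sum_apply, Finset.sum_eq_single i]
  · have h1 : mpow v (α - Pi.single i 1) = v i ^ (α - Pi.single i 1 : Fin n → ℕ) i *
        ∏ j ∈ Finset.univ.erase i, v j ^ (α - Pi.single i 1 : Fin n → ℕ) j :=
      (Finset.mul_prod_erase Finset.univ _ (Finset.mem_univ i)).symm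
    rw [h1]
    have : ∏ j ∈ Finset.univ.erase i, v j ^ (α - Pi.single i 1 : Fin n → ℕ) j =
        ∏ j ∈ Finset.univ.erase i, v j ^ α j := by
      refine Finset.prod_congr rfl fun j hj => ?_
      simp [Pi.single_eq_of_ne (Finset.ne_of_mem_erase hj)]
    rw [this]
    simp
    ring
  · intro j _ hj
    simp [hj]
  · simp

/-- The polynomial `∑_{|α| ≤ m} h_α v^α / α!`. -/
def taylorPoly (m : ℕ) (h : (Fin n → ℕ) → ℂ) (v : Rn n) : ℂ :=
  ∑ k ∈ Finset.range (m + 1), ∑ α ∈ Finset.piAntidiag Finset.univ k,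
    (1 / (mfact α : ℂ)) * h α * (mpow v α : ℂ)

/-- The shift of a family indexed by multi-indices, corresponding to a partial derivative. -/
def shift {X : Type*} (i : Fin n) (h : (Fin n → ℕ) → X) : (Fin n → ℕ) → X :=
  fun α => h (α + Pi.single i 1)

theorem contDiff_mpow (α : Fin n → ℕ) : ContDiff ℝ 1 fun v : Rn n => mpow v α := by
  unfold mpow
  fun_prop

theorem contDiff_taylorPoly (m : ℕ) (h : (Fin n → ℕ) → ℂ) : ContDiff ℝ 1 (taylorPoly m h) := by
  unfold taylorPoly
  refine ContDiff.sum fun k _ => ContDiff.sum fun α _ => ContDiff.mul contDiff_const ?_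
  exact Complex.ofRealCLM.contDiff.comp (contDiff_mpow α)

theorem mpow_zero_vec (α : Fin n → ℕ) (hα : α ≠ 0) : mpow (0 : Rn n) α = 0 := by
  obtain ⟨i, hi⟩ := Function.ne_iff.1 hα
  exact Finset.prod_eq_zero (Finset.mem_univ i) (by simpa using hi)

theorem taylorPoly_zero_vec (m : ℕ) (h : (Fin n → ℕ) → ℂ) : taylorPoly m h 0 = h 0 := by
  rw [taylorPoly, Finset.sum_eq_single 0]
  · simp [mfact, mpow]
  · intro k _ hk
    refine Finset.sum_eq_zero fun α hα => ?_
    rw [mpow_zero_vec]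
    · simp
    · rintro rfl
      rw [mem_piAntidiag_univ, mlen_zero] at hα
      exact hk hα.symm
  · simp

/-- The terms with α i = 0 vanish; the others are reindexed by α = β + e_i, where α_i/α! = 1/β!. -/
theorem fderiv_taylorPoly (m : ℕ) (h : (Fin n → ℕ) → ℂ) (v : Rn n) (i : Fin n) :
    fderiv ℝ (taylorPoly (m + 1) h) v (EuclideanSpace.single i 1) = taylorPoly m (shift i h) v := by
  choose L hL hLi using fun α : Fin n → ℕ => hasFDerivAt_mpow α v
  have h1 : HasFDerivAt (taylorPoly (m + 1) h) (∑ k ∈ Finset.range (m + 1 + 1),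
      ∑ α ∈ Finset.piAntidiag Finset.univ k, ((1 / (mfact α : ℂ)) * h α) •
        Complex.ofRealCLM.comp (L α)) v :=
    HasFDerivAt.fun_sum fun k _ => HasFDerivAt.fun_sum fun α _ =>
      (Complex.ofRealCLM.hasFDerivAt.comp v (hL α)).const_mul _
  rw [h1.fderiv]
  simp only [_root_.sum_apply, _root_.smul_apply,
    ContinuousLinearMap.comp_apply, hLi, Complex.ofRealCLM_apply, smul_eq_mul]
  rw [Finset.sum_range_succ', taylorPoly]
  have h0 : ∑ α ∈ Finset.piAntidiag (Finset.univ : Finset (Fin n)) 0, 1 / (mfact α : ℂ) * h α *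
      ((α i * mpow v (α - Pi.single i 1) : ℝ) : ℂ) = 0 := by
    refine Finset.sum_eq_zero fun α hα => ?_
    have : α i = 0 := by
      have : mlen α = 0 := mem_piAntidiag_univ.1 hα
      exact Finset.sum_eq_zero_iff.1 this i (Finset.mem_univ i)
    simp [this]
  rw [h0, add_zero]
  refine Finset.sum_congr rfl fun k _ => ?_
  symm
  refine Finset.sum_of_injOn (fun β => β + Pi.single i 1) ?_ ?_ ?_ ?_
  · exact fun a _ b _ hab => add_right_cancel hab
  · intro β hβ
    rw [Finset.mem_coe, mem_piAntidiag_univ] at *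
    rw [mlen_add_single, hβ]
  · intro α hα hnot
    have : α i = 0 := by
      by_contra hi
      refine hnot ⟨α - Pi.single i 1, ?_, ?_⟩
      · rw [Finset.mem_coe, mem_piAntidiag_univ]
        rw [mem_piAntidiag_univ] at hα
        have h2 := mlen_add_single (α - Pi.single i 1) i
        rw [tsub_add_cancel_of_le] at h2
        · omega
        · exact single_one_le hi
      · refine tsub_add_cancel_of_le ?_
        exact single_one_le hi
    simp [this]
  · intro β _
    rw [add_tsub_cancel_right, mfact_add_single, shift]
    have h1 : ((β i : ℂ) + 1) ≠ 0 := Nat.cast_add_one_ne_zero _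
    have h2 : (mfact β : ℂ) ≠ 0 := by
      exact_mod_cast Finset.prod_ne_zero_iff.2 fun i _ => Nat.factorial_ne_zero _
    push_cast [Pi.add_apply, Pi.single_eq_same]
    field_simp

/-- The coefficients of a Taylor polynomial of degree `m` whose top-order coefficients are replaced
by constants. -/
def topReplace (m : ℕ) (g lam : (Fin n → ℕ) → ℂ) (α : Fin n → ℕ) : ℂ :=
  if mlen α = m then lam α else g α

theorem shift_topReplace (m : ℕ) (g lam : (Fin n → ℕ) → ℂ) (i : Fin n) :
    shift i (topReplace (m + 1) g lam) = topReplace m (shift i g) (shift i lam) := by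
  funext α
  simp [shift, topReplace, mlen_add_single]

/-- The Taylor remainder of a family of functions (thought of as the derivatives of the first one)
with constant top-order coefficients. -/
def modRemainder (m : ℕ) (G : (Fin n → ℕ) → Rn n → ℂ) (lam : (Fin n → ℕ) → ℂ) (x y : Rn n) : ℂ :=
  G 0 x - taylorPoly m (topReplace m (fun α => G α y) lam) (x - y)

/-- The members of the family of order less than `m` are `C¹` and their partial derivatives are
members of the family. -/
def IsJet (m : ℕ) (G : (Fin n → ℕ) → Rn n → ℂ) : Prop :=
  ∀ α, mlen α < m → ContDiff ℝ 1 (G α) ∧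
    ∀ i x, fderiv ℝ (G α) x (EuclideanSpace.single i 1) = G (α + Pi.single i 1) x

theorem IsJet.shift {m : ℕ} {G : (Fin n → ℕ) → Rn n → ℂ} (hG : IsJet (m + 1) G) (i : Fin n) :
    IsJet m (shift i G) := by
  intro α hα
  obtain ⟨h1, h2⟩ := hG (α + Pi.single i 1) (by rw [mlen_add_single]; omega)
  refine ⟨h1, fun j x => ?_⟩
  rw [FractionalMultilinear.shift, h2, FractionalMultilinear.shift, add_right_comm]

theorem modRemainder_self {m : ℕ} (hm : m ≠ 0) (G : (Fin n → ℕ) → Rn n → ℂ)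
    (lam : (Fin n → ℕ) → ℂ) (y : Rn n) : modRemainder m G lam y y = 0 := by
  rw [modRemainder, sub_self, taylorPoly_zero_vec, topReplace, if_neg, sub_self]
  rw [mlen_zero]; exact hm.symm

theorem contDiff_modRemainder {m : ℕ} {G : (Fin n → ℕ) → Rn n → ℂ} (hG : IsJet (m + 1) G)
    (lam : (Fin n → ℕ) → ℂ) (y : Rn n) :
    ContDiff ℝ 1 fun x => modRemainder (m + 1) G lam x y := by
  refine (hG 0 (by rw [mlen_zero]; omega)).1.sub ?_
  exact (contDiff_taylorPoly _ _).comp (contDiff_id.sub contDiff_const)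

/-- Differentiation in x lowers the order by one and shifts the jet, keeping the constants in top
position. This drives the induction on m. -/
theorem fderiv_modRemainder {m : ℕ} {G : (Fin n → ℕ) → Rn n → ℂ} (hG : IsJet (m + 1) G)
    (lam : (Fin n → ℕ) → ℂ) (x y : Rn n) (i : Fin n) :
    fderiv ℝ (fun x => modRemainder (m + 1) G lam x y) x (EuclideanSpace.single i 1) =
      modRemainder m (shift i G) (shift i lam) x y := by
  obtain ⟨h1, h2⟩ := hG 0 (by rw [mlen_zero]; omega)
  have hT : HasFDerivAt (fun x => taylorPoly (m + 1)
      (topReplace (m + 1) (fun α => G α y) lam) (x - y))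
      (fderiv ℝ (taylorPoly (m + 1) (topReplace (m + 1) (fun α => G α y) lam)) (x - y)) x := by
    have := (((contDiff_taylorPoly (m + 1) (topReplace (m + 1) (fun α => G α y) lam)).differentiable
      one_ne_zero (x - y)).hasFDerivAt).comp x ((hasFDerivAt_id x).sub_const y)
    rw [ContinuousLinearMap.comp_id] at this
    exact this
  have h := ((h1.differentiable one_ne_zero x).hasFDerivAt.sub hT).fderiv
  unfold modRemainder
  erw [h]
  rw [_root_.sub_apply, h2, fderiv_taylorPoly, shift_topReplace]
  rfl

theorem norm_clm_le_sum {F : Type*} [NormedAddCommGroup F] [NormedSpace ℝ F]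
    (L : Rn n →L[ℝ] F) : ‖L‖ ≤ ∑ i, ‖L (EuclideanSpace.single i 1)‖ := by
  refine L.opNorm_le_bound (Finset.sum_nonneg fun _ _ => norm_nonneg _) fun v => ?_
  have hv : v = ∑ i, v i • EuclideanSpace.single i (1 : ℝ) := by
    ext j
    simp [Finset.sum_apply, Pi.single_apply]
  conv_lhs => rw [hv]
  rw [map_sum, Finset.sum_mul]
  refine (norm_sum_le _ _).trans (Finset.sum_le_sum fun i _ => ?_)
  rw [map_smul, norm_smul, mul_comm]
  gcongr
  exact PiLp.norm_apply_le v i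

theorem enorm_clm_le_sum {F : Type*} [NormedAddCommGroup F] [NormedSpace ℝ F]
    (L : Rn n →L[ℝ] F) : ‖L‖ₑ ≤ ∑ i, ‖L (EuclideanSpace.single i 1)‖ₑ := by
  simp_rw [← ofReal_norm]
  rw [← ENNReal.ofReal_sum_of_nonneg fun _ _ => norm_nonneg _]
  exact ENNReal.ofReal_le_ofReal (norm_clm_le_sum L)

/-- Pointwise bounds for the modified Taylor remainder of a smooth family whose top-order members
satisfy a Morrey condition. -/
theorem exists_modRemainder_bound {η : ℝ} (hη0 : 0 ≤ η) (hη : η < 1) {m : ℕ} (hm : 1 ≤ m) :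
    ∃ C : ℝ, 0 ≤ C ∧ ∀ (G : (Fin n → ℕ) → Rn n → ℂ) (lam : (Fin n → ℕ) → ℂ) (κ R : ℝ) (c : Rn n),
      IsJet m G → 0 ≤ κ →
      (∀ α, mlen α = m → ∀ x ∈ closedBall c R, ∀ t, 0 < t → t ≤ 2 * R →
        ∫⁻ y in closedBall x t, ‖G α y - lam α‖ₑ ≤ ENNReal.ofReal (κ * t ^ ((n : ℝ) - η))) →
      ∀ x ∈ closedBall c R, ∀ y ∈ closedBall c R,
        ‖modRemainder m G lam x y‖ ≤ C * κ * ‖x - y‖ ^ ((m : ℝ) - η) ∧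
        ∀ x₀ ∈ closedBall c R, ‖modRemainder m G lam x y - modRemainder m G lam x₀ y‖ ≤
          C * κ * R ^ (m - 1) * ‖x - x₀‖ ^ (1 - η) := by
  induction m, hm using Nat.le_induction with
  -- At order one the partial derivatives in x are exactly G_{e_i} - λ_{e_i}, so Morrey's inequality
  -- applies. The size bound is its case x₀ = y, where the remainder vanishes.
  | base =>
    obtain ⟨C, hC0, hC⟩ := exists_morrey (F := ℂ) n hη
    refine ⟨C * n, by positivity, fun G lam κ R c hG hκ hM x hx y hy => ?_⟩
    have hcd := contDiff_modRemainder (m := 0) hG lam y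
    have hmor := hC (fun x => modRemainder 1 G lam x y) (n * κ) R c hcd (by positivity)
      fun x hx t ht htR => by
      calc ∫⁻ z in closedBall x t, ‖fderiv ℝ (fun x => modRemainder 1 G lam x y) z‖ₑ
          ≤ ∫⁻ z in closedBall x t, ∑ i, ‖fderiv ℝ (fun x => modRemainder 1 G lam x y) z
              (EuclideanSpace.single i 1)‖ₑ := lintegral_mono fun z => enorm_clm_le_sum _
        _ = ∑ i, ∫⁻ z in closedBall x t, ‖fderiv ℝ (fun x => modRemainder 1 G lam x y) z
              (EuclideanSpace.single i 1)‖ₑ := by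
            refine lintegral_finsetSum _ fun i _ => Continuous.measurable ?_
            exact ((hcd.continuous_fderiv one_ne_zero).clm_apply continuous_const).enorm
        _ ≤ ∑ i : Fin n, ENNReal.ofReal (κ * t ^ ((n : ℝ) - η)) := by
            refine Finset.sum_le_sum fun i _ => ?_
            refine le_trans (le_of_eq ?_) (hM (Pi.single i 1) (by
              have := mlen_add_single (0 : Fin n → ℕ) i
              rwa [zero_add, mlen_zero] at this) x hx t ht htR)
            refine lintegral_congr fun z => ?_
            rw [fderiv_modRemainder hG]
            simp [modRemainder, shift, taylorPoly, topReplace, mlen_zero, mfact, mpow]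
        _ = _ := by
            rw [Finset.sum_const, Finset.card_univ, Fintype.card_fin, nsmul_eq_mul, mul_assoc,
              ENNReal.ofReal_mul (p := (n : ℝ)) (by positivity), ENNReal.ofReal_natCast]
    constructor
    · have := hmor x hx y hy
      rw [modRemainder_self one_ne_zero, sub_zero] at this
      push_cast
      linarith
    · intro x₀ hx₀
      have := hmor x hx x₀ hx₀
      simp only [le_refl, tsub_eq_zero_of_le, pow_zero, mul_one]
      linarith
  | succ m hm ih =>
    obtain ⟨C, hC0, hC⟩ := ih
    refine ⟨n * C * 2 ^ m, by positivity, fun G lam κ R c hG hκ hM x hx y hy => ?_⟩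
    have hR : 0 ≤ R := dist_nonneg.trans hx
    have hm1 : (1 : ℝ) ≤ m := by exact_mod_cast hm
    have hcd := contDiff_modRemainder hG lam y
    have h2R : ∀ z ∈ closedBall c R, ∀ w ∈ closedBall c R, ‖z - w‖ ≤ 2 * R := by
      intro z hz w hw
      rw [← dist_eq_norm]
      exact (dist_triangle_right z w c).trans (by rw [mem_closedBall] at hz hw; linarith)
    have hfd : ∀ z ∈ closedBall c R, ‖fderiv ℝ (fun x => modRemainder (m + 1) G lam x y) z‖ ≤
        n * C * κ * ‖z - y‖ ^ ((m : ℝ) - η) := by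
      intro z hz
      calc _ ≤ ∑ i, ‖fderiv ℝ (fun x => modRemainder (m + 1) G lam x y) z
              (EuclideanSpace.single i 1)‖ := norm_clm_le_sum _
        _ ≤ ∑ i : Fin n, C * κ * ‖z - y‖ ^ ((m : ℝ) - η) := by
            refine Finset.sum_le_sum fun i _ => ?_
            rw [fderiv_modRemainder hG]
            exact (hC _ (shift i lam) κ R c (hG.shift i) hκ (fun α hα x hx t ht htR =>
              hM (α + Pi.single i 1) (by rw [mlen_add_single, hα]) x hx t ht htR) z hz y hy).1
        _ = _ := by
            rw [Finset.sum_const, Finset.card_univ, Fintype.card_fin, nsmul_eq_mul]; ring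
    have hdiff : Differentiable ℝ fun x => modRemainder (m + 1) G lam x y :=
      hcd.differentiable one_ne_zero
    constructor
    -- Intersecting with the ball about y keeps the set convex and gives ‖z - y‖ ≤ ‖x - y‖ on it, so
    -- the gradient bound yields a power of ‖x - y‖ rather than of R.
    · have hy' : y ∈ closedBall c R ∩ closedBall y ‖x - y‖ := ⟨hy, by simp⟩
      have hx' : x ∈ closedBall c R ∩ closedBall y ‖x - y‖ := ⟨hx, by simp [dist_eq_norm]⟩
      have h := Convex.norm_image_sub_le_of_norm_fderiv_le (𝕜 := ℝ) (fun z _ => hdiff z)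
        (C := n * C * κ * ‖x - y‖ ^ ((m : ℝ) - η)) (fun z hz => (hfd z hz.1).trans (by
          have := hz.2
          rw [mem_closedBall, dist_eq_norm] at this
          gcongr
          linarith)) ((convex_closedBall c R).inter (convex_closedBall y _)) hy' hx'
      rw [modRemainder_self (Nat.succ_ne_zero m), sub_zero] at h
      refine h.trans ?_
      have h3 : ‖x - y‖ ^ ((m : ℝ) - η) * ‖x - y‖ ≤ ‖x - y‖ ^ (((m + 1 : ℕ) : ℝ) - η) := by
        rcases eq_or_lt_of_le (norm_nonneg (x - y)) with h0 | h0
        · rw [← h0, mul_zero]; positivity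
        · rw [← Real.rpow_add_one h0.ne']
          push_cast
          rw [show (m : ℝ) - η + 1 = m + 1 - η by ring]
      calc _ = n * C * κ * (‖x - y‖ ^ ((m : ℝ) - η) * ‖x - y‖) := by ring
        _ ≤ n * C * κ * ‖x - y‖ ^ (((m + 1 : ℕ) : ℝ) - η) := by gcongr
        _ ≤ _ := by
            have : (1 : ℝ) ≤ 2 ^ m := one_le_pow₀ (by norm_num)
            have h4 : 0 ≤ n * C * κ * ‖x - y‖ ^ (((m + 1 : ℕ) : ℝ) - η) := by positivity
            nlinarith
    · intro x₀ hx₀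
      have h := Convex.norm_image_sub_le_of_norm_fderiv_le (𝕜 := ℝ) (fun z _ => hdiff z)
        (C := n * C * κ * (2 * R) ^ ((m : ℝ) - η)) (fun z hz => (hfd z hz).trans (by
          have := h2R z hz y hy
          gcongr
          linarith)) (convex_closedBall c R) hx₀ hx
      refine h.trans ?_
      -- The gradient bound gives a Lipschitz estimate; giving up ‖x - x₀‖^η ≤ (2R)^η puts it in the
      -- Hölder form of the base case.
      have h3 : (2 * R) ^ ((m : ℝ) - η) * ‖x - x₀‖ ≤
          (2 * R) ^ m * ‖x - x₀‖ ^ (1 - η) := by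
        rcases eq_or_lt_of_le (norm_nonneg (x - x₀)) with h0 | h0
        · rw [← h0, mul_zero]; positivity
        · have hle := h2R x hx x₀ hx₀
          have hR0 : 0 < 2 * R := h0.trans_le hle
          calc (2 * R) ^ ((m : ℝ) - η) * ‖x - x₀‖
              = (2 * R) ^ ((m : ℝ) - η) * (‖x - x₀‖ ^ η * ‖x - x₀‖ ^ (1 - η)) := by
                rw [← Real.rpow_add h0]; simp
            _ ≤ (2 * R) ^ ((m : ℝ) - η) * ((2 * R) ^ η * ‖x - x₀‖ ^ (1 - η)) := by gcongr
            _ = _ := by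
                rw [← mul_assoc, ← Real.rpow_add hR0, sub_add_cancel, Real.rpow_natCast]
      rw [Nat.add_sub_cancel]
      calc _ = n * C * κ * ((2 * R) ^ ((m : ℝ) - η) * ‖x - x₀‖) := by ring
        _ ≤ n * C * κ * ((2 * R) ^ m * ‖x - x₀‖ ^ (1 - η)) := by gcongr
        _ = _ := by rw [mul_pow]; ring

end Taylor

/-! ### Weak derivatives, mollification, and passage to the limit. -/

section Mollify

variable {n : ℕ}

theorem ContDiff.partialDeriv {φ : Rn n → ℝ} (hφ : ContDiff ℝ (⊤ : ℕ∞) φ) (i : Fin n) :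
    ContDiff ℝ (⊤ : ℕ∞) (partialDeriv i φ) :=
  (hφ.fderiv_right (m := (⊤ : ℕ∞)) (by simp)).clm_apply contDiff_const

theorem ContDiff.partialDeriv_iterate {φ : Rn n → ℝ} (hφ : ContDiff ℝ (⊤ : ℕ∞) φ) (i : Fin n)
    (k : ℕ) : ContDiff ℝ (⊤ : ℕ∞) ((FractionalMultilinear.partialDeriv i)^[k] φ) := by
  induction k with
  | zero => exact hφ
  | succ k ih =>
    rw [Function.iterate_succ_apply']
    exact ContDiff.partialDeriv ih i

theorem partialDeriv_comm {φ : Rn n → ℝ} (hφ : ContDiff ℝ (⊤ : ℕ∞) φ) (i j : Fin n) :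
    partialDeriv i (partialDeriv j φ) = partialDeriv j (partialDeriv i φ) := by
  funext x
  have hd : DifferentiableAt ℝ (fderiv ℝ φ) x :=
    (hφ.fderiv_right (m := (⊤ : ℕ∞)) (by simp)).differentiable (by simp) x
  have h : ∀ v w : Rn n, fderiv ℝ (fun y => fderiv ℝ φ y v) x w = fderiv ℝ (fderiv ℝ φ) x w v := by
    intro v w
    rw [fderiv_clm_apply hd (differentiableAt_const v)]
    simp
  have hs : IsSymmSndFDerivAt ℝ φ x :=
    (hφ.contDiffAt (x := x)).isSymmSndFDerivAt (by
      simpa using WithTop.coe_le_coe.2 (le_top : (2 : ℕ∞) ≤ ⊤))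
  unfold partialDeriv
  rw [h, h]
  exact hs _ _

theorem partialDeriv_iterate_comm {φ : Rn n → ℝ} (hφ : ContDiff ℝ (⊤ : ℕ∞) φ) (i j : Fin n)
    (k : ℕ) : (partialDeriv j)^[k] (partialDeriv i φ) = partialDeriv i ((partialDeriv j)^[k] φ) := by
  induction k generalizing φ with
  | zero => rfl
  | succ k ih =>
    rw [Function.iterate_succ_apply, Function.iterate_succ_apply, partialDeriv_comm hφ,
      ih (ContDiff.partialDeriv hφ j)]

/-- `classicalDeriv` differentiates in a fixed order of coordinates, so one extra derivative must be
commuted to its place. Without repetitions in the list, coordinate i is met at most once. -/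
theorem foldr_partialDeriv (α : Fin n → ℕ) {φ : Rn n → ℝ} (hφ : ContDiff ℝ (⊤ : ℕ∞) φ)
    (i : Fin n) (L : List (Fin n)) (hL : L.Nodup) :
    ContDiff ℝ (⊤ : ℕ∞) (L.foldr (fun j ψ => (partialDeriv j)^[α j] ψ) φ) ∧
    L.foldr (fun j ψ => (partialDeriv j)^[α j] ψ) (partialDeriv i φ) =
      partialDeriv i (L.foldr (fun j ψ => (partialDeriv j)^[α j] ψ) φ) ∧
    (i ∈ L → L.foldr (fun j ψ => (partialDeriv j)^[(α + Pi.single i 1 : Fin n → ℕ) j] ψ) φ =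
      partialDeriv i (L.foldr (fun j ψ => (partialDeriv j)^[α j] ψ) φ)) ∧
    (i ∉ L → L.foldr (fun j ψ => (partialDeriv j)^[(α + Pi.single i 1 : Fin n → ℕ) j] ψ) φ =
      L.foldr (fun j ψ => (partialDeriv j)^[α j] ψ) φ) := by
  induction L with
  | nil => exact ⟨hφ, rfl, by simp, by simp⟩
  | cons a L ih =>
    rw [List.nodup_cons] at hL
    obtain ⟨h1, h2, h3, h4⟩ := ih hL.2
    simp only [List.foldr_cons, List.mem_cons, not_or]
    refine ⟨ContDiff.partialDeriv_iterate h1 _ _, ?_, ?_, ?_⟩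
    · rw [h2, partialDeriv_iterate_comm h1]
    · intro hi
      rcases eq_or_ne i a with rfl | hia
      · rw [h4 hL.1, Pi.add_apply, Pi.single_eq_same, Function.iterate_succ_apply']
      · rw [h3 (hi.resolve_left hia), Pi.add_apply, Pi.single_eq_of_ne hia.symm, add_zero,
          partialDeriv_iterate_comm h1]
    · rintro ⟨hia, hiL⟩
      rw [h4 hiL, Pi.add_apply, Pi.single_eq_of_ne (Ne.symm hia), add_zero]

theorem classicalDeriv_partialDeriv (α : Fin n → ℕ) {φ : Rn n → ℝ}
    (hφ : ContDiff ℝ (⊤ : ℕ∞) φ) (i : Fin n) :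
    classicalDeriv α (partialDeriv i φ) = classicalDeriv (α + Pi.single i 1) φ := by
  obtain ⟨-, h2, h3, -⟩ := foldr_partialDeriv α hφ i (List.finRange n) (List.nodup_finRange n)
  rw [classicalDeriv, classicalDeriv, h2, h3 (List.mem_finRange i)]

theorem HasCompactSupport.partialDeriv {φ : Rn n → ℝ} (hφ : HasCompactSupport φ) (i : Fin n) :
    HasCompactSupport (partialDeriv i φ) :=
  (hφ.fderiv ℝ).comp_left (g := fun L : Rn n →L[ℝ] ℝ => L (EuclideanSpace.single i 1)) (by simp)

/-- Weak derivatives of consecutive orders are related by integration by parts. -/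
theorem HasWeakDeriv.integral_partialDeriv_smul {α : Fin n → ℕ} {i : Fin n} {u g h : Rn n → ℂ}
    (hg : HasWeakDeriv α u g) (hh : HasWeakDeriv (α + Pi.single i 1) u h) {φ : Rn n → ℝ}
    (hφ : ContDiff ℝ (⊤ : ℕ∞) φ) (hφc : HasCompactSupport φ) :
    ∫ x, partialDeriv i φ x • g x = -∫ x, φ x • h x := by
  have h1 := hg.2.2 (partialDeriv i φ) (ContDiff.partialDeriv hφ i)
    (HasCompactSupport.partialDeriv hφc i)
  have h2 := hh.2.2 φ hφ hφc
  rw [classicalDeriv_partialDeriv α hφ, h2, mlen_add_single, pow_succ] at h1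
  have h3 : ((-1 : ℂ) ^ mlen α) ≠ 0 := pow_ne_zero _ (by norm_num)
  apply mul_left_cancel₀ h3
  rw [← h1]; ring

/-- Needed since `weakDeriv 0 u` is a chosen representative, while the Taylor remainder contains u
itself. -/
theorem HasWeakDeriv.ae_eq_zero_order {u g : Rn n → ℂ} (hg : HasWeakDeriv 0 u g) : g =ᵐ[volume] u := by
  suffices ∀ᵐ x, u x = g x from this.mono fun x hx => hx.symm
  refine ae_eq_of_integral_contDiff_smul_eq hg.1 hg.2.1 fun φ hφ hφc => ?_
  have h := hg.2.2 φ hφ hφc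
  have h0 : classicalDeriv (0 : Fin n → ℕ) φ = φ := by
    rw [classicalDeriv]
    induction List.finRange n with
    | nil => rfl
    | cons a L ih => rw [List.foldr_cons, ih]; rfl
  rwa [h0, mlen_zero, pow_zero, one_mul] at h

open ContinuousLinearMap in
/-- The mollification of `g` by the bump function `φ`. -/
def mollify (φ : ContDiffBump (0 : Rn n)) (g : Rn n → ℂ) : Rn n → ℂ :=
  convolution (φ.normed volume) g (lsmul ℝ ℝ) volume

theorem mollify_apply (φ : ContDiffBump (0 : Rn n)) (g : Rn n → ℂ) (x : Rn n) :
    mollify φ g x = ∫ t, φ.normed volume t • g (x - t) := rfl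

theorem integrable_mollify (φ : ContDiffBump (0 : Rn n)) {g : Rn n → ℂ} (hg : LocallyIntegrable g)
    (x : Rn n) : Integrable fun t => φ.normed volume t • g (x - t) :=
  (φ.hasCompactSupport_normed.convolutionExists_left (ContinuousLinearMap.lsmul ℝ ℝ)
    φ.continuous_normed hg x)

theorem contDiff_mollify (φ : ContDiffBump (0 : Rn n)) {g : Rn n → ℂ} (hg : LocallyIntegrable g) :
    ContDiff ℝ 1 (mollify φ g) :=
  φ.hasCompactSupport_normed.contDiff_convolution_left (n := 1) _ φ.contDiff_normed hg

/-- The derivative falls on the bump; y ↦ f(x - y) is a test function, and integration by parts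
moves the derivative to g. -/
theorem fderiv_mollify (φ : ContDiffBump (0 : Rn n)) {α : Fin n → ℕ} {i : Fin n} {u g h : Rn n → ℂ}
    (hg : HasWeakDeriv α u g) (hh : HasWeakDeriv (α + Pi.single i 1) u h) (x : Rn n) :
    fderiv ℝ (mollify φ g) x (EuclideanSpace.single i 1) = mollify φ h x := by
  set f : Rn n → ℝ := φ.normed volume with hf
  have hfc : ContDiff ℝ 1 f := φ.contDiff_normed
  have hfs : HasCompactSupport f := φ.hasCompactSupport_normed
  have h1 := (hfs.hasFDerivAt_convolution_left (ContinuousLinearMap.lsmul ℝ ℝ) hfc hg.2.1 x).fderiv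
  have hex : Integrable (fun t => ((ContinuousLinearMap.lsmul ℝ ℝ : ℝ →L[ℝ] ℂ →L[ℝ] ℂ).precompL
      (Rn n)) (fderiv ℝ f t) (g (x - t))) :=
    (hfs.fderiv ℝ).convolutionExists_left _ (hfc.continuous_fderiv one_ne_zero) hg.2.1 x
  rw [mollify, h1, convolution_def, ContinuousLinearMap.integral_apply hex]
  simp only [ContinuousLinearMap.precompL_apply, ContinuousLinearMap.lsmul_apply]
  set ψ : Rn n → ℝ := fun y => f (x - y) with hψ
  have hψs : ContDiff ℝ (⊤ : ℕ∞) ψ :=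
    (φ.contDiff_normed (n := (⊤ : ℕ∞))).comp (contDiff_const.sub contDiff_id)
  have hψc : HasCompactSupport ψ := hfs.comp_homeomorph (Homeomorph.subLeft x)
  have hpd : ∀ y, partialDeriv i ψ y = - fderiv ℝ f (x - y) (EuclideanSpace.single i 1) := by
    intro y
    have h2 : HasFDerivAt ψ ((fderiv ℝ f (x - y)).comp (-(ContinuousLinearMap.id ℝ (Rn n)))) y :=
      (hfc.differentiable one_ne_zero (x - y)).hasFDerivAt.comp y ((hasFDerivAt_id y).const_sub x)
    rw [partialDeriv, h2.fderiv]
    simp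
  have h3 := hg.integral_partialDeriv_smul hh hψs hψc
  simp only [hpd, neg_smul, integral_neg, neg_inj] at h3
  rw [mollify_apply, ← integral_sub_left_eq_self (fun t => f t • h (x - t)) volume x,
    ← integral_sub_left_eq_self (fun t => fderiv ℝ f t (EuclideanSpace.single i 1) • g (x - t))
      volume x]
  simpa using h3

theorem isJet_mollify (φ : ContDiffBump (0 : Rn n)) {m : ℕ} {u : Rn n → ℂ}
    {D : (Fin n → ℕ) → Rn n → ℂ} (hD : ∀ α, mlen α ≤ m → HasWeakDeriv α u (D α)) :
    IsJet m fun α => mollify φ (D α) := fun α hα =>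
  ⟨contDiff_mollify φ (hD α hα.le).2.1, fun i x => fderiv_mollify φ (hD α hα.le)
    (hD _ (by rw [mlen_add_single]; omega)) x⟩

/-- Mollification does not increase the mean deviation from a constant on balls of a fixed
radius. -/
theorem lintegral_mollify_sub_le (φ : ContDiffBump (0 : Rn n)) {g : Rn n → ℂ}
    (hg : LocallyIntegrable g) (a : ℂ) (x : Rn n) (t : ℝ) {M : ℝ≥0∞}
    (h : ∀ w ∈ closedBall x φ.rOut, ∫⁻ y in closedBall w t, ‖g y - a‖ₑ ≤ M) :
    ∫⁻ y in closedBall x t, ‖mollify φ g y - a‖ₑ ≤ M := by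
  set f : Rn n → ℝ := φ.normed volume with hf
  have hfi : Integrable f := φ.integrable_normed
  have hf1 : ∫ w, f w = 1 := φ.integral_normed
  have hfe : ∫⁻ w, ‖f w‖ₑ = 1 := by
    rw [← ofReal_integral_norm_eq_lintegral_enorm hfi]
    have : ∀ w, ‖f w‖ = f w := fun w => Real.norm_of_nonneg (φ.nonneg_normed w)
    simp_rw [this, hf1, ENNReal.ofReal_one]
  have hpt : ∀ y, ‖mollify φ g y - a‖ₑ ≤ ∫⁻ w, ‖f w‖ₑ * ‖g (y - w) - a‖ₑ := by
    intro y
    have : mollify φ g y - a = ∫ w, f w • (g (y - w) - a) := by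
      simp_rw [smul_sub]
      rw [integral_sub (integrable_mollify φ hg y) (hfi.smul_const a), integral_smul_const, hf1,
        one_smul, mollify_apply]
    rw [this]
    refine (enorm_integral_le_lintegral_enorm _).trans (le_of_eq ?_)
    simp_rw [enorm_smul]
  have hq : Measure.QuasiMeasurePreserving (fun p : Rn n × Rn n => p.1 - p.2)
      (volume.prod volume) volume := quasiMeasurePreserving_sub_of_right_invariant _ _
  have hm : AEMeasurable (fun p : Rn n × Rn n => ‖f p.2‖ₑ * ‖g (p.1 - p.2) - a‖ₑ)
      (volume.prod volume) := by
    have h1 : Measurable fun p : Rn n × Rn n => ‖f p.2‖ₑ :=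
      (φ.continuous_normed.measurable.comp measurable_snd).enorm
    have h2 : AEMeasurable (fun y => ‖g y - a‖ₑ) volume :=
      (hg.aestronglyMeasurable.sub aestronglyMeasurable_const).enorm
    exact h1.aemeasurable.mul (h2.comp_quasiMeasurePreserving hq)
  have htr : ∀ w, ∫⁻ y in closedBall x t, ‖g (y - w) - a‖ₑ =
      ∫⁻ y in closedBall (x - w) t, ‖g y - a‖ₑ := by
    intro w
    rw [← lintegral_indicator measurableSet_closedBall,
      ← lintegral_indicator measurableSet_closedBall, 
      ← lintegral_sub_right_eq_self ((closedBall (x - w) t).indicator fun y => ‖g y - a‖ₑ) w]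
    refine lintegral_congr fun y => ?_
    have : y ∈ closedBall x t ↔ y - w ∈ closedBall (x - w) t := by
      simp [mem_closedBall]
    by_cases hy : y ∈ closedBall x t
    · rw [indicator_of_mem hy, indicator_of_mem (this.1 hy)]
    · rw [indicator_of_notMem hy, indicator_of_notMem (fun hc => hy (this.2 hc))]
  calc ∫⁻ y in closedBall x t, ‖mollify φ g y - a‖ₑ
      ≤ ∫⁻ y in closedBall x t, ∫⁻ w, ‖f w‖ₑ * ‖g (y - w) - a‖ₑ := lintegral_mono fun y => hpt y
    _ = ∫⁻ w, ∫⁻ y in closedBall x t, ‖f w‖ₑ * ‖g (y - w) - a‖ₑ := by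
        refine lintegral_lintegral_swap (hm.mono_ac ?_)
        exact Measure.AbsolutelyContinuous.prod Measure.restrict_le_self.absolutelyContinuous
          Measure.AbsolutelyContinuous.rfl
    _ ≤ ∫⁻ w, ‖f w‖ₑ * M := by
        refine lintegral_mono fun w => ?_
        rw [lintegral_const_mul' _ _ enorm_ne_top]
        by_cases hw : f w = 0
        · simp [hw]
        · rw [htr]
          gcongr
          apply h
          have : w ∈ Function.support f := hw
          rw [hf, φ.support_normed_eq, mem_ball, dist_zero_right] at this
          rw [mem_closedBall, dist_eq_norm, sub_sub_cancel_left, norm_neg]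
          exact this.le
    _ = M := by rw [lintegral_mul_const'' _ hfi.aestronglyMeasurable.enorm, hfe, one_mul]

/-- Pointwise bounds for the modified Taylor remainder of a function with weak derivatives, valid
off a null set independent of the ball and of the constants. -/
theorem exists_weak_modRemainder_bound {η : ℝ} (hη0 : 0 ≤ η) (hη : η < 1) {m : ℕ} (hm : 1 ≤ m)
    {u : Rn n → ℂ} {D : (Fin n → ℕ) → Rn n → ℂ} (hD : ∀ α, mlen α ≤ m → HasWeakDeriv α u (D α)) :
    ∃ C : ℝ, 0 ≤ C ∧ ∃ E : Set (Rn n), (∀ᵐ x, x ∈ E) ∧ (∀ x ∈ E, D 0 x = u x) ∧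
      ∀ (lam : (Fin n → ℕ) → ℂ) (κ R : ℝ) (c : Rn n), 0 < R → 0 ≤ κ →
      (∀ α, mlen α = m → ∀ x ∈ closedBall c (2 * R), ∀ t, 0 < t → t ≤ 2 * R →
        ∫⁻ y in closedBall x t, ‖D α y - lam α‖ₑ ≤ ENNReal.ofReal (κ * t ^ ((n : ℝ) - η))) →
      ∀ x ∈ closedBall c R, x ∈ E → ∀ y ∈ closedBall c R, y ∈ E →
        ‖modRemainder m D lam x y‖ ≤ C * κ * ‖x - y‖ ^ ((m : ℝ) - η) ∧
        ∀ x₀ ∈ closedBall c R, x₀ ∈ E →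
          ‖modRemainder m D lam x y - modRemainder m D lam x₀ y‖ ≤
            C * κ * R ^ (m - 1) * ‖x - x₀‖ ^ (1 - η) := by
  obtain ⟨C, hC0, hC⟩ := exists_modRemainder_bound (n := n) hη0 hη hm
  have hpos : ∀ k : ℕ, 0 < 1 / ((k : ℝ) + 1) := fun k => Nat.one_div_pos_of_nat
  -- The inner radius is half the outer one: almost everywhere convergence requires a bounded ratio
  -- of the two.
  set φ : ℕ → ContDiffBump (0 : Rn n) := fun k =>
    ⟨1 / ((k : ℝ) + 1) / 2, 1 / ((k : ℝ) + 1), half_pos (hpos k), half_lt_self (hpos k)⟩ with hφ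
  have hlim : Tendsto (fun k => (φ k).rOut) atTop (𝓝 0) := tendsto_one_div_add_atTop_nhds_zero_nat
  have hae : ∀ᵐ x, ∀ α, mlen α ≤ m →
      Tendsto (fun k => mollify (φ k) (D α) x) atTop (𝓝 (D α x)) := by
    rw [ae_all_iff]
    intro α
    by_cases hα : mlen α ≤ m
    · have := ContDiffBump.ae_convolution_tendsto_right_of_locallyIntegrable (μ := volume)
        (K := 2) hlim (Eventually.of_forall fun k => by simp only [hφ]; linarith) (hD α hα).2.1
      filter_upwards [this] with x hx _ using hx
    · exact Eventually.of_forall fun x hc => absurd hc hα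
  have h0 := (hD 0 (by rw [mlen_zero]; omega)).ae_eq_zero_order
  -- The exceptional set depends on the functions D α and the mollifiers only, so one null set
  -- serves all balls and all constants.
  refine ⟨C, hC0, {x | (∀ α, mlen α ≤ m → Tendsto (fun k => mollify (φ k) (D α) x) atTop
    (𝓝 (D α x))) ∧ D 0 x = u x}, ?_, fun x hx => hx.2, ?_⟩
  · filter_upwards [hae, h0] with x h1 h2 using ⟨h1, h2⟩
  intro lam κ R c hR hκ hM x hx hxE y hy hyE
  have hev : ∀ᶠ k in atTop, (φ k).rOut ≤ R := hlim.eventually_le_const hR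
  have hT : ∀ z ∈ {x | (∀ α, mlen α ≤ m → Tendsto (fun k => mollify (φ k) (D α) x) atTop
      (𝓝 (D α x))) ∧ D 0 x = u x},
      Tendsto (fun k => modRemainder m (fun α => mollify (φ k) (D α)) lam z y) atTop
        (𝓝 (modRemainder m D lam z y)) := by
    intro z hz
    unfold modRemainder taylorPoly
    refine (hz.1 0 (by rw [mlen_zero]; omega)).sub ?_
    refine tendsto_finsetSum _ fun k hk => tendsto_finsetSum _ fun α hα => ?_
    refine (Tendsto.const_mul _ ?_).mul_const _
    unfold topReplace
    split_ifs with hαm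
    · exact tendsto_const_nhds
    · refine hyE.1 α ?_
      rw [Finset.mem_range] at hk
      rw [mem_piAntidiag_univ] at hα
      omega
  -- Mollifying displaces centres by at most rOut ≤ R, which is why the Morrey condition is assumed
  -- for centres in B(c,2R).
  have hb := fun (k : ℕ) (hk : (φ k).rOut ≤ R) =>
    hC (fun α => mollify (φ k) (D α)) lam κ R c (isJet_mollify (φ k) hD) hκ
      (fun α hα x hx t ht htR => lintegral_mollify_sub_le (φ k) (hD α hα.le).2.1 (lam α) x t
        fun w hw => hM α hα w (by
          rw [mem_closedBall] at hx hw ⊢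
          linarith [dist_triangle w x c]) t ht htR) x hx y hy
  constructor
  · exact le_of_tendsto (hT x hxE).norm (hev.mono fun k hk => (hb k hk).1)
  · intro x₀ hx₀ hx₀E
    exact le_of_tendsto ((hT x hxE).sub (hT x₀ hx₀E)).norm
      (hev.mono fun k hk => (hb k hk).2 x₀ hx₀)

end Mollify

/-! ### From oscillation on cubes to oscillation on balls. -/

section Cubes

variable {n : ℕ}

theorem closedBall_subset_cube (x : Rn n) (r : ℝ) : closedBall x r ⊆ cube x (2 * r) := by
  intro y hy i
  rw [mem_closedBall, dist_eq_norm] at hy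
  have h := PiLp.norm_apply_le (y - x) i
  rw [PiLp.sub_apply, Real.norm_eq_abs] at h
  linarith

theorem norm_le_sum_coord (v : Rn n) : ‖v‖ ≤ ∑ i, |v i| := by
  have hv : v = ∑ i, v i • EuclideanSpace.single i (1 : ℝ) := by
    ext j
    simp [Finset.sum_apply, Pi.single_apply]
  conv_lhs => rw [hv]
  refine (norm_sum_le _ _).trans (Finset.sum_le_sum fun i _ => ?_)
  simp [norm_smul]

theorem cube_subset_closedBall (x : Rn n) (d : ℝ) : cube x d ⊆ closedBall x (n * (d / 2)) := by
  intro y hy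
  rw [mem_closedBall, dist_eq_norm]
  refine (norm_le_sum_coord _).trans ?_
  calc ∑ i, |(y - x) i| ≤ ∑ _i : Fin n, d / 2 := Finset.sum_le_sum fun i _ => hy i
    _ = _ := by simp

/-- The mean of `b` over the cube circumscribed about a ball. -/
def ballConst (b : Rn n → ℂ) (x : Rn n) (r : ℝ) : ℂ := ⨍ z in cube x (2 * r), b z

/-- The circumscribed cube lies in the ball of n times the radius, whence the factor n^n. The added
1 makes N positive even when the seminorm is 0. -/
theorem MemBMO.exists_lintegral_closedBall_le (hn : 0 < n) {b : Rn n → ℂ} (hb : MemBMO b) :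
    ∃ N : ℝ, 0 < N ∧ ∀ (x : Rn n) (r : ℝ), 0 < r → ∫⁻ y in closedBall x r, ‖b y - ballConst b x r‖ₑ ≤
        ENNReal.ofReal N * volume (closedBall x r) := by
  have hn' : (0 : ℝ) < n := by exact_mod_cast hn
  obtain ⟨-, hM⟩ := hb
  refine ⟨(bmoNorm b).toReal * n ^ n + 1, by positivity, fun x r hr => ?_⟩
  have hsub := closedBall_subset_cube x r
  have h0 : volume (cube x (2 * r)) ≠ 0 :=
    (((volume_closedBall_ne_zero x hr).bot_lt).trans_le (measure_mono hsub)).ne'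
  have hle : volume (cube x (2 * r)) ≤ ENNReal.ofReal (n ^ n) * volume (closedBall x r) := by
    rw [← volume_closedBall_mul x x hn'.le hr.le]
    refine measure_mono ((cube_subset_closedBall x _).trans ?_)
    rw [mul_div_cancel_left₀ _ two_ne_zero]
  have htop : volume (cube x (2 * r)) ≠ ∞ := ne_top_of_le_ne_top
    (ENNReal.mul_ne_top ENNReal.ofReal_ne_top (volume_closedBall_ne_top _ _)) hle
  have h1 : meanOsc b (cube x (2 * r)) ≤ bmoNorm b :=
    le_iSup_of_le x (le_iSup_of_le (2 * r) (le_iSup_of_le (by positivity) le_rfl))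
  rw [meanOsc, ← ENNReal.div_eq_inv_mul, ENNReal.div_le_iff h0 htop] at h1
  calc _ ≤ ∫⁻ y in cube x (2 * r), ‖b y - ballConst b x r‖ₑ := lintegral_mono_set hsub
    _ ≤ bmoNorm b * (ENNReal.ofReal (n ^ n) * volume (closedBall x r)) := h1.trans (by gcongr)
    _ ≤ _ := by
      rw [← mul_assoc]
      gcongr
      conv_lhs => rw [← ENNReal.ofReal_toReal hM.ne]
      rw [← ENNReal.ofReal_mul ENNReal.toReal_nonneg]
      exact ENNReal.ofReal_le_ofReal (by linarith)

end Cubes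

/-! ### Integrability and growth of the deviation weight. -/

section Weight

variable {n : ℕ} {ι : Type*} [Fintype ι]

/-- The total deviation of a finite family of functions from their means near a ball. -/
def weight (b : ι → Rn n → ℂ) (c : Rn n) (ρ : ℝ) (y : Rn n) : ℝ :=
  1 + ∑ i, ‖b i y - ballConst (b i) c ρ‖

theorem one_le_weight (b : ι → Rn n → ℂ) (c : Rn n) (ρ : ℝ) (y : Rn n) : 1 ≤ weight b c ρ y :=
  le_add_of_nonneg_right (Finset.sum_nonneg fun _ _ => norm_nonneg _)

theorem norm_sub_le_weight (b : ι → Rn n → ℂ) (c : Rn n) (ρ : ℝ) (y : Rn n) (i : ι) :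
    ‖b i y - ballConst (b i) c ρ‖ ≤ weight b c ρ y :=
  (Finset.single_le_sum (f := fun i => ‖b i y - ballConst (b i) c ρ‖)
    (fun _ _ => norm_nonneg _) (Finset.mem_univ i)).trans (le_add_of_nonneg_left zero_le_one)

theorem aestronglyMeasurable_weight {b : ι → Rn n → ℂ} (hb : ∀ i, MemBMO (b i)) (c : Rn n)
    (ρ : ℝ) : AEStronglyMeasurable (weight b c ρ) volume := by
  refine aestronglyMeasurable_const.add (Finset.aestronglyMeasurable_fun_sum _ fun i _ => ?_)
  exact ((hb i).1.aestronglyMeasurable.sub aestronglyMeasurable_const).norm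

/-- John–Nirenberg for each member of the family, combined by the power mean inequality; `Option ι`
indexes the deviations together with the summand 1. Arbitrarily slow growth is what allows the
strict decay of the kernel to win later. -/
theorem exists_weight_growth (hn : 0 < n) {b : ι → Rn n → ℂ} (hb : ∀ i, MemBMO (b i)) {q : ℝ}
    (hq : 1 ≤ q) {η : ℝ} (hη : 0 < η) :
    ∃ C : ℝ, 0 ≤ C ∧ ∀ (c : Rn n) (ρ R : ℝ), 0 < ρ → ρ ≤ R →
      ∫⁻ y in closedBall c R, ENNReal.ofReal (weight b c ρ y) ^ q ≤
        ENNReal.ofReal (C * (R / ρ) ^ η) * volume (closedBall c R) := by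
  have hq0 : 0 < q := by linarith
  have h : ∀ i, ∃ C : ℝ, 0 ≤ C ∧ ∀ (c : Rn n) (ρ R : ℝ), 0 < ρ → ρ ≤ R →
      ∫⁻ y in closedBall c R, ‖b i y - ballConst (b i) c ρ‖ₑ ^ q ≤
        ENNReal.ofReal (C * (R / ρ) ^ η) * volume (closedBall c R) := by
    intro i
    obtain ⟨N, hN, hNi⟩ := (hb i).exists_lintegral_closedBall_le hn
    obtain ⟨C, hC0, hC⟩ := exists_lintegral_rpow_le_growth (n := n) (F := ℂ) hN hq hη
    exact ⟨C, hC0, hC (b i) (ballConst (b i)) (hb i).1 hNi⟩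
  choose C hC0 hC using h
  set k : ℝ := ((Finset.univ : Finset (Option ι)).card : ℝ) ^ (q - 1) with hk
  refine ⟨k * (1 + ∑ i, C i), mul_nonneg (by positivity)
    (add_nonneg zero_le_one (Finset.sum_nonneg fun i _ => hC0 i)), fun c ρ R hρ hR => ?_⟩
  have hone : 1 ≤ (R / ρ) ^ η := Real.one_le_rpow ((one_le_div hρ).2 hR) hη.le
  have hpt : ∀ y, ENNReal.ofReal (weight b c ρ y) ^ q ≤
      ENNReal.ofReal k * (1 + ∑ i, ‖b i y - ballConst (b i) c ρ‖ₑ ^ q) := by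
    intro y
    have h1 := ENNReal.rpow_sum_le_const_mul_sum_rpow (Finset.univ : Finset (Option ι))
      (fun o => o.elim 1 fun i => ‖b i y - ballConst (b i) c ρ‖ₑ) hq
    simp only [Fintype.sum_option, Option.elim_none, Option.elim_some, ENNReal.one_rpow] at h1
    have h2 : ENNReal.ofReal (weight b c ρ y) = 1 + ∑ i, ‖b i y - ballConst (b i) c ρ‖ₑ := by
      rw [weight, ENNReal.ofReal_add zero_le_one (Finset.sum_nonneg fun _ _ => norm_nonneg _),
        ENNReal.ofReal_one, ENNReal.ofReal_sum_of_nonneg fun _ _ => norm_nonneg _]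
      simp_rw [ofReal_norm]
    rw [h2]
    refine h1.trans (le_of_eq ?_)
    rw [hk, ← ENNReal.ofReal_rpow_of_nonneg (Nat.cast_nonneg _) (by linarith),
      ENNReal.ofReal_natCast]
  calc _ ≤ ∫⁻ y in closedBall c R, ENNReal.ofReal k *
        (1 + ∑ i, ‖b i y - ballConst (b i) c ρ‖ₑ ^ q) := lintegral_mono hpt
    _ = ENNReal.ofReal k * (volume (closedBall c R) +
        ∑ i, ∫⁻ y in closedBall c R, ‖b i y - ballConst (b i) c ρ‖ₑ ^ q) := by
      rw [lintegral_const_mul' _ _ ENNReal.ofReal_ne_top, lintegral_add_left measurable_const,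
        lintegral_finsetSum' _ fun i _ => ?_]
      · simp
      · exact (((hb i).1.aestronglyMeasurable.sub aestronglyMeasurable_const).enorm.pow_const
          q).mono_measure Measure.restrict_le_self
    _ ≤ ENNReal.ofReal k * (ENNReal.ofReal ((R / ρ) ^ η) * volume (closedBall c R) +
        ∑ i, ENNReal.ofReal (C i * (R / ρ) ^ η) * volume (closedBall c R)) := by
      gcongr with i
      · exact le_mul_of_one_le_left (zero_le) (by simpa using hone)
      · exact hC i c ρ R hρ hR
    _ = _ := by
      rw [← Finset.sum_mul, ← add_mul, ← ENNReal.ofReal_sum_of_nonneg fun i _ =>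
        mul_nonneg (hC0 i) (by positivity), ← ENNReal.ofReal_add (by positivity)
        (Finset.sum_nonneg fun i _ => mul_nonneg (hC0 i) (by positivity)), ← mul_assoc,
        ← ENNReal.ofReal_mul (by positivity), ← Finset.sum_mul]
      congr 2
      ring

/-- Hölder's inequality with exponent n/η: the factor |B(x,t)|^(1-η/n) supplies t^(n-η), uniformly
over small balls. This is the hypothesis Morrey's inequality needs. -/
theorem exists_weight_morrey (hn : 0 < n) {b : ι → Rn n → ℂ} (hb : ∀ i, MemBMO (b i)) {η : ℝ}
    (hη : 0 < η) (hη1 : η < 1) :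
    ∃ C : ℝ, 0 ≤ C ∧ ∀ (c : Rn n) (ρ R : ℝ), 0 < ρ → ρ ≤ R → ∀ x ∈ closedBall c (2 * R),
      ∀ t, 0 < t → t ≤ 2 * R → ∫⁻ y in closedBall x t, ENNReal.ofReal (weight b c ρ y) ≤
        ENNReal.ofReal (C * (R / ρ) ^ η * R ^ η * t ^ ((n : ℝ) - η)) := by
  have hn' : (0 : ℝ) < n := by exact_mod_cast hn
  have hn1 : (1 : ℝ) ≤ n := by exact_mod_cast hn
  have hq : 1 < n / η := (one_lt_div hη).2 (by linarith)
  -- Growth exponent n is chosen because the later power η/n turns it into η.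
  obtain ⟨C, hC0, hC⟩ := exists_weight_growth hn hb hq.le hn'
  set v : ℝ := volume.real (ball (0 : Rn n) 1) with hv
  have hV : volume (ball (0 : Rn n) 1) = ENNReal.ofReal v :=
    (ENNReal.ofReal_toReal measure_ball_lt_top.ne).symm
  have hv0 : 0 ≤ v := ENNReal.toReal_nonneg
  -- All balls in question lie in B(c,4R); one 4^η comes from (4R/ρ)^η and another from its volume.
  refine ⟨C ^ (η / n) * 16 ^ η * v ^ (η / n) * v ^ (1 - η / n), by positivity,
    fun c ρ R hρ hR x hx t ht htR => ?_⟩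
  have hR0 : 0 < R := hρ.trans_le hR
  have hsub : closedBall x t ⊆ closedBall c (4 * R) :=
    closedBall_subset_closedBall' (by rw [mem_closedBall] at hx; linarith)
  have hpq : (n / η).HolderConjugate ((1 - η / n)⁻¹) := by
    rw [Real.holderConjugate_iff]
    refine ⟨hq, ?_⟩
    rw [inv_inv, inv_div]; ring
  have hH := ENNReal.lintegral_mul_le_Lp_mul_Lq (volume.restrict (closedBall x t)) hpq
    (f := fun y => ENNReal.ofReal (weight b c ρ y)) (g := 1)
    ((aestronglyMeasurable_weight hb c ρ).aemeasurable.ennreal_ofReal.mono_measure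
      Measure.restrict_le_self) aemeasurable_const
  simp only [mul_one, Pi.one_apply, ENNReal.one_rpow, lintegral_one, Measure.restrict_apply_univ,
    one_div, inv_inv, inv_div] at hH
  refine hH.trans ?_
  have h1 : ∫⁻ y in closedBall x t, ENNReal.ofReal (weight b c ρ y) ^ ((n : ℝ) / η) ≤
      ENNReal.ofReal (C * (4 * R / ρ) ^ (n : ℝ) * ((4 * R) ^ n * v)) := by
    refine (lintegral_mono_set hsub).trans ((hC c ρ (4 * R) hρ (by linarith)).trans (le_of_eq ?_))
    rw [volume_closedBall c (by positivity), hV, ← ENNReal.ofReal_mul (by positivity),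
      ← ENNReal.ofReal_mul (by positivity)]
  have hθ : 0 < 1 - η / n := by rw [sub_pos, div_lt_one hn']; linarith
  calc _ ≤ ENNReal.ofReal (C * (4 * R / ρ) ^ (n : ℝ) * ((4 * R) ^ n * v)) ^ (η / n) *
        ENNReal.ofReal (t ^ n * v) ^ (1 - η / n) := by
        gcongr
        rw [volume_closedBall x ht.le, hV, ← ENNReal.ofReal_mul (by positivity)]
    _ = _ := by
        rw [ENNReal.ofReal_rpow_of_nonneg (by positivity) (by positivity),
          ENNReal.ofReal_rpow_of_nonneg (by positivity) hθ.le, ← ENNReal.ofReal_mul (by positivity)]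
        congr 1
        have e1 : ∀ z : ℝ, 0 ≤ z → (z ^ n) ^ (η / n) = z ^ η := by
          intro z hz
          rw [← Real.rpow_natCast, ← Real.rpow_mul hz]
          congr 1; field_simp
        have e2 : (t ^ n) ^ (1 - η / n) = t ^ ((n : ℝ) - η) := by
          rw [← Real.rpow_natCast, ← Real.rpow_mul ht.le]
          congr 1; field_simp
        rw [Real.mul_rpow (by positivity) (by positivity), Real.mul_rpow hC0 (by positivity),
          Real.mul_rpow (by positivity) hv0, Real.mul_rpow (by positivity) hv0, Real.rpow_natCast,
          e1 _ (by positivity), e1 _ (by positivity), e2, mul_div_assoc,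
          Real.mul_rpow (by norm_num) (by positivity), Real.mul_rpow (by norm_num) hR0.le,
          show (16 : ℝ) = 4 * 4 by norm_num, Real.mul_rpow (by norm_num) (by norm_num)]
        ring

end Weight

/-! ### Pointwise bounds for the Taylor remainder. -/

section Remainder

variable {n : ℕ}

theorem abs_mpow_le (v : Rn n) (α : Fin n → ℕ) : |mpow v α| ≤ ‖v‖ ^ mlen α := by
  rw [mpow, Finset.abs_prod, mlen, ← Finset.prod_pow_eq_pow_sum]
  refine Finset.prod_le_prod (fun _ _ => abs_nonneg _) fun i _ => ?_
  rw [abs_pow]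
  gcongr
  simpa using PiLp.norm_apply_le v i

theorem abs_mpow_sub_le {α : Fin n → ℕ} {v w : Rn n} {r : ℝ} (hv : ‖v‖ ≤ r) (hw : ‖w‖ ≤ r) :
    |mpow v α - mpow w α| ≤ mlen α * r ^ (mlen α - 1) * ‖v - w‖ := by
  have hr : 0 ≤ r := (norm_nonneg _).trans hv
  have h := Convex.norm_image_sub_le_of_norm_fderiv_le (𝕜 := ℝ) (f := fun v : Rn n => mpow v α)
    (s := closedBall 0 r) (C := mlen α * r ^ (mlen α - 1))
    (fun z _ => (contDiff_mpow α).differentiable one_ne_zero z) (fun z hz => by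
      obtain ⟨L, hL, hLi⟩ := hasFDerivAt_mpow α z
      rw [hL.fderiv]
      calc ‖L‖ ≤ ∑ i, ‖L (EuclideanSpace.single i 1)‖ := norm_clm_le_sum L
        _ ≤ ∑ i, (α i : ℝ) * r ^ (mlen α - 1) := by
            refine Finset.sum_le_sum fun i _ => ?_
            rw [hLi, norm_mul, Real.norm_natCast, Real.norm_eq_abs]
            by_cases hi : α i = 0
            · simp [hi]
            · gcongr
              refine (abs_mpow_le z _).trans ?_
              have h2 := mlen_add_single (α - Pi.single i 1) i
              rw [tsub_add_cancel_of_le (single_one_le hi)] at h2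
              rw [h2, Nat.add_sub_cancel]
              gcongr
              simpa using hz
        _ = _ := by rw [← Finset.sum_mul, mlen]; push_cast; rfl)
    (convex_closedBall 0 r) (x := w) (y := v) (by simpa using hw) (by simpa using hv)
  simpa using h

theorem norm_inv_mfact_le (α : Fin n → ℕ) : ‖(1 / (mfact α : ℂ))‖ ≤ 1 := by
  have : 0 < mfact α := Finset.prod_pos fun i _ => Nat.factorial_pos _
  rw [norm_div, norm_one, Complex.norm_natCast]
  exact div_le_one_of_le₀ (by exact_mod_cast this) (by positivity)

/-- The contribution of the top-order derivatives to the Taylor remainder. -/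
def topTerm (m : ℕ) (D : (Fin n → ℕ) → Rn n → ℂ) (lam : (Fin n → ℕ) → ℂ) (x y : Rn n) : ℂ :=
  ∑ α ∈ Finset.piAntidiag Finset.univ m, (1 / (mfact α : ℂ)) * (D α y - lam α) * (mpow (x - y) α : ℂ)

/-- Separates the part that is smooth in x with Morrey control from the part controlled pointwise by
the weight at y. -/
theorem taylorRemainder_eq {m : ℕ} {u : Rn n → ℂ} (lam : (Fin n → ℕ) → ℂ) {x : Rn n} (y : Rn n)
    (hx : weakDeriv 0 u x = u x) :
    taylorRemainder m u x y = modRemainder m (fun α => weakDeriv α u) lam x y -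
      topTerm m (fun α => weakDeriv α u) lam x y := by
  rw [taylorRemainder, modRemainder, hx, topTerm, taylorPoly, sub_sub]
  congr 1
  rw [Finset.sum_range_succ, Finset.sum_range_succ, add_assoc, ← Finset.sum_add_distrib]
  congr 1
  · refine Finset.sum_congr rfl fun k hk => Finset.sum_congr rfl fun α hα => ?_
    rw [mem_piAntidiag_univ] at hα
    rw [Finset.mem_range] at hk
    rw [topReplace, if_neg (by omega)]
  · refine Finset.sum_congr rfl fun α hα => ?_
    rw [mem_piAntidiag_univ] at hα
    rw [topReplace, if_pos hα]
    ring

theorem norm_topTerm_le {m : ℕ} {D : (Fin n → ℕ) → Rn n → ℂ} {lam : (Fin n → ℕ) → ℂ} {y : Rn n}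
    {w : ℝ} (hw : ∀ α, mlen α = m → ‖D α y - lam α‖ ≤ w) (x : Rn n) :
    ‖topTerm m D lam x y‖ ≤
      (Finset.piAntidiag (Finset.univ : Finset (Fin n)) m).card * (w * ‖x - y‖ ^ m) := by
  rw [← nsmul_eq_mul]
  refine (norm_sum_le _ _).trans (Finset.sum_le_card_nsmul _ _ _ fun α hα => ?_)
  rw [mem_piAntidiag_univ] at hα
  rw [norm_mul, norm_mul, Complex.norm_real, Real.norm_eq_abs]
  have h1 := norm_inv_mfact_le α
  have h2 := abs_mpow_le (x - y) α
  rw [hα] at h2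
  have h3 := hw α hα
  calc _ ≤ 1 * w * ‖x - y‖ ^ m := by
        have := (norm_nonneg _).trans h3
        gcongr
    _ = _ := by ring

theorem norm_topTerm_sub_le {m : ℕ} {D : (Fin n → ℕ) → Rn n → ℂ} {lam : (Fin n → ℕ) → ℂ}
    {y : Rn n} {w : ℝ} (hw : ∀ α, mlen α = m → ‖D α y - lam α‖ ≤ w) {x x₀ : Rn n} {r : ℝ}
    (hx : ‖x - y‖ ≤ r) (hx₀ : ‖x₀ - y‖ ≤ r) :
    ‖topTerm m D lam x y - topTerm m D lam x₀ y‖ ≤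
      (Finset.piAntidiag (Finset.univ : Finset (Fin n)) m).card *
        (w * (m * r ^ (m - 1) * ‖x - x₀‖)) := by
  rw [← nsmul_eq_mul, topTerm, topTerm, ← Finset.sum_sub_distrib]
  refine (norm_sum_le _ _).trans (Finset.sum_le_card_nsmul _ _ _ fun α hα => ?_)
  rw [mem_piAntidiag_univ] at hα
  rw [← mul_sub, ← Complex.ofReal_sub, norm_mul, norm_mul, Complex.norm_real, Real.norm_eq_abs]
  have h1 := norm_inv_mfact_le α
  have h2 := abs_mpow_sub_le (α := α) hx hx₀
  rw [hα, sub_sub_sub_cancel_right] at h2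
  have h3 := hw α hα
  calc _ ≤ 1 * w * (m * r ^ (m - 1) * ‖x - x₀‖) := by
        have := (norm_nonneg _).trans h3
        gcongr
    _ = _ := by ring

/-- Pointwise size and smoothness of the Taylor remainder of a function whose top-order weak
derivatives are in `BMO`. -/
theorem exists_taylorRemainder_bound (hn : 0 < n) {η : ℝ} (hη : 0 < η) (hη1 : η < 1) {m : ℕ}
    (hm : 1 ≤ m) {u : Rn n → ℂ} (hu : ∀ α, mlen α ≤ m → HasWeakDeriv α u (weakDeriv α u))
    {ι : Type*} [Fintype ι] {b : ι → Rn n → ℂ} (hb : ∀ i, MemBMO (b i))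
    (hι : ∀ α, mlen α = m → ∃ i, b i = weakDeriv α u) :
    ∃ C : ℝ, 0 ≤ C ∧ ∃ E : Set (Rn n), (∀ᵐ x, x ∈ E) ∧ ∀ (c : Rn n) (ρ R : ℝ), 0 < ρ → ρ ≤ R →
      ∀ x ∈ closedBall c R, x ∈ E → ∀ y ∈ closedBall c R, y ∈ E →
        ‖taylorRemainder m u x y‖ ≤
          C * ((R / ρ) ^ η * weight b c ρ y) * (R ^ η * ‖x - y‖ ^ ((m : ℝ) - η)) ∧
        ∀ x₀ ∈ closedBall c R, x₀ ∈ E →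
          ‖taylorRemainder m u x y - taylorRemainder m u x₀ y‖ ≤
            C * ((R / ρ) ^ η * weight b c ρ y) * (R ^ (m - 1) * (R ^ η * ‖x - x₀‖ ^ (1 - η))) := by
  obtain ⟨C₁, hC₁, hW⟩ := exists_weight_morrey hn hb hη hη1
  obtain ⟨C₀, hC₀, E, hE, hE0, hS⟩ := exists_weak_modRemainder_bound hη.le hη1 hm hu
  set k : ℝ := ((Finset.piAntidiag (Finset.univ : Finset (Fin n)) m).card : ℝ) with hk
  have hm1 : (1 : ℝ) ≤ m := by exact_mod_cast hm
  refine ⟨C₀ * C₁ + k * 2 * m * 2 ^ (m - 1), by positivity, E, hE,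
    fun c ρ R hρ hR x hx hxE y hy hyE => ?_⟩
  have hR0 : 0 < R := hρ.trans_le hR
  set W := weight b c ρ y with hWdef
  have hW1 : 1 ≤ W := one_le_weight b c ρ y
  have hg1 : 1 ≤ (R / ρ) ^ η := Real.one_le_rpow ((one_le_div hρ).2 hR) hη.le
  have hGW : W ≤ (R / ρ) ^ η * W := le_mul_of_one_le_left (by linarith) hg1
  have hGW' : (R / ρ) ^ η ≤ (R / ρ) ^ η * W := le_mul_of_one_le_right (by linarith) hW1
  set Z := (R / ρ) ^ η * W with hZ
  have hZ0 : 0 ≤ Z := by positivity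
  set lam : (Fin n → ℕ) → ℂ := fun α => ballConst (weakDeriv α u) c ρ with hlam
  have hdev : ∀ α, mlen α = m → ∀ y, ‖weakDeriv α u y - lam α‖ ≤ weight b c ρ y := by
    intro α hα y
    obtain ⟨i, hi⟩ := hι α hα
    simp only [hlam]
    rw [← hi]
    exact norm_sub_le_weight b c ρ y i
  have hSx := hS lam (C₁ * (R / ρ) ^ η * R ^ η) R c hR0 (by positivity)
    (fun α hα x hx t ht htR => by
      refine le_trans (lintegral_mono fun y => ?_) (hW c ρ R hρ hR x hx t ht htR)
      rw [← ofReal_norm]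
      exact ENNReal.ofReal_le_ofReal (hdev α hα y)) x hx hxE y hy hyE
  have h2R : ∀ z ∈ closedBall c R, ∀ w ∈ closedBall c R, ‖z - w‖ ≤ 2 * R := by
    intro z hz w hw
    rw [← dist_eq_norm]
    exact (dist_triangle_right z w c).trans (by rw [mem_closedBall] at hz hw; linarith)
  have h2η : (2 : ℝ) ^ η ≤ 2 := by
    calc (2 : ℝ) ^ η ≤ 2 ^ (1 : ℝ) := Real.rpow_le_rpow_of_exponent_le (by norm_num) hη1.le
      _ = 2 := Real.rpow_one 2
  -- Brings the top-order term, which has full powers of the distance, to the form with loss η of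
  -- the modified remainder.
  have hpow : ∀ s : ℝ, η ≤ s → ∀ d : ℝ, 0 ≤ d → d ≤ 2 * R →
      d ^ s ≤ 2 * (R ^ η * d ^ (s - η)) := by
    intro s hs d hd0 hd
    rcases eq_or_lt_of_le hd0 with h0 | h0
    · rw [← h0, Real.zero_rpow (by linarith)]; positivity
    · calc d ^ s = d ^ η * d ^ (s - η) := by rw [← Real.rpow_add h0]; congr 1; ring
        _ ≤ (2 * R) ^ η * d ^ (s - η) := by gcongr
        _ = 2 ^ η * (R ^ η * d ^ (s - η)) := by
            rw [Real.mul_rpow (by norm_num) hR0.le]; ring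
        _ ≤ _ := by gcongr
  have h2m : (1 : ℝ) ≤ m * 2 ^ (m - 1) :=
    one_le_mul_of_one_le_of_one_le hm1 (one_le_pow₀ (by norm_num))
  constructor
  · rw [taylorRemainder_eq lam y (hE0 x hxE)]
    have h1 := norm_topTerm_le (m := m) (D := fun α => weakDeriv α u) (lam := lam)
      (fun α hα => hdev α hα y) x
    have h2 := hpow m (by linarith) ‖x - y‖ (norm_nonneg _) (h2R x hx y hy)
    rw [Real.rpow_natCast] at h2
    have h3 : 0 ≤ R ^ η * ‖x - y‖ ^ ((m : ℝ) - η) := by positivity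
    calc _ ≤ C₀ * (C₁ * (R / ρ) ^ η * R ^ η) * ‖x - y‖ ^ ((m : ℝ) - η) +
          k * (W * ‖x - y‖ ^ m) := (norm_sub_le _ _).trans (add_le_add hSx.1 h1)
      _ = C₀ * C₁ * (R / ρ) ^ η * (R ^ η * ‖x - y‖ ^ ((m : ℝ) - η)) +
          k * (W * ‖x - y‖ ^ m) := by ring
      _ ≤ C₀ * C₁ * Z * (R ^ η * ‖x - y‖ ^ ((m : ℝ) - η)) +
          k * (Z * (2 * (R ^ η * ‖x - y‖ ^ ((m : ℝ) - η)))) := by gcongr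
      _ = (C₀ * C₁ + k * 2 * 1) * Z * (R ^ η * ‖x - y‖ ^ ((m : ℝ) - η)) := by ring
      _ ≤ (C₀ * C₁ + k * 2 * (m * 2 ^ (m - 1))) * Z * (R ^ η * ‖x - y‖ ^ ((m : ℝ) - η)) := by
          gcongr
      _ = _ := by ring
  · intro x₀ hx₀ hx₀E
    rw [taylorRemainder_eq lam y (hE0 x hxE), taylorRemainder_eq lam y (hE0 x₀ hx₀E),
      sub_sub_sub_comm]
    have h1 := norm_topTerm_sub_le (m := m) (D := fun α => weakDeriv α u) (lam := lam)
      (fun α hα => hdev α hα y) (h2R x hx y hy) (h2R x₀ hx₀ y hy)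
    have h2 := hpow 1 hη1.le ‖x - x₀‖ (norm_nonneg _) (h2R x hx x₀ hx₀)
    rw [Real.rpow_one] at h2
    calc _ ≤ C₀ * (C₁ * (R / ρ) ^ η * R ^ η) * R ^ (m - 1) * ‖x - x₀‖ ^ (1 - η) +
          k * (W * (m * (2 * R) ^ (m - 1) * ‖x - x₀‖)) :=
          (norm_sub_le _ _).trans (add_le_add (hSx.2 x₀ hx₀ hx₀E) h1)
      _ = C₀ * C₁ * (R / ρ) ^ η * (R ^ (m - 1) * (R ^ η * ‖x - x₀‖ ^ (1 - η))) +
          k * (W * (m * (2 * R) ^ (m - 1) * ‖x - x₀‖)) := by ring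
      _ ≤ C₀ * C₁ * Z * (R ^ (m - 1) * (R ^ η * ‖x - x₀‖ ^ (1 - η))) +
          k * (Z * (m * (2 * R) ^ (m - 1) * (2 * (R ^ η * ‖x - x₀‖ ^ (1 - η))))) := by gcongr
      _ = _ := by rw [mul_pow]; ring

end Remainder

/-! ### Size and smoothness of the multilinear kernel. -/

section Kernel

variable {n l : ℕ}

/-- Telescoping, one factor exchanged at a time; θ is the relative error of a factor. -/
theorem norm_prod_sub_prod_le {ι : Type*} (s : Finset ι) {f g : ι → ℂ} {M θ : ℝ}
    (hf : ∀ i ∈ s, ‖f i‖ ≤ M) (hg : ∀ i ∈ s, ‖g i‖ ≤ M) (hfg : ∀ i ∈ s, ‖f i - g i‖ ≤ M * θ) :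
    ‖∏ i ∈ s, f i - ∏ i ∈ s, g i‖ ≤ s.card * (M ^ s.card * θ) := by
  classical
  induction s using Finset.induction_on with
  | empty => simp
  | insert a s ha ih =>
    have hM : 0 ≤ M := (norm_nonneg _).trans (hf a (Finset.mem_insert_self a s))
    have h1 := ih (fun i hi => hf i (Finset.mem_insert_of_mem hi))
      (fun i hi => hg i (Finset.mem_insert_of_mem hi))
      (fun i hi => hfg i (Finset.mem_insert_of_mem hi))
    have h2 : ‖∏ i ∈ s, g i‖ ≤ M ^ s.card := by
      rw [norm_prod, ← Finset.prod_const]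
      exact Finset.prod_le_prod (fun _ _ => norm_nonneg _)
        fun i hi => hg i (Finset.mem_insert_of_mem hi)
    rw [Finset.prod_insert ha, Finset.prod_insert ha, Finset.card_insert_of_notMem ha]
    have : f a * ∏ i ∈ s, f i - g a * ∏ i ∈ s, g i =
        f a * (∏ i ∈ s, f i - ∏ i ∈ s, g i) + (f a - g a) * ∏ i ∈ s, g i := by ring
    rw [this]
    calc _ ≤ ‖f a‖ * ‖∏ i ∈ s, f i - ∏ i ∈ s, g i‖ + ‖f a - g a‖ * ‖∏ i ∈ s, g i‖ := by
          rw [← norm_mul, ← norm_mul]; exact norm_add_le _ _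
      _ ≤ M * (s.card * (M ^ s.card * θ)) + M * θ * M ^ s.card := by
          refine add_le_add (mul_le_mul (hf a (Finset.mem_insert_self a s)) h1 (norm_nonneg _) hM)
            (mul_le_mul (hfg a (Finset.mem_insert_self a s)) h2 (norm_nonneg _) ?_)
          exact (norm_nonneg _).trans (hfg a (Finset.mem_insert_self a s))
      _ = _ := by push_cast; ring

/-- Quotients by powers of comparable numbers. -/
theorem norm_div_pow_sub_div_pow_le {m : ℕ} (hm : 1 ≤ m) {z w : ℂ} {d e R ρ M : ℝ} (hR : 0 < R)
    (hd : R / 2 ≤ d) (hd' : d ≤ 2 * R) (he : R / 2 ≤ e) (he' : e ≤ 2 * R) (hde : |d - e| ≤ 2 * ρ)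
    (hw : ‖w / ((e ^ m : ℝ) : ℂ)‖ ≤ M) :
    ‖z / ((d ^ m : ℝ) : ℂ) - w / ((e ^ m : ℝ) : ℂ)‖ ≤
      ‖z - w‖ * 2 ^ m / R ^ m + M * (m * 4 ^ m * (ρ / R)) := by
  have hd0 : 0 < d := by linarith
  have he0 : 0 < e := by linarith
  have hρ : 0 ≤ ρ := by linarith [abs_nonneg (d - e)]
  have h1 : z / ((d ^ m : ℝ) : ℂ) - w / ((e ^ m : ℝ) : ℂ) =
      (z - w) / ((d ^ m : ℝ) : ℂ) + w / ((e ^ m : ℝ) : ℂ) * (((e ^ m - d ^ m) / d ^ m : ℝ) : ℂ) := by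
    have : (d : ℂ) ≠ 0 := by exact_mod_cast hd0.ne'
    have : (e : ℂ) ≠ 0 := by exact_mod_cast he0.ne'
    push_cast
    field_simp
    ring
  have h2 : ‖((d ^ m : ℝ) : ℂ)‖ = d ^ m := by
    rw [Complex.norm_real, Real.norm_of_nonneg (by positivity)]
  have h3 : |(e ^ m - d ^ m) / d ^ m| ≤ m * 4 ^ m * (ρ / R) := by
    rw [abs_div, abs_of_pos (pow_pos hd0 m), div_le_iff₀ (by positivity)]
    have h4 := abs_pow_sub_pow_le e d m
    rw [abs_of_pos hd0, abs_of_pos he0, abs_sub_comm e d] at h4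
    calc |e ^ m - d ^ m| ≤ (2 * ρ) * m * (2 * R) ^ (m - 1) := by
          refine h4.trans ?_
          gcongr
          exact max_le he' hd'
      _ = m * 4 ^ m * (ρ / R) * (R / 2) ^ m := by
          obtain ⟨k, rfl⟩ : ∃ k, m = k + 1 := ⟨m - 1, by omega⟩
          rw [Nat.add_sub_cancel, show (4 : ℝ) ^ (k + 1) = 2 ^ (k + 1) * 2 ^ (k + 1) by
            rw [← mul_pow]; norm_num, div_pow]
          field_simp
          ring
      _ ≤ _ := by gcongr
  rw [h1]
  refine (norm_add_le _ _).trans (add_le_add ?_ ?_)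
  · rw [norm_div, h2, mul_div_assoc]
    rw [div_eq_mul_inv]
    gcongr
    calc (d ^ m)⁻¹ ≤ ((R / 2) ^ m)⁻¹ := by gcongr
      _ = _ := by rw [div_pow, inv_div]
  · rw [norm_mul, Complex.norm_real, Real.norm_eq_abs]
    exact mul_le_mul hw h3 (abs_nonneg _) ((norm_nonneg _).trans hw)

theorem multiKernel_eq (m : Fin l → ℕ) (A : Fin l → Rn n → ℂ) (K : Rn n → Rn n → ℂ) (x y : Rn n) :
    multiKernel m A K x y =
      (∏ j, taylorRemainder (m j) (A j) x y / ((‖x - y‖ ^ m j : ℝ) : ℂ)) * K x y := by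
  rw [multiKernel, Finset.prod_div_distrib]
  congr 2
  rw [← Complex.ofReal_prod, Finset.prod_pow_eq_pow_sum]

/-- Index set of the top-order derivatives of all the functions `A_j`. -/
abbrev TopIndex (n : ℕ) (m : Fin l → ℕ) : Type :=
  (j : Fin l) × {α // α ∈ Finset.piAntidiag (Finset.univ : Finset (Fin n)) (m j)}

/-- The family of all top-order derivatives. -/
def topDeriv (m : Fin l → ℕ) (A : Fin l → Rn n → ℂ) (i : TopIndex n m) : Rn n → ℂ :=
  weakDeriv i.2.1 (A i.1)

set_option maxHeartbeats 1000000 in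
/-- Size of the kernel near a ball and its smoothness far from it. -/
theorem exists_multiKernel_bound (hn : 0 < n) {δ ε : ℝ} (hδn : δ < n) (hε : 0 < ε)
    {K : Rn n → Rn n → ℂ} (hK : IsFractionalKernel δ ε K) {m : Fin l → ℕ} (hm : ∀ j, 0 < m j)
    {A : Fin l → Rn n → ℂ}
    (hA : ∀ j, ∀ α : Fin n → ℕ, mlen α ≤ m j → ∃ g, HasWeakDeriv α (A j) g)
    (hA_bmo : ∀ i : TopIndex n m, MemBMO (topDeriv m A i)) {η : ℝ} (hη : 0 < η) (hη1 : η < 1) :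
    ∃ C : ℝ, 0 ≤ C ∧ ∃ E : Set (Rn n), (∀ᵐ x, x ∈ E) ∧ ∀ (c : Rn n) (ρ : ℝ), 0 < ρ →
      ∀ x ∈ closedBall c ρ, x ∈ E →
        (∀ y ∈ closedBall c (8 * ρ), y ∈ E → x ≠ y → ‖multiKernel m A K x y‖ ≤
          C * weight (topDeriv m A) c ρ y ^ l * (ρ ^ (l * η) * ‖x - y‖ ^ (δ - n - l * η))) ∧
        ∀ x₀ ∈ closedBall c ρ, x₀ ∈ E → ∀ y, y ∈ E → 8 * ρ < ‖y - c‖ →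
          ‖multiKernel m A K x y - multiKernel m A K x₀ y‖ ≤
            C * weight (topDeriv m A) c ρ y ^ l *
              ((‖y - c‖ / ρ) ^ ((l + 1) * η - min 1 ε) * ‖y - c‖ ^ (δ - n)) := by
  obtain ⟨CK, hCK⟩ := hK.size
  obtain ⟨CR, hCR⟩ := hK.regularity
  have hw : ∀ j, ∀ α : Fin n → ℕ, mlen α ≤ m j → HasWeakDeriv α (A j) (weakDeriv α (A j)) := by
    intro j α hα
    rw [weakDeriv, dif_pos (hA j α hα)]
    exact (hA j α hα).choose_spec
  have hj := fun j => exists_taylorRemainder_bound hn hη hη1 (hm j) (hw j) hA_bmo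
    (fun α hα => ⟨⟨j, ⟨α, mem_piAntidiag_univ.2 hα⟩⟩, rfl⟩)
  choose C hC0 E hE hb using hj
  set C₀ : ℝ := ∑ j, C j with hC₀
  have hCj : ∀ j, C j ≤ C₀ := fun j =>
    Finset.single_le_sum (f := C) (fun j _ => hC0 j) (Finset.mem_univ j)
  have hC₀0 : 0 ≤ C₀ := Finset.sum_nonneg fun j _ => hC0 j
  set M : ℕ := ∑ j, m j with hM
  have hmM : ∀ j, m j ≤ M := fun j => Finset.single_le_sum (fun _ _ => Nat.zero_le _)
    (Finset.mem_univ j)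
  set C₁ : ℝ := 2 * C₀ * (1 + 2 ^ M + M * 4 ^ M) with hC₁
  have hC₁0 : 0 ≤ C₁ := by positivity
  set B₁ : ℝ := (C₀ * 64 ^ η) ^ l * |CK| with hB₁
  set B₂ : ℝ := C₁ ^ l * (l * |CK| * 2 ^ (n - δ) + |CR| * 2 ^ ε * 2 ^ (n + ε - δ)) with hB₂
  have hB₁0 : 0 ≤ B₁ := by positivity
  have hB₂0 : 0 ≤ B₂ := by positivity
  refine ⟨B₁ + B₂, by positivity, {x | ∀ j, x ∈ E j}, ?_, fun c ρ hρ x hx hxE => ⟨?_, ?_⟩⟩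
  · exact ae_all_iff.2 hE
  · intro y hy hyE hxy
    set W := weight (topDeriv m A) c ρ y with hW
    have hW1 : 1 ≤ W := one_le_weight _ c ρ y
    have hd0 : 0 < ‖x - y‖ := norm_pos_iff.2 (sub_ne_zero.2 hxy)
    set d := ‖x - y‖ with hd
    have hx8 : x ∈ closedBall c (8 * ρ) := closedBall_subset_closedBall (by linarith) hx
    -- The remainder bound is taken with R = 8ρ; 64 = 8·8 collects (R/ρ)^η and R^η.
    have h1 : ∀ j, ‖taylorRemainder (m j) (A j) x y / ((d ^ m j : ℝ) : ℂ)‖ ≤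
        C₀ * 64 ^ η * (W * (ρ ^ η * d ^ (-η))) := by
      intro j
      rw [norm_div, Complex.norm_real, Real.norm_of_nonneg (by positivity),
        div_le_iff₀ (by positivity)]
      refine ((hb j c ρ (8 * ρ) hρ (by linarith) x hx8 (hxE j) y hy (hyE j)).1).trans ?_
      rw [← hW, ← hd, mul_div_cancel_right₀ _ hρ.ne', Real.mul_rpow (by norm_num) hρ.le,
        show (64 : ℝ) = 8 * 8 by norm_num, Real.mul_rpow (by norm_num) (by norm_num),
        sub_eq_add_neg, Real.rpow_add hd0, Real.rpow_natCast]
      calc C j * (8 ^ η * W) * (8 ^ η * ρ ^ η * (d ^ m j * d ^ (-η)))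
          ≤ C₀ * (8 ^ η * W) * (8 ^ η * ρ ^ η * (d ^ m j * d ^ (-η))) := by
            gcongr; exact hCj j
        _ = _ := by ring
    have h2 : ‖K x y‖ ≤ |CK| * d ^ (-(n : ℝ) + δ) :=
      (hCK x y hxy).trans (by gcongr; exact le_abs_self _)
    rw [multiKernel_eq, norm_mul, norm_prod]
    calc _ ≤ (∏ _j : Fin l, C₀ * 64 ^ η * (W * (ρ ^ η * d ^ (-η)))) *
          (|CK| * d ^ (-(n : ℝ) + δ)) := by
          gcongr with j
          · exact h1 j
      _ = B₁ * W ^ l * (ρ ^ (l * η) * d ^ (δ - n - l * η)) := by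
          rw [Finset.prod_const, Finset.card_univ, Fintype.card_fin, mul_pow (C₀ * 64 ^ η),
            mul_pow W, mul_pow (ρ ^ η), hB₁,
            ← Real.rpow_natCast (ρ ^ η), ← Real.rpow_mul hρ.le, ← Real.rpow_natCast (d ^ (-η)),
            ← Real.rpow_mul hd0.le, show δ - n - l * η = -η * l + (-(n : ℝ) + δ) by ring,
            Real.rpow_add hd0 (-η * l), mul_comm (l : ℝ) η]
          ring
      _ ≤ _ := by
          gcongr
          linarith
  · intro x₀ hx₀ hx₀E y hyE hy
    set W := weight (topDeriv m A) c ρ y with hW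
    have hW1 : 1 ≤ W := one_le_weight _ c ρ y
    -- The remainder bounds are applied on B(c,R), with y on its boundary. For points z of B(c,ρ)
    -- the distance to y is comparable to R.
    set R := ‖y - c‖ with hR
    have hR0 : 0 < R := by linarith
    have hyR : y ∈ closedBall c R := by rw [mem_closedBall, dist_eq_norm]
    have hsub : closedBall c ρ ⊆ closedBall c R := closedBall_subset_closedBall (by linarith)
    have hdist : ∀ z ∈ closedBall c ρ, 4 * ρ ≤ ‖z - y‖ ∧ R / 2 ≤ ‖z - y‖ ∧ ‖z - y‖ ≤ 2 * R := by
      intro z hz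
      rw [mem_closedBall, dist_eq_norm] at hz
      have e1 : y - c = (z - c) - (z - y) := by abel
      have e2 : z - y = (z - c) - (y - c) := by abel
      have h1 : R ≤ ‖z - c‖ + ‖z - y‖ := by rw [hR, e1]; exact norm_sub_le _ _
      have h2 : ‖z - y‖ ≤ ‖z - c‖ + R := by rw [e2]; exact norm_sub_le _ _
      refine ⟨by linarith, by linarith, by linarith⟩
    obtain ⟨hx4, hxl, hxu⟩ := hdist x hx
    obtain ⟨hx₀4, hx₀l, hx₀u⟩ := hdist x₀ hx₀
    have hxx₀ : ‖x - x₀‖ ≤ 2 * ρ := by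
      rw [mem_closedBall] at hx hx₀
      rw [← dist_eq_norm]
      exact (dist_triangle_right x x₀ c).trans (by linarith)
    have hxy : x ≠ y := fun h => by rw [h, sub_self, norm_zero] at hx4; linarith
    have hx₀y : x₀ ≠ y := fun h => by rw [h, sub_self, norm_zero] at hx₀4; linarith
    have h2η : (2 : ℝ) ^ η ≤ 2 := by
      calc (2 : ℝ) ^ η ≤ 2 ^ (1 : ℝ) := Real.rpow_le_rpow_of_exponent_le (by norm_num) hη1.le
        _ = 2 := Real.rpow_one 2
    have h2η' : (2 : ℝ) ^ (1 - η) ≤ 2 := by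
      calc (2 : ℝ) ^ (1 - η) ≤ 2 ^ (1 : ℝ) :=
            Real.rpow_le_rpow_of_exponent_le (by norm_num) (by linarith)
        _ = 2 := Real.rpow_one 2
    set Z := (R / ρ) ^ η * W with hZ
    have hZ0 : 0 ≤ Z := by positivity
    -- Relative variation of one factor: Hölder order 1-η for the remainder, and ρ/R ≤ θ for the
    -- power of the distance.
    set θ := (ρ / R) ^ (1 - η) with hθ
    have hθ0 : 0 < θ := by positivity
    have hθ1 : ρ / R ≤ θ := by
      conv_lhs => rw [← Real.rpow_one (ρ / R)]
      exact Real.rpow_le_rpow_of_exponent_ge (by positivity)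
        ((div_le_one hR0).2 (by linarith)) (by linarith)
    have hsize : ∀ z ∈ closedBall c ρ, (∀ j, z ∈ E j) → ∀ j,
        ‖taylorRemainder (m j) (A j) z y / ((‖z - y‖ ^ m j : ℝ) : ℂ)‖ ≤ 2 * C₀ * Z := by
      intro z hz hzE j
      obtain ⟨-, hzl, hzu⟩ := hdist z hz
      have hd0 : 0 < ‖z - y‖ := by linarith
      rw [norm_div, Complex.norm_real, Real.norm_of_nonneg (by positivity),
        div_le_iff₀ (by positivity)]
      refine ((hb j c ρ R hρ (by linarith) z (hsub hz) (hzE j) y hyR (hyE j)).1).trans ?_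
      rw [sub_eq_add_neg (m j : ℝ) η, Real.rpow_add hd0, Real.rpow_natCast]
      have h3 : R ^ η * ‖z - y‖ ^ (-η) ≤ 2 := by
        rw [Real.rpow_neg hd0.le, ← div_eq_mul_inv, ← Real.div_rpow hR0.le hd0.le]
        refine le_trans ?_ h2η
        gcongr
        rw [div_le_iff₀ hd0]; linarith
      calc C j * Z * (R ^ η * (‖z - y‖ ^ m j * ‖z - y‖ ^ (-η)))
          = C j * Z * ‖z - y‖ ^ m j * (R ^ η * ‖z - y‖ ^ (-η)) := by ring
        _ ≤ C₀ * Z * ‖z - y‖ ^ m j * 2 := by gcongr; exact hCj j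
        _ = _ := by ring
    have hdiff : ∀ j, ‖taylorRemainder (m j) (A j) x y / ((‖x - y‖ ^ m j : ℝ) : ℂ) -
        taylorRemainder (m j) (A j) x₀ y / ((‖x₀ - y‖ ^ m j : ℝ) : ℂ)‖ ≤ C₁ * Z * θ := by
      intro j
      have hde : |‖x - y‖ - ‖x₀ - y‖| ≤ 2 * ρ := by
        refine (abs_norm_sub_norm_le _ _).trans ?_
        rwa [sub_sub_sub_cancel_right]
      refine (norm_div_pow_sub_div_pow_le (hm j) hR0 hxl hxu hx₀l hx₀u hde
        (hsize x₀ hx₀ hx₀E j)).trans ?_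
      have h4 := (hb j c ρ R hρ (by linarith) x (hsub hx) (hxE j) y hyR (hyE j)).2 x₀ (hsub hx₀)
        (hx₀E j)
      have h5 : R ^ (m j - 1) * (R ^ η * ‖x - x₀‖ ^ (1 - η)) ≤ 2 * (R ^ m j * θ) := by
        calc R ^ (m j - 1) * (R ^ η * ‖x - x₀‖ ^ (1 - η))
            ≤ R ^ (m j - 1) * (R ^ η * (2 * ρ) ^ (1 - η)) := by
              gcongr
          _ = 2 ^ (1 - η) * (R ^ (m j - 1) * R * θ) := by
              rw [Real.mul_rpow (by norm_num) hρ.le, hθ, Real.div_rpow hρ.le hR0.le,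
                Real.rpow_sub hR0, Real.rpow_one]
              field_simp
          _ = 2 ^ (1 - η) * (R ^ m j * θ) := by
              rw [← pow_succ, Nat.sub_add_cancel (hm j)]
          _ ≤ _ := by gcongr
      calc _ ≤ (C₀ * Z * (2 * (R ^ m j * θ))) * 2 ^ m j / R ^ m j +
            2 * C₀ * Z * (m j * 4 ^ m j * θ) := by
            gcongr
            refine h4.trans ?_
            gcongr
            exact hCj j
        _ = 2 * C₀ * (2 ^ m j + m j * 4 ^ m j) * Z * θ := by
            field_simp
        _ ≤ 2 * C₀ * (2 ^ M + M * 4 ^ M) * Z * θ := by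
            have := hmM j
            have h6 : (m j : ℝ) ≤ M := by exact_mod_cast this
            gcongr <;> norm_num
        _ ≤ _ := by
            rw [hC₁]
            gcongr
            linarith
    have hCC : 2 * C₀ * Z ≤ C₁ * Z := by
      rw [hC₁]
      refine mul_le_mul_of_nonneg_right (le_mul_of_one_le_right (by positivity) ?_) hZ0
      rw [add_assoc]
      exact le_add_of_nonneg_right (by positivity)
    have hprod := norm_prod_sub_prod_le Finset.univ (fun j _ => (hsize x hx hxE j).trans hCC)
      (fun j _ => (hsize x₀ hx₀ hx₀E j).trans hCC) (fun j _ => hdiff j)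
    rw [Finset.card_univ, Fintype.card_fin] at hprod
    have hprod₀ : ‖∏ j, taylorRemainder (m j) (A j) x₀ y / ((‖x₀ - y‖ ^ m j : ℝ) : ℂ)‖ ≤
        (C₁ * Z) ^ l := by
      rw [norm_prod]
      refine (Finset.prod_le_prod (fun _ _ => norm_nonneg _)
        fun j _ => (hsize x₀ hx₀ hx₀E j).trans hCC).trans (le_of_eq ?_)
      rw [Finset.prod_const, Finset.card_univ, Fintype.card_fin]
    have hKx : ‖K x y‖ ≤ |CK| * (2 ^ (n - δ) * R ^ (δ - n)) := by
      refine (hCK x y hxy).trans ?_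
      calc CK * ‖x - y‖ ^ (-(n : ℝ) + δ) ≤ |CK| * (R / 2) ^ (-(n : ℝ) + δ) := by
            refine mul_le_mul (le_abs_self _) ?_ (by positivity) (abs_nonneg _)
            exact Real.rpow_le_rpow_of_nonpos (by positivity) hxl (by linarith)
        _ = _ := by
            rw [Real.div_rpow hR0.le (by norm_num), div_eq_mul_inv, ← Real.rpow_neg (by norm_num),
              show -(-(n : ℝ) + δ) = n - δ by ring, show -(n : ℝ) + δ = δ - n by ring, mul_comm (R ^ _)]
    have hKd : ‖K x y - K x₀ y‖ ≤
        |CR| * (2 ^ ε * 2 ^ (n + ε - δ) * ((ρ / R) ^ ε * R ^ (δ - n))) := by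
      have h7 : 2 * ‖x - x₀‖ ≤ ‖y - x₀‖ := by rw [norm_sub_rev y x₀]; linarith
      have h8 := (le_add_of_nonneg_right (norm_nonneg _)).trans (hCR y x x₀ hx₀y.symm h7)
      rw [norm_sub_rev y x₀] at h8
      refine h8.trans ?_
      calc CR * ‖x - x₀‖ ^ ε * ‖x₀ - y‖ ^ (-(n : ℝ) - ε + δ)
          ≤ |CR| * (2 * ρ) ^ ε * (R / 2) ^ (-(n : ℝ) - ε + δ) := by
            have h9 := Real.rpow_le_rpow_of_nonpos (by positivity) hx₀l
              (show -(n : ℝ) - ε + δ ≤ 0 by linarith)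
            have h10 : ‖x - x₀‖ ^ ε ≤ (2 * ρ) ^ ε := by gcongr
            refine mul_le_mul (mul_le_mul (le_abs_self _) h10 (by positivity) (abs_nonneg _)) h9
              (by positivity) (by positivity)
        _ = _ := by
            rw [Real.div_rpow hR0.le (by norm_num), div_eq_mul_inv, ← Real.rpow_neg (by norm_num),
              show -(-(n : ℝ) - ε + δ) = n + ε - δ by ring,
              show -(n : ℝ) - ε + δ = -ε + (δ - n) by ring, Real.rpow_add hR0,
              Real.mul_rpow (by norm_num) hρ.le, Real.div_rpow hρ.le hR0.le, Real.rpow_neg hR0.le]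
            ring
    rw [multiKernel_eq, multiKernel_eq]
    set P := ∏ j, taylorRemainder (m j) (A j) x y / ((‖x - y‖ ^ m j : ℝ) : ℂ) with hP
    set P₀ := ∏ j, taylorRemainder (m j) (A j) x₀ y / ((‖x₀ - y‖ ^ m j : ℝ) : ℂ) with hP₀
    have hRρ : 1 ≤ R / ρ := (one_le_div hρ).2 (by linarith)
    have hq : ∀ s : ℝ, (ρ / R) ^ s = (R / ρ) ^ (-s) := by
      intro s
      rw [Real.rpow_neg (by positivity), ← Real.inv_rpow (by positivity), inv_div]
    have hZl : (C₁ * Z) ^ l = C₁ ^ l * W ^ l * (R / ρ) ^ (η * l) := by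
      rw [mul_pow C₁, hZ, mul_pow _ W, ← Real.rpow_natCast ((R / ρ) ^ η), ← Real.rpow_mul (by positivity)]
      ring
    -- The l remainders contribute (R/ρ)^(lη). Varying one of them gains (R/ρ)^(η-1), varying K
    -- gains (R/ρ)^(-ε); τ dominates both resulting exponents.
    set τ := (l + 1) * η - min 1 ε with hτ
    have hτ1 : (R / ρ) ^ (η * l) * θ ≤ (R / ρ) ^ τ := by
      rw [hθ, hq, ← Real.rpow_add (by positivity)]
      refine Real.rpow_le_rpow_of_exponent_le hRρ ?_
      have := min_le_left 1 ε
      rw [hτ]; linarith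
    have hτ2 : (R / ρ) ^ (η * l) * (ρ / R) ^ ε ≤ (R / ρ) ^ τ := by
      rw [hq, ← Real.rpow_add (by positivity)]
      refine Real.rpow_le_rpow_of_exponent_le hRρ ?_
      have := min_le_right 1 ε
      rw [hτ]; linarith
    calc ‖P * K x y - P₀ * K x₀ y‖ = ‖(P - P₀) * K x y + P₀ * (K x y - K x₀ y)‖ := by
          congr 1; ring
      _ ≤ ‖P - P₀‖ * ‖K x y‖ + ‖P₀‖ * ‖K x y - K x₀ y‖ := by
          rw [← norm_mul, ← norm_mul]; exact norm_add_le _ _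
      _ ≤ (l * ((C₁ * Z) ^ l * θ)) * (|CK| * (2 ^ (n - δ) * R ^ (δ - n))) +
          (C₁ * Z) ^ l * (|CR| * (2 ^ ε * 2 ^ (n + ε - δ) * ((ρ / R) ^ ε * R ^ (δ - n)))) := by
          gcongr
      _ = C₁ ^ l * W ^ l * R ^ (δ - n) * (l * |CK| * 2 ^ (n - δ) * ((R / ρ) ^ (η * l) * θ) +
          |CR| * 2 ^ ε * 2 ^ (n + ε - δ) * ((R / ρ) ^ (η * l) * (ρ / R) ^ ε)) := by
          rw [hZl]; ring
      _ ≤ C₁ ^ l * W ^ l * R ^ (δ - n) * (l * |CK| * 2 ^ (n - δ) * (R / ρ) ^ τ +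
          |CR| * 2 ^ ε * 2 ^ (n + ε - δ) * (R / ρ) ^ τ) := by gcongr
      _ = B₂ * W ^ l * ((R / ρ) ^ τ * R ^ (δ - n)) := by rw [hB₂]; ring
      _ ≤ _ := by
          exact mul_le_mul_of_nonneg_right (mul_le_mul_of_nonneg_right
            (le_add_of_nonneg_left hB₁0) (by positivity)) (by positivity)

end Kernel

/-! ### Integrated near and far estimates against a scalar function. -/

section Oscillation

variable {n l : ℕ}

theorem exists_lintegral_norm_rpow_le (hn : 0 < n) {ν : ℝ} (hν : 0 < ν) :
    ∃ C : ℝ, 0 ≤ C ∧ ∀ (y : Rn n) (r : ℝ), 0 < r →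
      ∫⁻ x in closedBall y r, ENNReal.ofReal (‖x - y‖ ^ (ν - n)) ≤ ENNReal.ofReal (C * r ^ ν) := by
  have : NeZero n := ⟨hn.ne'⟩
  have hint : IntegrableOn (fun x : Rn n => ‖x‖ ^ (ν - n)) (ball 0 2) := by
    rw [integrableOn_fun_norm_addHaar (volume : Measure (Rn n)) (f := fun t => t ^ (ν - n)),
      finrank_euclideanSpace, Fintype.card_fin]
    refine IntegrableOn.congr_fun ((intervalIntegral.integrableOn_Ioo_rpow_iff
      (s := ν - 1) (t := 2) (by norm_num)).2 (by linarith)) (fun t ht => ?_) measurableSet_Ioo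
    have ht0 : 0 < t := ht.1
    simp only [smul_eq_mul]
    rw [← Real.rpow_natCast, ← Real.rpow_add ht0, Nat.cast_sub hn]
    congr 1; push_cast; ring
  have hint' : IntegrableOn (fun x : Rn n => ‖x‖ ^ (ν - n)) (closedBall 0 1) :=
    hint.mono_set (closedBall_subset_ball (by norm_num))
  refine ⟨∫ x in closedBall (0 : Rn n) 1, ‖x‖ ^ (ν - n), integral_nonneg fun x => by positivity,
    fun y r hr => le_of_eq ?_⟩
  have h := lintegral_closedBall_comp_affine (h := fun x : Rn n => ENNReal.ofReal (‖x - y‖ ^ (ν - n)))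
    (by fun_prop) y (s := 1) hr
  rw [mul_one] at h
  have h1 : ∀ w : Rn n, ENNReal.ofReal (‖y + r • w - y‖ ^ (ν - n)) =
      ENNReal.ofReal (r ^ (ν - n)) * ENNReal.ofReal (‖w‖ ^ (ν - n)) := by
    intro w
    rw [add_sub_cancel_left, norm_smul, Real.norm_of_nonneg hr.le,
      Real.mul_rpow hr.le (norm_nonneg _), ENNReal.ofReal_mul (by positivity)]
  simp_rw [h1] at h
  rw [lintegral_const_mul' _ _ ENNReal.ofReal_ne_top, ← ofReal_integral_eq_lintegral_ofReal hint'
    (Eventually.of_forall fun x => by positivity), ← ENNReal.ofReal_mul (by positivity)] at h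
  calc _ = ENNReal.ofReal (r ^ n) * (ENNReal.ofReal ((r ^ n)⁻¹) *
        ∫⁻ x in closedBall y r, ENNReal.ofReal (‖x - y‖ ^ (ν - n))) := by
        rw [← mul_assoc, ← ENNReal.ofReal_mul (by positivity), mul_inv_cancel₀ (by positivity),
          ENNReal.ofReal_one, one_mul]
    _ = _ := by
        rw [← h, ← ENNReal.ofReal_mul (by positivity)]
        congr 1
        rw [Real.rpow_sub hr, Real.rpow_natCast]
        field_simp

theorem aemeasurable_weight_pow_mul {ι : Type*} [Fintype ι] {b : ι → Rn n → ℂ}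
    (hb : ∀ i, MemBMO (b i)) (c : Rn n) (ρ : ℝ) (l : ℕ) {u : Rn n → ℝ≥0∞}
    (hu : AEMeasurable u volume) :
    AEMeasurable (fun y => ENNReal.ofReal (weight b c ρ y) ^ l * u y) volume :=
  ((aestronglyMeasurable_weight hb c ρ).aemeasurable.ennreal_ofReal.pow_const l).mul hu

/-- Hölder's inequality with exponents s' and s: the powers of the weight cost only (R/ρ)^η beyond
the trivial volume factor. -/
theorem exists_lintegral_weight_mul_le (hn : 0 < n) {ι : Type*} [Fintype ι] {b : ι → Rn n → ℂ}
    (hb : ∀ i, MemBMO (b i)) (l : ℕ) {η s : ℝ} (hη : 0 < η) (hs : 1 < s) :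
    ∃ C : ℝ, 0 ≤ C ∧ ∀ (c : Rn n) (ρ R : ℝ), 0 < ρ → ρ ≤ R → ∀ u : Rn n → ℝ≥0∞,
      AEMeasurable u volume →
      ∫⁻ y in closedBall c R, ENNReal.ofReal (weight b c ρ y) ^ l * u y ≤
        ENNReal.ofReal (C * (R / ρ) ^ η * R ^ ((n : ℝ) - n / s)) *
          (∫⁻ y in closedBall c R, u y ^ s) ^ (1 / s) := by
  set s' := s.conjExponent with hs'
  have hpq : s.HolderConjugate s' := Real.HolderConjugate.conjExponent hs
  have hs'1 : 1 < s' := hpq.symm.lt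
  have hs'0 : 0 < s' := by linarith
  -- Exponent l+1 instead of l keeps q ≥ 1 when l = 0; this is harmless because the weight is at
  -- least 1.
  have hq : 1 ≤ ((l : ℝ) + 1) * s' := by
    have : (0 : ℝ) ≤ l := Nat.cast_nonneg l
    nlinarith
  obtain ⟨C, hC0, hC⟩ := exists_weight_growth hn hb hq (mul_pos hη hs'0)
  set v : ℝ := volume.real (ball (0 : Rn n) 1) with hv
  have hV : volume (ball (0 : Rn n) 1) = ENNReal.ofReal v :=
    (ENNReal.ofReal_toReal measure_ball_lt_top.ne).symm
  have hv0 : 0 ≤ v := ENNReal.toReal_nonneg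
  refine ⟨C ^ (1 / s') * v ^ (1 / s'), by positivity, fun c ρ R hρ hR u hu => ?_⟩
  have hR0 : 0 < R := hρ.trans_le hR
  have hH := ENNReal.lintegral_mul_le_Lp_mul_Lq (volume.restrict (closedBall c R)) hpq.symm
    (f := fun y => ENNReal.ofReal (weight b c ρ y) ^ l) (g := u)
    (((aestronglyMeasurable_weight hb c ρ).aemeasurable.ennreal_ofReal.pow_const l).mono_measure
      Measure.restrict_le_self) (hu.mono_measure Measure.restrict_le_self)
  refine hH.trans ?_
  gcongr
  have h1 : ∫⁻ y in closedBall c R, (ENNReal.ofReal (weight b c ρ y) ^ l) ^ s' ≤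
      ENNReal.ofReal (C * (R / ρ) ^ (η * s') * (R ^ n * v)) := by
    refine le_trans (lintegral_mono fun y => ?_) ((hC c ρ R hρ hR).trans (le_of_eq ?_))
    · have hw : 1 ≤ ENNReal.ofReal (weight b c ρ y) := by
        rw [ENNReal.one_le_ofReal]; exact one_le_weight b c ρ y
      dsimp only
      rw [← ENNReal.rpow_natCast, ← ENNReal.rpow_mul]
      exact ENNReal.rpow_le_rpow_of_exponent_le hw (by gcongr; linarith)
    · rw [volume_closedBall c hR0.le, hV, ← ENNReal.ofReal_mul (by positivity),
        ← ENNReal.ofReal_mul (by positivity)]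
  refine (ENNReal.rpow_le_rpow h1 (by positivity)).trans (le_of_eq ?_)
  rw [ENNReal.ofReal_rpow_of_nonneg (by positivity) (by positivity)]
  congr 1
  rw [Real.mul_rpow (by positivity) (by positivity), Real.mul_rpow hC0 (by positivity),
    Real.mul_rpow (by positivity) hv0, ← Real.rpow_mul (by positivity), ← Real.rpow_natCast,
    ← Real.rpow_mul hR0.le, mul_assoc η, mul_one_div_cancel hs'0.ne', mul_one]
  have h2 : (n : ℝ) * (1 / s') = n - n / s := by
    have := hpq.inv_add_inv_eq_one
    rw [one_div, show s'⁻¹ = 1 - s⁻¹ by linarith]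
    ring
  rw [h2]
  ring

theorem mem_shell_of_lt {ρ t : ℝ} (hρ : 0 < ρ) (ht : 8 * ρ < t) :
    ∃ k : ℕ, 2 ^ k * ρ ≤ t ∧ t ≤ 2 ^ (k + 1) * ρ := by
  obtain ⟨k, hk1, hk2⟩ := exists_nat_pow_near (x := t / ρ) (y := 2)
    ((one_le_div hρ).2 (by linarith)) (by norm_num)
  exact ⟨k, (le_div_iff₀ hρ).1 hk1, ((div_lt_iff₀ hρ).1 hk2).le⟩

/-- The local integral of the kernel over pairs of points of a ball, and the integral of the
oscillation of the kernel far from the ball. -/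
theorem exists_oscillation_bound (hn : 0 < n) {δ ε : ℝ} (hδn : δ < n) (hε : 0 < ε)
    {K : Rn n → Rn n → ℂ} (hK : IsFractionalKernel δ ε K) {m : Fin l → ℕ} (hm : ∀ j, 0 < m j)
    {A : Fin l → Rn n → ℂ}
    (hA : ∀ j, ∀ α : Fin n → ℕ, mlen α ≤ m j → ∃ g, HasWeakDeriv α (A j) g)
    (hA_bmo : ∀ i : TopIndex n m, MemBMO (topDeriv m A i)) {s : ℝ} (hs : 1 < s) (hδ : 0 < δ) :
    ∃ C : ℝ≥0, ∃ E : Set (Rn n), (∀ᵐ x, x ∈ E) ∧ ∀ (c : Rn n) (ρ : ℝ), 0 < ρ →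
      ∀ u : Rn n → ℝ≥0∞, AEMeasurable u volume → ∀ N : ℝ≥0∞,
      (∀ R, ρ ≤ R → (∫⁻ y in closedBall c R, u y ^ s) ^ (1 / s) ≤
        N * ENNReal.ofReal (R ^ (n / s - δ))) →
      (∫⁻ x in closedBall c ρ, ∫⁻ y in closedBall c (8 * ρ), ‖multiKernel m A K x y‖ₑ * u y ≤
        C * N * ENNReal.ofReal (ρ ^ n)) ∧
      ∀ x ∈ closedBall c ρ, x ∈ E → ∀ x₀ ∈ closedBall c ρ, x₀ ∈ E →
        ∫⁻ y in (closedBall c (8 * ρ))ᶜ,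
          ‖multiKernel m A K x y - multiKernel m A K x₀ y‖ₑ * u y ≤ C * N := by
  have : NeZero n := ⟨hn.ne'⟩
  -- Small enough that ν = δ - lη > 0 (integrability at the diagonal) and τ + η = (l+2)η - min(1,ε)
  -- < 0 (convergence of the dyadic sum).
  set η : ℝ := min 1 (min ε δ) / (2 * (l + 2)) with hηdef
  have hmin : 0 < min 1 (min ε δ) := lt_min one_pos (lt_min hε hδ)
  have hη : 0 < η := by positivity
  have hη2 : (l + 2) * η = min 1 (min ε δ) / 2 := by rw [hηdef]; field_simp
  have hl0 : (0 : ℝ) ≤ l := Nat.cast_nonneg l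
  have hlη : 0 ≤ l * η := by positivity
  have hm1 : min 1 (min ε δ) ≤ min 1 ε := min_le_min le_rfl (min_le_left _ _)
  have hm2 : min 1 (min ε δ) ≤ δ := (min_le_right _ _).trans (min_le_right _ _)
  have hm3 : min 1 (min ε δ) ≤ 1 := min_le_left _ _
  have hη1 : η < 1 := by linarith
  set ν := δ - l * η with hνdef
  have hν : 0 < ν := by linarith
  set τ := (l + 1) * η - min 1 ε with hτ
  have hτη : τ + η < 0 := by linarith
  obtain ⟨C₁, hC₁, E, hE, hk⟩ := exists_multiKernel_bound hn hδn hε hK hm hA hA_bmo hη hη1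
  obtain ⟨C₂, hC₂, hW⟩ := exists_lintegral_weight_mul_le hn hA_bmo l hη hs
  obtain ⟨C₃, hC₃, hI⟩ := exists_lintegral_norm_rpow_le hn hν
  have hq : (2 : ℝ) ^ (τ + η) < 1 := Real.rpow_lt_one_of_one_lt_of_neg (by norm_num) hτη
  have hq' : (1 - ENNReal.ofReal ((2 : ℝ) ^ (τ + η)))⁻¹ ≠ ∞ := by
    rw [ENNReal.inv_ne_top]
    exact (tsub_pos_of_lt (by rwa [ENNReal.ofReal_lt_one])).ne'
  set Bn : ℝ := C₁ * C₃ * 9 ^ ν * C₂ * 8 ^ η * 8 ^ (n - δ) with hBn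
  set Bf : ℝ := C₁ * C₂ * 2 ^ η * 2 ^ (n - δ) with hBf
  have hBft : ENNReal.ofReal Bf * (1 - ENNReal.ofReal ((2 : ℝ) ^ (τ + η)))⁻¹ ≠ ∞ :=
    ENNReal.mul_ne_top ENNReal.ofReal_ne_top hq'
  refine ⟨Bn.toNNReal + (ENNReal.ofReal Bf * (1 - ENNReal.ofReal ((2 : ℝ) ^ (τ + η)))⁻¹).toNNReal,
    E, hE, fun c ρ hρ u hu N hN => ?_⟩
  rw [ENNReal.coe_add, ENNReal.coe_toNNReal hBft]
  change (_ ≤ (ENNReal.ofReal Bn + _) * _ * _) ∧ ∀ x ∈ _, _ → ∀ x₀ ∈ _, _ → _ ≤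
    (ENNReal.ofReal Bn + _) * _
  set h : Rn n → ℝ≥0∞ := fun y => ENNReal.ofReal (weight (topDeriv m A) c ρ y) ^ l * u y with hh
  have hhm : AEMeasurable h volume := aemeasurable_weight_pow_mul hA_bmo c ρ l hu
  -- Hölder's R^(n-n/s) meets the assumed R^(n/s-δ), so s disappears from the power of R.
  have hhR : ∀ R, ρ ≤ R → ∫⁻ y in closedBall c R, h y ≤
      ENNReal.ofReal (C₂ * (R / ρ) ^ η * R ^ (n - δ)) * N := by
    intro R hR
    have hR0 : 0 < R := hρ.trans_le hR
    calc _ ≤ ENNReal.ofReal (C₂ * (R / ρ) ^ η * R ^ ((n : ℝ) - n / s)) *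
          (N * ENNReal.ofReal (R ^ (n / s - δ))) :=
          (hW c ρ R hρ hR u hu).trans (by gcongr; exact hN R hR)
      _ = (ENNReal.ofReal (C₂ * (R / ρ) ^ η * R ^ ((n : ℝ) - n / s)) *
          ENNReal.ofReal (R ^ (n / s - δ))) * N := by ring
      _ = _ := by
          rw [← ENNReal.ofReal_mul (by positivity), mul_assoc (C₂ * _), ← Real.rpow_add hR0]
          congr 4
          ring
  constructor
  · have hpt : ∀ x ∈ closedBall c ρ, x ∈ E →
        ∫⁻ y in closedBall c (8 * ρ), ‖multiKernel m A K x y‖ₑ * u y ≤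
        ∫⁻ y in closedBall c (8 * ρ), ENNReal.ofReal (C₁ * ρ ^ (l * η)) *
          (ENNReal.ofReal (‖x - y‖ ^ (ν - n)) * h y) := by
      intro x hx hxE
      refine lintegral_mono_ae ((ae_restrict_iff' measurableSet_closedBall).2 ?_)
      have hne : ∀ᵐ y : Rn n, y ≠ x := by
        simp [ae_iff]
      filter_upwards [hE, hne] with y hyE hyx hy
      have hb := (hk c ρ hρ x hx hxE).1 y hy hyE hyx.symm
      have hw0 : 0 ≤ weight (topDeriv m A) c ρ y := zero_le_one.trans (one_le_weight _ _ _ _)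
      rw [show δ - n - l * η = ν - n by rw [hνdef]; ring] at hb
      calc ‖multiKernel m A K x y‖ₑ * u y
          ≤ ENNReal.ofReal (C₁ * weight (topDeriv m A) c ρ y ^ l *
              (ρ ^ (l * η) * ‖x - y‖ ^ (ν - n))) * u y := by
            gcongr
            rw [← ofReal_norm]
            exact ENNReal.ofReal_le_ofReal hb
        _ = _ := by
            rw [hh, show C₁ * weight (topDeriv m A) c ρ y ^ l * (ρ ^ (l * η) * ‖x - y‖ ^ (ν - n)) =
              C₁ * ρ ^ (l * η) * ‖x - y‖ ^ (ν - n) * weight (topDeriv m A) c ρ y ^ l by ring,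
              ENNReal.ofReal_mul (by positivity), ENNReal.ofReal_mul (by positivity),
              ENNReal.ofReal_pow hw0]
            ring
    have hswap : AEMeasurable (Function.uncurry fun x y : Rn n =>
        ENNReal.ofReal (C₁ * ρ ^ (l * η)) * (ENNReal.ofReal (‖x - y‖ ^ (ν - n)) * h y))
        ((volume.restrict (closedBall c ρ)).prod (volume.restrict (closedBall c (8 * ρ)))) := by
      have e1 : Measurable fun p : Rn n × Rn n => ENNReal.ofReal (‖p.1 - p.2‖ ^ (ν - n)) := by
        fun_prop
      have e2 : AEMeasurable (fun p : Rn n × Rn n => h p.2)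
          ((volume.restrict (closedBall c ρ)).prod (volume.restrict (closedBall c (8 * ρ)))) :=
        (hhm.mono_measure Measure.restrict_le_self).comp_snd
      exact (e1.aemeasurable.mul e2).const_mul _
    calc _ ≤ ∫⁻ x in closedBall c ρ, ∫⁻ y in closedBall c (8 * ρ),
          ENNReal.ofReal (C₁ * ρ ^ (l * η)) * (ENNReal.ofReal (‖x - y‖ ^ (ν - n)) * h y) := by
          refine lintegral_mono_ae ((ae_restrict_iff' measurableSet_closedBall).2 ?_)
          filter_upwards [hE] with x hxE hx using hpt x hx hxE
      _ = ∫⁻ y in closedBall c (8 * ρ), ∫⁻ x in closedBall c ρ,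
          ENNReal.ofReal (C₁ * ρ ^ (l * η)) * (ENNReal.ofReal (‖x - y‖ ^ (ν - n)) * h y) :=
          lintegral_lintegral_swap hswap
      _ ≤ ∫⁻ y in closedBall c (8 * ρ), ENNReal.ofReal (C₁ * ρ ^ (l * η)) *
          ENNReal.ofReal (C₃ * (9 * ρ) ^ ν) * h y := by
          refine lintegral_mono_ae ((ae_restrict_iff' measurableSet_closedBall).2
            (Eventually.of_forall fun y hy => ?_))
          rw [lintegral_const_mul' _ _ ENNReal.ofReal_ne_top, lintegral_mul_const _ (by fun_prop),
            ← mul_assoc]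
          gcongr
          -- For y in B(c,8ρ), the ball B(c,ρ) is contained in B(y,9ρ).
          refine (lintegral_mono_set ?_).trans (hI y (9 * ρ) (by positivity))
          apply closedBall_subset_closedBall'
          rw [mem_closedBall, dist_comm] at hy
          linarith
      _ ≤ ENNReal.ofReal (C₁ * ρ ^ (l * η)) * ENNReal.ofReal (C₃ * (9 * ρ) ^ ν) *
          (ENNReal.ofReal (C₂ * (8 * ρ / ρ) ^ η * (8 * ρ) ^ (n - δ)) * N) := by
          rw [lintegral_const_mul'' _ (hhm.mono_measure Measure.restrict_le_self)]
          gcongr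
          exact hhR _ (by linarith)
      _ = ENNReal.ofReal Bn * N * ENNReal.ofReal (ρ ^ n) := by
          rw [← ENNReal.ofReal_mul (by positivity), ← mul_assoc, ← ENNReal.ofReal_mul (by positivity),
            mul_right_comm (ENNReal.ofReal Bn), ← ENNReal.ofReal_mul (by positivity)]
          congr 2
          rw [mul_div_cancel_right₀ _ hρ.ne', Real.mul_rpow (by norm_num) hρ.le,
            Real.mul_rpow (by norm_num) hρ.le, hBn,
            show ρ ^ n = ρ ^ (l * η) * (ρ ^ ν * ρ ^ (n - δ)) by
              rw [← Real.rpow_add hρ, ← Real.rpow_add hρ, ← Real.rpow_natCast]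
              congr 1; rw [hνdef]; ring]
          ring
      _ ≤ _ := by
          gcongr
          exact le_self_add
  · intro x hx hxE x₀ hx₀ hx₀E
    -- At each y a single term, that of its dyadic shell, already dominates; full balls may
    -- therefore replace shells in the sum.
    have hpt : ∀ᵐ y, y ∈ (closedBall c (8 * ρ))ᶜ →
        ‖multiKernel m A K x y - multiKernel m A K x₀ y‖ₑ * u y ≤
        ∑' k : ℕ, (closedBall c (2 ^ (k + 1) * ρ)).indicator (fun y =>
          ENNReal.ofReal (C₁ * ((2 ^ k) ^ τ * (2 ^ k * ρ) ^ (δ - n))) * h y) y := by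
      filter_upwards [hE] with y hyE hy
      have hy8 : 8 * ρ < ‖y - c‖ := by
        rwa [mem_compl_iff, mem_closedBall, not_le, dist_eq_norm] at hy
      have hb := (hk c ρ hρ x hx hxE).2 x₀ hx₀ hx₀E y hyE hy8
      obtain ⟨k, hk1, hk2⟩ := mem_shell_of_lt hρ hy8
      have hw0 : 0 ≤ weight (topDeriv m A) c ρ y := zero_le_one.trans (one_le_weight _ _ _ _)
      refine le_trans ?_ (ENNReal.le_tsum k)
      rw [indicator_of_mem (by rwa [mem_closedBall, dist_eq_norm])]
      have hb' : ‖multiKernel m A K x y - multiKernel m A K x₀ y‖ ≤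
          C₁ * ((2 ^ k) ^ τ * (2 ^ k * ρ) ^ (δ - n)) * weight (topDeriv m A) c ρ y ^ l := by
        refine hb.trans ?_
        have e1 : (‖y - c‖ / ρ) ^ τ ≤ (2 ^ k) ^ τ :=
          Real.rpow_le_rpow_of_nonpos (by positivity) ((le_div_iff₀ hρ).2 hk1) (by linarith)
        have e2 : ‖y - c‖ ^ (δ - n) ≤ (2 ^ k * ρ) ^ (δ - n) :=
          Real.rpow_le_rpow_of_nonpos (by positivity) hk1 (by linarith)
        calc _ ≤ C₁ * weight (topDeriv m A) c ρ y ^ l * ((2 ^ k) ^ τ * (2 ^ k * ρ) ^ (δ - n)) := by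
              gcongr
          _ = _ := by ring
      calc _ ≤ ENNReal.ofReal (C₁ * ((2 ^ k) ^ τ * (2 ^ k * ρ) ^ (δ - n)) *
            weight (topDeriv m A) c ρ y ^ l) * u y := by
            gcongr
            rw [← ofReal_norm]
            exact ENNReal.ofReal_le_ofReal hb'
        _ = _ := by
            rw [hh, ENNReal.ofReal_mul (by positivity), ENNReal.ofReal_pow hw0, mul_assoc]
    calc _ ≤ ∫⁻ y in (closedBall c (8 * ρ))ᶜ, ∑' k : ℕ,
          (closedBall c (2 ^ (k + 1) * ρ)).indicator (fun y =>
            ENNReal.ofReal (C₁ * ((2 ^ k) ^ τ * (2 ^ k * ρ) ^ (δ - n))) * h y) y :=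
          lintegral_mono_ae ((ae_restrict_iff' measurableSet_closedBall.compl).2 hpt)
      _ ≤ ∫⁻ y, ∑' k : ℕ, (closedBall c (2 ^ (k + 1) * ρ)).indicator (fun y =>
            ENNReal.ofReal (C₁ * ((2 ^ k) ^ τ * (2 ^ k * ρ) ^ (δ - n))) * h y) y :=
          lintegral_mono' Measure.restrict_le_self le_rfl
      _ = ∑' k : ℕ, ENNReal.ofReal (C₁ * ((2 ^ k) ^ τ * (2 ^ k * ρ) ^ (δ - n))) *
          ∫⁻ y in closedBall c (2 ^ (k + 1) * ρ), h y := by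
          rw [lintegral_tsum fun k => (hhm.const_mul _).indicator measurableSet_closedBall]
          refine tsum_congr fun k => ?_
          rw [lintegral_indicator measurableSet_closedBall,
            lintegral_const_mul' _ _ ENNReal.ofReal_ne_top]
      -- The powers (2^k ρ)^(δ-n) and (2^k ρ)^(n-δ) cancel; kernel decay 2^(kτ) and weight growth
      -- 2^(kη) leave a geometric series of ratio below 1.
      _ ≤ ∑' k : ℕ, ENNReal.ofReal Bf * N * ENNReal.ofReal ((2 : ℝ) ^ (τ + η)) ^ k := by
          refine ENNReal.tsum_le_tsum fun k => ?_
          have h2k : (1 : ℝ) ≤ 2 ^ (k + 1) := one_le_pow₀ (by norm_num)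
          refine (mul_le_mul_right (hhR (2 ^ (k + 1) * ρ)
            (le_mul_of_one_le_left hρ.le h2k)) _).trans (le_of_eq ?_)
          rw [← mul_assoc, ← ENNReal.ofReal_mul (by positivity),
            mul_right_comm (ENNReal.ofReal Bf),
            ← ENNReal.ofReal_pow (by positivity), ← ENNReal.ofReal_mul (by positivity)]
          congr 2
          have h2 : (0 : ℝ) < 2 ^ k := by positivity
          have e1 : ((2 : ℝ) ^ (k + 1)) ^ η = (2 ^ k) ^ η * 2 ^ η := by
            rw [pow_succ, Real.mul_rpow h2.le (by norm_num)]
          have e2 : ((2 : ℝ) ^ (k + 1) * ρ) ^ (n - δ) = 2 ^ (n - δ) * (2 ^ k * ρ) ^ (n - δ) := by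
            rw [← Real.mul_rpow (by norm_num) (by positivity)]
            congr 1; ring
          have e3 : (2 ^ k * ρ) ^ (δ - n) = ((2 ^ k * ρ) ^ (n - δ))⁻¹ := by
            rw [← Real.rpow_neg (by positivity), neg_sub]
          have e4 : ((2 : ℝ) ^ (τ + η)) ^ k = (2 ^ k) ^ τ * (2 ^ k) ^ η := by
            rw [← Real.rpow_natCast, ← Real.rpow_mul (by norm_num), mul_comm (τ + η),
              Real.rpow_mul (by norm_num), Real.rpow_natCast, Real.rpow_add h2]
          rw [mul_div_cancel_right₀ _ hρ.ne', e1, e2, e3, e4, hBf]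
          have h3 : (0 : ℝ) < (2 ^ k * ρ) ^ (n - δ) := by positivity
          field_simp
      _ = ENNReal.ofReal Bf * (1 - ENNReal.ofReal ((2 : ℝ) ^ (τ + η)))⁻¹ * N := by
          rw [ENNReal.tsum_mul_left, ENNReal.tsum_geometric]
          ring
      _ ≤ _ := by
          gcongr
          exact le_add_self

end Oscillation

/-! ### Minkowski's inequality for the ℓ^r norm. -/

section SequenceNorm

/-- The `ℓ^r` norm of a sequence in `[0, ∞]`. -/
def seqNorm (r : ℝ) (a : ℕ → ℝ≥0∞) : ℝ≥0∞ := (∑' i, a i ^ r) ^ (1 / r)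

variable {r : ℝ}

theorem seqNorm_mono (hr : 0 ≤ r) {a b : ℕ → ℝ≥0∞} (h : ∀ i, a i ≤ b i) :
    seqNorm r a ≤ seqNorm r b :=
  ENNReal.rpow_le_rpow (ENNReal.tsum_le_tsum fun i => ENNReal.rpow_le_rpow (h i) hr)
    (by positivity)

theorem le_seqNorm (hr : 0 < r) (a : ℕ → ℝ≥0∞) (i : ℕ) : a i ≤ seqNorm r a := by
  calc a i = (a i ^ r) ^ (1 / r) := by
        rw [← ENNReal.rpow_mul, mul_one_div_cancel hr.ne', ENNReal.rpow_one]
    _ ≤ _ := ENNReal.rpow_le_rpow (ENNReal.le_tsum i) (by positivity)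

theorem seqNorm_add_le (hr : 1 ≤ r) (a b : ℕ → ℝ≥0∞) :
    seqNorm r (fun i => a i + b i) ≤ seqNorm r a + seqNorm r b := by
  have h := ENNReal.lintegral_Lp_add_le (μ := Measure.count) (f := a) (g := b)
    (measurable_of_countable a).aemeasurable (measurable_of_countable b).aemeasurable hr
  simpa only [lintegral_count, seqNorm, Pi.add_apply] using h

theorem seqNorm_const_mul (hr : 0 < r) (c : ℝ≥0∞) (a : ℕ → ℝ≥0∞) :
    seqNorm r (fun i => c * a i) = c * seqNorm r a := by
  simp only [seqNorm, ENNReal.mul_rpow_of_nonneg _ _ hr.le, ENNReal.tsum_mul_left]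
  rw [ENNReal.mul_rpow_of_nonneg _ _ (by positivity), ← ENNReal.rpow_mul,
    mul_one_div_cancel hr.ne', ENNReal.rpow_one]

/-- The integral form of Minkowski's inequality for the `ℓ^r` norm. -/
theorem seqNorm_lintegral_le {α : Type*} [MeasurableSpace α] {μ : Measure α} (hr : 1 < r)
    {h : ℕ → α → ℝ≥0∞} (hh : ∀ i, AEMeasurable (h i) μ) :
    seqNorm r (fun i => ∫⁻ y, h i y ∂μ) ≤ ∫⁻ y, seqNorm r (fun i => h i y) ∂μ := by
  have hr0 : 0 < r := zero_lt_one.trans hr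
  rcases eq_or_ne (∫⁻ y, seqNorm r (fun i => h i y) ∂μ) ∞ with htop | htop
  · rw [htop]; exact le_top
  have hfin : ∀ i, ∫⁻ y, h i y ∂μ ≠ ∞ := fun i =>
    ((lintegral_mono fun y => le_seqNorm hr0 (fun i => h i y) i).trans_lt
      (lt_top_iff_ne_top.2 htop)).ne
  have hpq := Real.HolderConjugate.conjExponent hr
  have hfinset : ∀ s : Finset ℕ, (∑ i ∈ s, (∫⁻ y, h i y ∂μ) ^ r) ^ (1 / r) ≤
      ∫⁻ y, seqNorm r (fun i => h i y) ∂μ := by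
    intro s
    -- Duality: φ has ℓ^{r'} norm at most 1 on s and attains the finite ℓ^r norm of the integrals.
    -- The sum then goes under the integral, where Hölder applies pointwise.
    obtain ⟨φ, hφ, hφe⟩ := (NNReal.isGreatest_Lp s
      (fun i => (∫⁻ y, h i y ∂μ).toNNReal) hpq).1
    have e1 : (∑ i ∈ s, (∫⁻ y, h i y ∂μ) ^ r) ^ (1 / r) =
        ∑ i ∈ s, (∫⁻ y, h i y ∂μ) * φ i := by
      have := congrArg (fun t : ℝ≥0 => (t : ℝ≥0∞)) hφe
      simp only [ENNReal.ofNNReal_finsetSum, ENNReal.coe_mul, ENNReal.coe_toNNReal (hfin _)] at this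
      rw [this, ENNReal.coe_rpow_of_nonneg _ (by positivity), ENNReal.ofNNReal_finsetSum]
      simp only [ENNReal.coe_rpow_of_nonneg _ hr0.le, ENNReal.coe_toNNReal (hfin _)]
    rw [e1]
    simp only [← lintegral_mul_const' _ _ ENNReal.coe_ne_top]
    rw [← lintegral_finsetSum' _ fun i _ => (hh i).mul_const _]
    refine lintegral_mono fun y => (ENNReal.inner_le_Lp_mul_Lq s _ _ hpq).trans ?_
    calc _ ≤ seqNorm r (fun i => h i y) * 1 := by
          gcongr
          · exact ENNReal.rpow_le_rpow (ENNReal.sum_le_tsum s) (by positivity)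
          · refine ENNReal.rpow_le_one ?_ hpq.symm.one_div_nonneg
            have := ENNReal.coe_le_coe.2 hφ
            simpa only [ENNReal.ofNNReal_finsetSum, ENNReal.coe_rpow_of_nonneg _ hpq.symm.nonneg,
              ENNReal.coe_one] using this
      _ = _ := mul_one _
  have hc := (ENNReal.continuous_rpow_const (y := 1 / r)).tendsto
    (∑' i, (∫⁻ y, h i y ∂μ) ^ r)
  exact le_of_tendsto (hc.comp ENNReal.summable.hasSum) (Eventually.of_forall hfinset)

theorem aemeasurable_seqNorm {α : Type*} [MeasurableSpace α] {μ : Measure α}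
    {h : ℕ → α → ℝ≥0∞} (hh : ∀ i, AEMeasurable (h i) μ) :
    AEMeasurable (fun x => seqNorm r (fun i => h i x)) μ :=
  (AEMeasurable.tsum fun i => (hh i).pow_const r).pow_const _

/-- Reduces the vector-valued operator to the scalar function |f|_r; the kernel factors out because
it does not depend on i. -/
theorem seqNorm_enorm_integral_mul_le {n : ℕ} (hr : 1 < r) {μ : Measure (Rn n)} {k : Rn n → ℂ}
    {f : ℕ → Rn n → ℂ} (hk : AEStronglyMeasurable k μ) (hf : ∀ i, AEStronglyMeasurable (f i) μ) :
    seqNorm r (fun i => ‖∫ y, k y * f i y ∂μ‖ₑ) ≤ ∫⁻ y, ‖k y‖ₑ * vnorm r f y ∂μ := by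
  calc _ ≤ seqNorm r (fun i => ∫⁻ y, ‖k y‖ₑ * ‖f i y‖ₑ ∂μ) := by
        refine seqNorm_mono (by linarith) fun i => ?_
        simpa only [enorm_mul] using enorm_integral_le_lintegral_enorm (μ := μ)
          fun y => k y * f i y
    _ ≤ ∫⁻ y, seqNorm r (fun i => ‖k y‖ₑ * ‖f i y‖ₑ) ∂μ :=
        seqNorm_lintegral_le hr fun i => hk.enorm.mul (hf i).enorm
    _ = _ := lintegral_congr fun y => seqNorm_const_mul (by linarith) _ _

end SequenceNorm

/-! ### Joint measurability of the kernel and of the operator's values. -/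

section Measurability

variable {n l : ℕ}

theorem ae_fst_ne_snd (hn : 0 < n) : ∀ᵐ z : Rn n × Rn n, z.1 ≠ z.2 := by
  have : NeZero n := ⟨hn.ne'⟩
  have hd : MeasurableSet {z : Rn n × Rn n | z.1 ≠ z.2} :=
    (isClosed_eq continuous_fst continuous_snd).measurableSet.compl
  refine (Measure.ae_prod_iff_ae_ae hd).2 (Eventually.of_forall fun x => ?_)
  filter_upwards [compl_mem_ae_iff.2 (measure_singleton x)] with y hy
  exact fun h => hy h.symm

/-- Local integrability is given off the diagonal, which is a null set because n > 0. -/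
theorem IsFractionalKernel.aestronglyMeasurable (hn : 0 < n) {δ ε : ℝ} {K : Rn n → Rn n → ℂ}
    (hK : IsFractionalKernel δ ε K) :
    AEStronglyMeasurable (fun z : Rn n × Rn n => K z.1 z.2) volume := by
  have h := hK.locallyIntegrableOn.aestronglyMeasurable
  rwa [Measure.restrict_eq_self_of_ae_mem
    (s := {z : Rn n × Rn n | z.1 ≠ z.2}) (ae_fst_ne_snd hn)] at h

theorem aestronglyMeasurable_weakDeriv (α : Fin n → ℕ) (u : Rn n → ℂ) :
    AEStronglyMeasurable (weakDeriv α u) volume := by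
  unfold weakDeriv
  split_ifs with h
  · exact h.choose_spec.2.1.aestronglyMeasurable
  · exact aestronglyMeasurable_const

theorem aestronglyMeasurable_taylorRemainder (m : ℕ) {A : Rn n → ℂ}
    (hA : AEStronglyMeasurable A volume) :
    AEStronglyMeasurable (fun z : Rn n × Rn n => taylorRemainder m A z.1 z.2) volume := by
  refine hA.comp_fst.sub (Finset.aestronglyMeasurable_fun_sum _ fun k _ =>
    Finset.aestronglyMeasurable_fun_sum _ fun α _ => ?_)
  refine ((aestronglyMeasurable_weakDeriv α A).comp_snd.const_mul _).mul ?_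
  refine Continuous.aestronglyMeasurable ?_
  unfold mpow
  fun_prop

theorem aestronglyMeasurable_multiKernel (hn : 0 < n) {δ ε : ℝ} {K : Rn n → Rn n → ℂ}
    (hK : IsFractionalKernel δ ε K) (m : Fin l → ℕ) {A : Fin l → Rn n → ℂ}
    (hA : ∀ j, AEStronglyMeasurable (A j) volume) :
    AEStronglyMeasurable (fun z : Rn n × Rn n => multiKernel m A K z.1 z.2) volume := by
  refine AEStronglyMeasurable.mul ?_ (hK.aestronglyMeasurable hn)
  simp only [div_eq_mul_inv]
  refine (Finset.aestronglyMeasurable_fun_prod _ fun j _ =>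
    aestronglyMeasurable_taylorRemainder (m j) (hA j)).mul ?_
  refine Measurable.aestronglyMeasurable ?_
  fun_prop

theorem aemeasurable_vectorOp (r : ℝ) {k : Rn n → Rn n → ℂ}
    (hk : AEStronglyMeasurable (fun z : Rn n × Rn n => k z.1 z.2) volume)
    {f : ℕ → Rn n → ℂ} (hf : ∀ i, AEStronglyMeasurable (f i) volume) :
    AEMeasurable (vectorOp r k f) volume := by
  refine aemeasurable_seqNorm fun i => AEStronglyMeasurable.enorm ?_
  exact AEStronglyMeasurable.integral_prod_right'
    (f := fun z : Rn n × Rn n => k z.1 z.2 * f i z.2) (hk.mul (hf i).comp_snd)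

theorem aemeasurable_vnorm (r : ℝ) {f : ℕ → Rn n → ℂ}
    (hf : ∀ i, AEStronglyMeasurable (f i) volume) : AEMeasurable (vnorm r f) volume :=
  aemeasurable_seqNorm fun i => (hf i).enorm

theorem aemeasurable_lintegral_enorm_mul {k : Rn n → Rn n → ℂ}
    (hk : AEStronglyMeasurable (fun z : Rn n × Rn n => k z.1 z.2) volume) {u : Rn n → ℝ≥0∞}
    (hu : AEMeasurable u volume) (S : Set (Rn n)) :
    AEMeasurable (fun x => ∫⁻ y in S, ‖k x y‖ₑ * u y) volume := by
  have h : AEMeasurable (fun z : Rn n × Rn n => ‖k z.1 z.2‖ₑ * u z.2)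
      ((volume : Measure (Rn n)).prod (volume.restrict S)) := by
    refine (hk.enorm.mul hu.comp_snd).mono_ac ?_
    exact Measure.AbsolutelyContinuous.rfl.prod Measure.restrict_le_self.absolutelyContinuous
  exact h.lintegral_prod_right'

end Measurability

/-! ### Mean oscillation and well-definedness of the vector-valued operator. -/

section MeanOscillationOfVectorOp

variable {n l : ℕ} {r : ℝ}

theorem enorm_toReal_sub_toReal_le {a b t : ℝ≥0∞} (ha : a ≠ ∞) (hb : b ≠ ∞) (hab : a ≤ b + t)
    (hba : b ≤ a + t) : ‖a.toReal - b.toReal‖ₑ ≤ t := by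
  rcases eq_or_ne t ∞ with rfl | ht
  · exact le_top
  have h1 := ENNReal.toReal_mono (ENNReal.add_ne_top.2 ⟨hb, ht⟩) hab
  have h2 := ENNReal.toReal_mono (ENNReal.add_ne_top.2 ⟨ha, ht⟩) hba
  rw [ENNReal.toReal_add hb ht] at h1
  rw [ENNReal.toReal_add ha ht] at h2
  rw [Real.enorm_eq_ofReal_abs, ← ENNReal.ofReal_toReal ht]
  exact ENNReal.ofReal_le_ofReal (abs_sub_le_iff.2 ⟨by linarith, by linarith⟩)

/-- Splitting `k x · f` into a part on `S`, the difference `k x - k x₀` off `S`, and a constant. -/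
theorem vectorOp_le_add (hr : 1 < r) {k : Rn n → Rn n → ℂ} {f : ℕ → Rn n → ℂ}
    (hf : ∀ i, AEStronglyMeasurable (f i) volume) {S : Set (Rn n)} (hS : MeasurableSet S)
    {x x₀ : Rn n} (hkx : AEStronglyMeasurable (k x) volume)
    (hkx₀ : AEStronglyMeasurable (k x₀) volume)
    (hx : ∀ i, Integrable (fun y => k x y * f i y))
    (hx₀ : ∀ i, Integrable (fun y => k x₀ y * f i y)) :
    vectorOp r k f x ≤ seqNorm r (fun i => ‖∫ y in Sᶜ, k x₀ y * f i y‖ₑ) +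
        ((∫⁻ y in S, ‖k x y‖ₑ * vnorm r f y) +
          ∫⁻ y in Sᶜ, ‖k x y - k x₀ y‖ₑ * vnorm r f y) ∧
      seqNorm r (fun i => ‖∫ y in Sᶜ, k x₀ y * f i y‖ₑ) ≤ vectorOp r k f x +
        ((∫⁻ y in S, ‖k x y‖ₑ * vnorm r f y) +
          ∫⁻ y in Sᶜ, ‖k x y - k x₀ y‖ₑ * vnorm r f y) := by
  have hr1 := hr.le
  have hnear := seqNorm_enorm_integral_mul_le hr (μ := volume.restrict S) hkx.restrict
    fun i => (hf i).restrict
  have hfar := seqNorm_enorm_integral_mul_le hr (μ := volume.restrict Sᶜ)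
    (hkx.sub hkx₀).restrict fun i => (hf i).restrict
  have hsplit : ∀ i, ∫ y, k x y * f i y = (∫ y in Sᶜ, k x₀ y * f i y) +
      ((∫ y in S, k x y * f i y) + ∫ y in Sᶜ, (k x - k x₀) y * f i y) := by
    intro i
    have : ∫ y in Sᶜ, (k x - k x₀) y * f i y =
        (∫ y in Sᶜ, k x y * f i y) - ∫ y in Sᶜ, k x₀ y * f i y := by
      rw [← integral_sub (hx i).integrableOn (hx₀ i).integrableOn]
      exact integral_congr_ae (Eventually.of_forall fun y => sub_mul _ _ _)
    rw [this, ← integral_add_compl hS (hx i)]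
    ring
  have hrest : seqNorm r (fun i => ‖∫ y in S, k x y * f i y‖ₑ +
      ‖∫ y in Sᶜ, (k x - k x₀) y * f i y‖ₑ) ≤ (∫⁻ y in S, ‖k x y‖ₑ * vnorm r f y) +
          ∫⁻ y in Sᶜ, ‖k x y - k x₀ y‖ₑ * vnorm r f y :=
    (seqNorm_add_le hr1 _ _).trans (add_le_add hnear hfar)
  constructor
  · refine le_trans ?_ (add_le_add_right hrest _)
    refine le_trans ?_ (seqNorm_add_le hr1 _ _)
    refine seqNorm_mono (by linarith) fun i => ?_
    change ‖∫ y, k x y * f i y‖ₑ ≤ _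
    rw [hsplit i]
    exact (enorm_add_le _ _).trans (add_le_add_right (enorm_add_le _ _) _)
  · refine le_trans ?_ (add_le_add_right hrest _)
    refine le_trans ?_ (seqNorm_add_le hr1 (fun i => ‖kernelOp k (f i) x‖ₑ) _)
    refine seqNorm_mono (by linarith) fun i => ?_
    have : ∫ y in Sᶜ, k x₀ y * f i y = kernelOp k (f i) x -
        ((∫ y in S, k x y * f i y) + ∫ y in Sᶜ, (k x - k x₀) y * f i y) := by
      rw [kernelOp, hsplit i]; ring
    rw [this]
    exact enorm_sub_le.trans (add_le_add_right (enorm_add_le _ _) _)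

/-- The constant is the ℓ^r norm of the far integrals at one generic point x₀ of B, at which the
operator is defined. Taking ℓ^r norms is 1-Lipschitz, so scalar near and far bounds suffice. -/
theorem exists_lintegral_vectorOp_sub_le (hr : 1 < r) {k : Rn n → Rn n → ℂ}
    (hk : AEStronglyMeasurable (fun z : Rn n × Rn n => k z.1 z.2) volume) {f : ℕ → Rn n → ℂ}
    (hf : ∀ i, AEStronglyMeasurable (f i) volume) (hwd : WellDefined r k f)
    {B S E : Set (Rn n)} (hB : MeasurableSet B) (hB0 : volume B ≠ 0) (hS : MeasurableSet S)
    (hE : ∀ᵐ x, x ∈ E) {M : ℝ≥0∞}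
    (hfar : ∀ x ∈ B, x ∈ E → ∀ x₀ ∈ B, x₀ ∈ E →
      ∫⁻ y in Sᶜ, ‖k x y - k x₀ y‖ₑ * vnorm r f y ≤ M) :
    ∃ c₀ : ℝ, ∫⁻ x in B, ‖(vectorOp r k f x).toReal - c₀‖ₑ ≤
      (∫⁻ x in B, ∫⁻ y in S, ‖k x y‖ₑ * vnorm r f y) + M * volume B := by
  rcases eq_or_ne (∫⁻ x in B, ∫⁻ y in S, ‖k x y‖ₑ * vnorm r f y) ∞ with htop | htop
  · exact ⟨0, by rw [htop, top_add]; exact le_top⟩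
  have hu := aemeasurable_vnorm r hf
  have hnear : ∀ᵐ x, x ∈ B → ∫⁻ y in S, ‖k x y‖ₑ * vnorm r f y < ∞ :=
    (ae_restrict_iff' hB).1
      (ae_lt_top' (aemeasurable_lintegral_enorm_mul hk hu S).restrict htop)
  have hsec : ∀ᵐ x, AEStronglyMeasurable (k x) volume := by
    have : AEStronglyMeasurable (fun z : Rn n × Rn n => k z.1 z.2)
      ((volume : Measure (Rn n)).prod volume) := hk
    exact this.prodMk_left
  have hall := hnear.and (hsec.and (hE.and hwd))
  obtain ⟨x₀, hx₀B, hx₀n, hx₀k, hx₀E, hx₀i, hx₀f⟩ : ∃ x₀ ∈ B,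
      ∫⁻ y in S, ‖k x₀ y‖ₑ * vnorm r f y < ∞ ∧ AEStronglyMeasurable (k x₀) volume ∧ x₀ ∈ E ∧
      (∀ i, Integrable fun y => k x₀ y * f i y) ∧ vectorOp r k f x₀ < ∞ := by
    obtain ⟨x, hx, h⟩ := Frequently.exists
      ((frequently_ae_mem_iff.2 hB0).and_eventually hall)
    exact ⟨x, hx, h.1 hx, h.2⟩
  -- The splitting is used with x = x₀, where the difference term vanishes: the far part is at most
  -- the full value plus the near part, both finite at x₀.
  have hc₀ : seqNorm r (fun i => ‖∫ y in Sᶜ, k x₀ y * f i y‖ₑ) ≠ ∞ := by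
    refine ((vectorOp_le_add hr hf hS hx₀k hx₀k hx₀i hx₀i).2.trans_lt ?_).ne
    simp only [sub_self, enorm_zero, zero_mul, lintegral_zero, add_zero]
    exact ENNReal.add_lt_top.2 ⟨hx₀f, hx₀n⟩
  refine ⟨(seqNorm r (fun i => ‖∫ y in Sᶜ, k x₀ y * f i y‖ₑ)).toReal, ?_⟩
  calc _ ≤ ∫⁻ x in B, ((∫⁻ y in S, ‖k x y‖ₑ * vnorm r f y) + M) := by
        refine lintegral_mono_ae ((ae_restrict_iff' hB).2 ?_)
        filter_upwards [hall] with x ⟨_, hxk, hxE, hxi, hxf⟩ hxB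
        have h := vectorOp_le_add hr hf hS hxk hx₀k hxi hx₀i
        have hM := hfar x hxB hxE x₀ hx₀B hx₀E
        exact enorm_toReal_sub_toReal_le hxf.ne hc₀ (h.1.trans (by gcongr))
          (h.2.trans (by gcongr))
    _ = _ := by
        rw [lintegral_add_right _ measurable_const, setLIntegral_const]

theorem integrableOn_of_lintegral_enorm_sub {F : Rn n → ℝ} (hF : AEStronglyMeasurable F volume)
    {B : Set (Rn n)} (hB : volume B ≠ ∞) {c₀ : ℝ} (h : ∫⁻ x in B, ‖F x - c₀‖ₑ ≠ ∞) :
    IntegrableOn F B := by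
  have h1 : IntegrableOn (fun x => F x - c₀) B :=
    ⟨(hF.sub aestronglyMeasurable_const).restrict, lt_top_iff_ne_top.2 h⟩
  have h2 : IntegrableOn (fun _ : Rn n => c₀) B := integrableOn_const hB
  exact (h1.add h2).congr_fun_ae (Eventually.of_forall fun x => sub_add_cancel _ _)

theorem meanOsc_le_two_mul {F : Rn n → ℝ} {Q : Set (Rn n)} (hQ0 : volume Q ≠ 0)
    (hQ : volume Q ≠ ∞) (hF : IntegrableOn F Q) (c₀ : ℝ) :
    meanOsc F Q ≤ 2 * ((volume Q)⁻¹ * ∫⁻ x in Q, ‖F x - c₀‖ₑ) := by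
  have : IsFiniteMeasure (volume.restrict Q) := ⟨by simpa using hQ.lt_top⟩
  have : NeZero (volume.restrict Q) := ⟨by simpa using hQ0⟩
  have havg : ‖c₀ - ⨍ z in Q, F z‖ₑ ≤ (volume Q)⁻¹ * ∫⁻ x in Q, ‖F x - c₀‖ₑ := by
    have e : c₀ - ⨍ z in Q, F z = ⨍ z in Q, (c₀ - F z) := by
      rw [average_eq, average_eq, integral_sub (integrable_const _) hF, smul_sub,
        integral_const, smul_smul, inv_mul_cancel₀, one_smul]
      simpa [Measure.real, ENNReal.toReal_eq_zero_iff] using ⟨hQ0, hQ⟩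
    rw [e]
    calc _ ≤ _ := enorm_integral_le_lintegral_enorm _
      _ = _ := by
        rw [lintegral_smul_measure, Measure.restrict_apply_univ, smul_eq_mul]
        simp only [enorm_sub_rev]
  calc meanOsc F Q ≤ (volume Q)⁻¹ * ∫⁻ x in Q, (‖F x - c₀‖ₑ + ‖c₀ - ⨍ z in Q, F z‖ₑ) := by
        unfold meanOsc
        gcongr with x
        calc _ = ‖(F x - c₀) + (c₀ - ⨍ z in Q, F z)‖ₑ := by congr 1; ring
          _ ≤ _ := enorm_add_le _ _
    _ = (volume Q)⁻¹ * (∫⁻ x in Q, ‖F x - c₀‖ₑ) +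
        ((volume Q)⁻¹ * volume Q) * ‖c₀ - ⨍ z in Q, F z‖ₑ := by
        rw [lintegral_add_right _ measurable_const, setLIntegral_const]
        ring
    _ ≤ _ := by
        rw [ENNReal.inv_mul_cancel hQ0 hQ, one_mul, two_mul]
        gcongr

/-- Common source of (a) and (b): the growth hypothesis concerns only balls with the same centre c
and radius at least ρ. A cube of side d sits in the ball of radius ρ = n d/2 with comparable volume.
-/
theorem exists_meanOsc_vectorOp_le (hn : 0 < n) (hr : 1 < r) {δ ε : ℝ} (hδ : 0 < δ) (hδn : δ < n)
    (hε : 0 < ε) {K : Rn n → Rn n → ℂ} (hK : IsFractionalKernel δ ε K) {m : Fin l → ℕ}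
    (hm : ∀ j, 0 < m j) {A : Fin l → Rn n → ℂ}
    (hA : ∀ j, ∀ α : Fin n → ℕ, mlen α ≤ m j → ∃ g, HasWeakDeriv α (A j) g)
    (hA_bmo : ∀ i : TopIndex n m, MemBMO (topDeriv m A i)) {s : ℝ} (hs : 1 < s) :
    ∃ C : ℝ≥0, ∀ f : ℕ → Rn n → ℂ, (∀ i, AEStronglyMeasurable (f i) volume) →
      WellDefined r (multiKernel m A K) f → ∀ N : ℝ≥0∞, N ≠ ∞ → ∀ (c : Rn n) (ρ : ℝ), 0 < ρ →
      (∀ R, ρ ≤ R → (∫⁻ y in closedBall c R, vnorm r f y ^ s) ^ (1 / s) ≤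
        N * ENNReal.ofReal (R ^ (n / s - δ))) →
      IntegrableOn (fun x => (vectorOp r (multiKernel m A K) f x).toReal) (closedBall c ρ) ∧
      ∀ d, n * (d / 2) = ρ →
        meanOsc (fun x => (vectorOp r (multiKernel m A K) f x).toReal) (cube c d) ≤ C * N := by
  obtain ⟨C, E, hE, hC⟩ := exists_oscillation_bound hn hδn hε hK hm hA hA_bmo hs hδ
  set κ := volume (ball (0 : Rn n) 1) with hκ
  have hκ0 : κ ≠ 0 := (measure_ball_pos _ _ one_pos).ne'
  have hκt : κ ≠ ∞ := measure_ball_lt_top.ne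
  have hn0 : (0 : ℝ) < n := Nat.cast_pos.2 hn
  refine ⟨(2 * (C * (κ⁻¹ + 1) * ENNReal.ofReal ((n : ℝ) ^ n))).toNNReal,
    fun f hf hwd N hN c ρ hρ hR => ?_⟩
  have hAm : ∀ j, AEStronglyMeasurable (A j) volume := fun j => by
    obtain ⟨g, hg⟩ := hA j 0 (by simp [mlen])
    exact hg.1.aestronglyMeasurable
  have hk := aestronglyMeasurable_multiKernel hn hK m hAm
  obtain ⟨hnear, hfar⟩ := hC c ρ hρ (vnorm r f) (aemeasurable_vnorm r hf) N hR
  have hB0 := volume_closedBall_ne_zero c hρ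
  have hBt := volume_closedBall_ne_top c ρ
  obtain ⟨c₀, hc₀⟩ := exists_lintegral_vectorOp_sub_le hr hk hf hwd measurableSet_closedBall hB0
    measurableSet_closedBall hE hfar
  have hbound : ∫⁻ x in closedBall c ρ, ‖(vectorOp r (multiKernel m A K) f x).toReal - c₀‖ₑ ≤
      C * N * (κ⁻¹ + 1) * volume (closedBall c ρ) := by
    refine hc₀.trans ?_
    calc _ ≤ C * N * ENNReal.ofReal (ρ ^ n) + C * N * volume (closedBall c ρ) := by gcongr
      _ = C * N * (κ⁻¹ * volume (closedBall c ρ)) + C * N * volume (closedBall c ρ) := by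
          congr 2
          rw [volume_closedBall c hρ.le, mul_left_comm, ENNReal.inv_mul_cancel hκ0 hκt, mul_one]
      _ = _ := by ring
  have hCt : C * N * (κ⁻¹ + 1) * volume (closedBall c ρ) ≠ ∞ := by
    have : κ⁻¹ ≠ ∞ := ENNReal.inv_ne_top.2 hκ0
    finiteness
  have hint := integrableOn_of_lintegral_enorm_sub
    (aemeasurable_vectorOp r hk hf).ennreal_toReal.aestronglyMeasurable hBt
    (hbound.trans_lt (lt_top_iff_ne_top.2 hCt)).ne
  refine ⟨hint, fun d hd => ?_⟩
  have hd0 : 0 < d := by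
    by_contra h
    have : (n : ℝ) * (d / 2) ≤ 0 := mul_nonpos_of_nonneg_of_nonpos hn0.le (by linarith)
    linarith
  have hsub : cube c d ⊆ closedBall c ρ := hd ▸ cube_subset_closedBall c d
  have hsup : closedBall c (d / 2) ⊆ cube c d := by
    simpa [mul_div_cancel₀] using closedBall_subset_cube c (d / 2)
  have hQ0 : volume (cube c d) ≠ 0 := fun h =>
    volume_closedBall_ne_zero c (half_pos hd0) (measure_mono_null hsup h)
  have hQt : volume (cube c d) ≠ ∞ := measure_ne_top_of_subset hsub hBt
  have hvol : volume (closedBall c ρ) ≤ ENNReal.ofReal ((n : ℝ) ^ n) * volume (cube c d) := by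
    rw [← hd, volume_closedBall_mul c c hn0.le (half_pos hd0).le]
    gcongr
  have hcoe : ((2 * (C * (κ⁻¹ + 1) * ENNReal.ofReal ((n : ℝ) ^ n))).toNNReal : ℝ≥0∞) =
      2 * (C * (κ⁻¹ + 1) * ENNReal.ofReal ((n : ℝ) ^ n)) := by
    refine ENNReal.coe_toNNReal ?_
    have : κ⁻¹ ≠ ∞ := ENNReal.inv_ne_top.2 hκ0
    finiteness
  refine (meanOsc_le_two_mul hQ0 hQt (hint.mono_set hsub) c₀).trans ?_
  rw [hcoe]
  calc _ ≤ 2 * ((volume (cube c d))⁻¹ * (C * N * (κ⁻¹ + 1) *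
        (ENNReal.ofReal ((n : ℝ) ^ n) * volume (cube c d)))) := by
        gcongr
        exact (lintegral_mono_set hsub).trans (hbound.trans (mul_le_mul_right hvol _))
    _ = 2 * (C * (κ⁻¹ + 1) * ENNReal.ofReal ((n : ℝ) ^ n)) * N *
        ((volume (cube c d))⁻¹ * volume (cube c d)) := by ring
    _ = _ := by rw [ENNReal.inv_mul_cancel hQ0 hQt, mul_one]

/-- The near estimate alone suffices: for a large ball about 0, its 8-fold dilate contains the
support, and a finite double integral has finite inner integrals almost everywhere. -/
theorem wellDefined_of_hasCompactSupport (hn : 0 < n) (hr : 1 < r) {δ ε : ℝ} (hδ : 0 < δ)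
    (hδn : δ < n) (hε : 0 < ε) {K : Rn n → Rn n → ℂ} (hK : IsFractionalKernel δ ε K)
    {m : Fin l → ℕ} (hm : ∀ j, 0 < m j) {A : Fin l → Rn n → ℂ}
    (hA : ∀ j, ∀ α : Fin n → ℕ, mlen α ≤ m j → ∃ g, HasWeakDeriv α (A j) g)
    (hA_bmo : ∀ i : TopIndex n m, MemBMO (topDeriv m A i)) {s : ℝ} (hs : 1 < s)
    {f : ℕ → Rn n → ℂ} (hf : ∀ i, AEStronglyMeasurable (f i) volume)
    (hsupp : HasCompactSupport (vnorm r f)) {N : ℝ≥0∞} (hN : N ≠ ∞)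
    (hR : ∀ R, 1 ≤ R → (∫⁻ y in closedBall 0 R, vnorm r f y ^ s) ^ (1 / s) ≤
        N * ENNReal.ofReal (R ^ (n / s - δ))) :
    WellDefined r (multiKernel m A K) f := by
  obtain ⟨C, E, hE, hC⟩ := exists_oscillation_bound hn hδn hε hK hm hA hA_bmo hs hδ
  have hAm : ∀ j, AEStronglyMeasurable (A j) volume := fun j => by
    obtain ⟨g, hg⟩ := hA j 0 (by simp [mlen])
    exact hg.1.aestronglyMeasurable
  have hk := aestronglyMeasurable_multiKernel hn hK m hAm
  have hu := aemeasurable_vnorm r hf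
  have hsec : ∀ᵐ x, AEStronglyMeasurable (multiKernel m A K x) volume := by
    have : AEStronglyMeasurable (fun z : Rn n × Rn n => multiKernel m A K z.1 z.2)
      ((volume : Measure (Rn n)).prod volume) := hk
    exact this.prodMk_left
  have hnear : ∀ᵐ x, ∀ j : ℕ, x ∈ closedBall (0 : Rn n) (j + 1 : ℕ) →
      ∫⁻ y in closedBall 0 (8 * (j + 1 : ℕ)), ‖multiKernel m A K x y‖ₑ * vnorm r f y < ∞ := by
    refine ae_all_iff.2 fun j => (ae_restrict_iff' measurableSet_closedBall).1 ?_
    have hj : (1 : ℝ) ≤ (j + 1 : ℕ) := by push_cast; linarith [Nat.cast_nonneg (α := ℝ) j]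
    have h := (hC 0 (j + 1 : ℕ) (by linarith) (vnorm r f) hu N
      fun R hjR => hR R (hj.trans hjR)).1
    refine ae_lt_top' (aemeasurable_lintegral_enorm_mul hk hu _).restrict (h.trans_lt ?_).ne
    exact lt_top_iff_ne_top.2 (by finiteness)
  obtain ⟨R₀, hR₀⟩ := hsupp.isCompact.isBounded.subset_closedBall 0
  filter_upwards [hnear, hsec] with x hx hxk
  obtain ⟨j, hj⟩ := exists_nat_ge (max ‖x‖ R₀)
  have hj1 : ‖x‖ ≤ j := (le_max_left _ _).trans hj
  have hj2 : R₀ ≤ j := (le_max_right _ _).trans hj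
  have hj0 : (0 : ℝ) ≤ j := Nat.cast_nonneg j
  have hfin := hx j (by rw [mem_closedBall_zero_iff]; push_cast; linarith)
  rw [setLIntegral_eq_of_support_subset] at hfin
  · have hbd := seqNorm_enorm_integral_mul_le hr hxk hf
    refine ⟨fun i => ⟨hxk.mul (hf i), ?_⟩, hbd.trans_lt hfin⟩
    refine lt_of_le_of_lt (lintegral_mono fun y => ?_) hfin
    rw [enorm_mul]
    gcongr
    exact le_seqNorm (by linarith) (fun i => ‖f i y‖ₑ) i
  · intro y hy
    have : y ∈ closedBall (0 : Rn n) R₀ :=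
      hR₀ (subset_tsupport _ (right_ne_zero_of_mul hy))
    exact closedBall_subset_closedBall (by push_cast; linarith) this

end MeanOscillationOfVectorOp

/-! ### The two function spaces and the conclusion. -/

section Main

variable {n : ℕ}

theorem eLpNorm_ofReal_eq (u : Rn n → ℝ≥0∞) {s : ℝ} (hs : 0 < s) (μ : Measure (Rn n)) :
    eLpNorm u (ENNReal.ofReal s) μ = (∫⁻ y, u y ^ s ∂μ) ^ (1 / s) := by
  rw [eLpNorm_eq_lintegral_rpow_enorm_toReal (by simpa using hs) ENNReal.ofReal_ne_top,
    ENNReal.toReal_ofReal hs.le]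
  simp only [enorm_eq_self]

/-- For s = n/δ the exponent n/s - δ is zero, so the growth condition holds on every ball with N the
global norm. -/
theorem lintegral_closedBall_rpow_le_eLpNorm {δ : ℝ} (hn : 0 < n) (hδ : 0 < δ)
    (u : Rn n → ℝ≥0∞) (c : Rn n) (R : ℝ) :
    (∫⁻ y in closedBall c R, u y ^ (n / δ)) ^ (1 / (n / δ)) ≤
      eLpNorm u (ENNReal.ofReal (n / δ)) volume * ENNReal.ofReal (R ^ (n / (n / δ) - δ)) := by
  have hn0 : (0 : ℝ) < n := Nat.cast_pos.2 hn
  rw [div_div_cancel₀ hn0.ne', sub_self, Real.rpow_zero, ENNReal.ofReal_one, mul_one,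
    ← eLpNorm_ofReal_eq u (by positivity)]
  exact eLpNorm_mono_measure _ Measure.restrict_le_self

/-- The ball of radius R lies in Q(0,2R), which is admissible in the norm as soon as 2R > 1. -/
theorem lintegral_closedBall_rpow_le_herzNorm {δ p : ℝ} (hn : 0 < n) (hp : 0 < p)
    (u : Rn n → ℝ≥0∞) {R : ℝ} (hR : 1 / 2 < R) :
    (∫⁻ y in closedBall 0 R, u y ^ p) ^ (1 / p) ≤
      (herzNorm δ p u * ENNReal.ofReal (2 ^ (n / p - δ))) * ENNReal.ofReal (R ^ (n / p - δ)) := by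
  have hn0 : (0 : ℝ) < n := Nat.cast_pos.2 hn
  have h2R : 0 < 2 * R := by linarith
  have hexp : -(n : ℝ) * (1 / p - δ / n) = -(n / p - δ) := by field_simp
  have h : ENNReal.ofReal ((2 * R) ^ (-(n : ℝ) * (1 / p - δ / n))) *
      eLpNorm u (ENNReal.ofReal p) (volume.restrict (cube 0 (2 * R))) ≤ herzNorm δ p u :=
    le_iSup₂_of_le (2 * R) (by linarith) le_rfl
  calc _ = eLpNorm u (ENNReal.ofReal p) (volume.restrict (closedBall 0 R)) :=
        (eLpNorm_ofReal_eq u hp _).symm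
    _ ≤ eLpNorm u (ENNReal.ofReal p) (volume.restrict (cube 0 (2 * R))) :=
        eLpNorm_mono_measure _ (Measure.restrict_mono (closedBall_subset_cube 0 R) le_rfl)
    _ = ENNReal.ofReal ((2 * R) ^ (n / p - δ)) *
        (ENNReal.ofReal ((2 * R) ^ (-(n : ℝ) * (1 / p - δ / n))) *
          eLpNorm u (ENNReal.ofReal p) (volume.restrict (cube 0 (2 * R)))) := by
        rw [← mul_assoc, ← ENNReal.ofReal_mul (by positivity), hexp, ← Real.rpow_add h2R,
          add_neg_cancel, Real.rpow_zero, ENNReal.ofReal_one, one_mul]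
    _ ≤ ENNReal.ofReal ((2 * R) ^ (n / p - δ)) * herzNorm δ p u := by gcongr
    _ = _ := by
        rw [Real.mul_rpow (by norm_num) (by linarith), ENNReal.ofReal_mul (by positivity)]
        ring

theorem locallyIntegrable_of_integrableOn_closedBall {F : Rn n → ℝ}
    (h : ∀ R : ℝ, 1 ≤ R → IntegrableOn F (closedBall 0 R)) : LocallyIntegrable F := by
  intro x
  refine ⟨closedBall 0 (‖x‖ + 1), ?_, h _ (by linarith [norm_nonneg x])⟩
  refine mem_of_superset (closedBall_mem_nhds x one_pos) (closedBall_subset_closedBall' ?_)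
  rw [dist_zero_right, add_comm]

end Main

end

end FractionalMultilinear

open FractionalMultilinear in
theorem theorem1 (n : ℕ) (r δ ε p : ℝ) (hr : 1 < r) (hδ : 0 < δ) (hδn : δ < n) (hε : 0 < ε)
    (hp : 1 < p) (hpn : p < n / δ)
    (K : Rn n → Rn n → ℂ) (hK : IsFractionalKernel δ ε K)
    (l : ℕ) (m : Fin l → ℕ) (hm : ∀ j, 0 < m j)
    (A : Fin l → Rn n → ℂ)
    (hA : ∀ j, ∀ α : Fin n → ℕ, mlen α ≤ m j → ∃ g, HasWeakDeriv α (A j) g)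
    (hA_bmo : ∀ j, ∀ α : Fin n → ℕ, mlen α = m j → MemBMO (weakDeriv α (A j)))
    (hT : ∀ s t : ℝ, 1 < s → s < n / δ → 1 / t = 1 / s - δ / n → BoundedLsLt r s t K) :
    -- (a)
    ((∃ C : ℝ≥0, ∀ f : ℕ → Rn n → ℂ,
        (∀ i, AEStronglyMeasurable (f i) volume) →
        eLpNorm (vnorm r f) (ENNReal.ofReal (n / δ)) volume < ∞ →
        WellDefined r (multiKernel m A K) f →
        MemBMO (fun x => (vectorOp r (multiKernel m A K) f x).toReal) ∧
        bmoNorm (fun x => (vectorOp r (multiKernel m A K) f x).toReal)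
          ≤ C * eLpNorm (vnorm r f) (ENNReal.ofReal (n / δ)) volume) ∧
      (∀ f : ℕ → Rn n → ℂ,
        (∀ i, AEStronglyMeasurable (f i) volume) →
        eLpNorm (vnorm r f) (ENNReal.ofReal (n / δ)) volume < ∞ →
        HasCompactSupport (vnorm r f) →
        WellDefined r (multiKernel m A K) f)) ∧
    -- (b)
    ((∃ C : ℝ≥0, ∀ f : ℕ → Rn n → ℂ,
        (∀ i, AEStronglyMeasurable (f i) volume) →
        herzNorm δ p (vnorm r f) < ∞ →
        WellDefined r (multiKernel m A K) f →
        MemCMO (fun x => (vectorOp r (multiKernel m A K) f x).toReal) ∧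
        cmoNorm (fun x => (vectorOp r (multiKernel m A K) f x).toReal)
          ≤ C * herzNorm δ p (vnorm r f)) ∧
      (∀ f : ℕ → Rn n → ℂ,
        (∀ i, AEStronglyMeasurable (f i) volume) →
        herzNorm δ p (vnorm r f) < ∞ →
        HasCompactSupport (vnorm r f) →
        WellDefined r (multiKernel m A K) f)) := by
  have hn0 : (0 : ℝ) < n := hδ.trans hδn
  have hn : 0 < n := Nat.cast_pos.1 hn0
  have hn1 : (1 : ℝ) ≤ n := by exact_mod_cast hn
  have hs : 1 < n / δ := (one_lt_div hδ).2 hδn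
  have hp0 : 0 < p := zero_lt_one.trans hp
  have hA_top : ∀ i : TopIndex n m, MemBMO (topDeriv m A i) := fun i =>
    hA_bmo i.1 i.2.1 ((mem_piAntidiag_univ).1 i.2.2)
  have hherz : ∀ u : Rn n → ℝ≥0∞, herzNorm δ p u < ∞ →
      herzNorm δ p u * ENNReal.ofReal (2 ^ (n / p - δ)) ≠ ∞ := fun u hu =>
    ENNReal.mul_ne_top hu.ne ENNReal.ofReal_ne_top
  refine ⟨⟨?_, fun f hf hfin hsupp => ?_⟩, ⟨?_, fun f hf hfin hsupp => ?_⟩⟩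
  · obtain ⟨C, hC⟩ := exists_meanOsc_vectorOp_le hn hr hδ hδn hε hK hm hA hA_top hs
    refine ⟨C, fun f hf hfin hwd => ?_⟩
    have h := fun (c : Rn n) (ρ : ℝ) (hρ : 0 < ρ) => hC f hf hwd _ hfin.ne c ρ hρ
      fun R _ => lintegral_closedBall_rpow_le_eLpNorm hn hδ _ c R
    have hbmo : bmoNorm (fun x => (vectorOp r (multiKernel m A K) f x).toReal)
        ≤ C * eLpNorm (vnorm r f) (ENNReal.ofReal (n / δ)) volume :=
      iSup_le fun c => iSup₂_le fun d hd =>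
        (h c (n * (d / 2)) (mul_pos hn0 (half_pos hd))).2 d rfl
    exact ⟨⟨locallyIntegrable_of_integrableOn_closedBall fun R hR =>
      (h 0 R (by linarith)).1, hbmo.trans_lt (ENNReal.mul_lt_top ENNReal.coe_lt_top hfin)⟩, hbmo⟩
  · exact wellDefined_of_hasCompactSupport hn hr hδ hδn hε hK hm hA hA_top hs hf hsupp hfin.ne
      fun R _ => lintegral_closedBall_rpow_le_eLpNorm hn hδ _ 0 R
  · obtain ⟨C, hC⟩ := exists_meanOsc_vectorOp_le hn hr hδ hδn hε hK hm hA hA_top hp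
    refine ⟨C * Real.toNNReal (2 ^ (n / p - δ)), fun f hf hfin hwd => ?_⟩
    have h := fun (ρ : ℝ) (hρ : 1 / 2 < ρ) => hC f hf hwd _ (hherz _ hfin) 0 ρ (by linarith)
      fun R hR => lintegral_closedBall_rpow_le_herzNorm hn hp0 _ (hρ.trans_le hR)
    have hcmo : cmoNorm (fun x => (vectorOp r (multiKernel m A K) f x).toReal)
        ≤ (C * Real.toNNReal (2 ^ (n / p - δ)) : ℝ≥0) * herzNorm δ p (vnorm r f) := by
      refine iSup₂_le fun d hd => ((h (n * (d / 2)) ?_).2 d rfl).trans (le_of_eq ?_)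
      -- With d > 1 and n ≥ 1 the radius n d/2 exceeds 1/2, as the Herz bound requires.
      · nlinarith
      · rw [ENNReal.coe_mul, mul_comm (herzNorm _ _ _), ← mul_assoc]
        rfl
    exact ⟨⟨locallyIntegrable_of_integrableOn_closedBall fun R hR =>
      (h R (by linarith)).1, hcmo.trans_lt (ENNReal.mul_lt_top ENNReal.coe_lt_top hfin)⟩, hcmo⟩
  · exact wellDefined_of_hasCompactSupport hn hr hδ hδn hε hK hm hA hA_top hp hf hsupp
      (hherz _ hfin) fun R hR => lintegral_closedBall_rpow_le_herzNorm hn hp0 _ (by linarith)
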